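/- **Setting.** Let $d\ge 3$ and $n\ge 3$, let $V$ be a complex vector space of dimension $d$, and fix $e\in\bigwedge^d V$, $e^*\in\bigwedge^d V^*$ with $\langle e,e^*\rangle=1$, where $\langle v_1\wedge\cdots\wedge v_k,\,w_1\wedge\cdots\wedge w_k\rangle=\det(w_i(v_j))$ and different degrees are orthogonal; a top form $c$ has determinant $\det c=\langle c,e^*\rangle$. Let $\psi:\bigwedge V^*\to\bigwedge V$ be the linear isomorphism with $\langle\psi(w),\mu\rangle=\langle e,w\wedge\mu\rangle$ for all $\mu$, put $x\cap y=\psi(\psi^{-1}(x)\wedge\psi^{-1}(y))$, and for $x\in\bigwedge^pV$, $y\in\bigwedge^qV$ put $x\curlywedge y=x\wedge y$ if $p+q\le d$ and $x\curlywedge y=x\cap y$ if $p+q> d$. A covector $u\in V^*$ is regarded as the element $\psi(u)\in\bigwedge^{d-1}V$, and iterated products are evaluated from right to left. A *signature* of size $n$ is an $n$-periodic map $\sigma:\mathbb Z\to\{1,-1\}$. It is *$d$-admissible* if for all $j\in\mathbb Z$ and $0\le k\le d-1$ there is $j'\ge j$ with $\sum_{i=j}^{j'}\sigma(i)\equiv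 k \pmod d$. Let $V^\sigma$ be the product of $n$ factors, the $j$-th being $V$ if $\sigma(j)=1$ and $V^*$ if $\sigma(j)=-1$; $\mathrm{SL}(V)$ acts on it naturally, and $R_\sigma=\mathbb C[V^\sigma]^{\mathrm{SL}(V)}$ is the ring of invariant polynomial functions. For $\mathbf u=(u_1,\dots,u_n)\in V^\sigma$, extended by $u_{j+n}=u_j$, put $f_j(\mathbf u)=\det(u_j\curlywedge u_{j+1}\curlywedge\cdots\curlywedge u_{j'})$, where $j'\ge j$ is minimal with $\sum_{i=j}^{j'}\sigma(i)\equiv0\pmod d$, and $f=f_1f_2\cdots f_n$. A *decorated flag* is a tuple $G=(G^1,\dots,G^{d-1})$ of nonzero $G^k\in\bigwedge^kV$ such that for $1\le k<d-1$ there is $v\in V$ with $G^{k+1}=G^k\wedge v$; put $G^0=1$, $G^d=e$. Decorated flags $G,H$ are *in relative position $s_k$* if $G^i=H^i$ for $i\ne k$ and $G^k$ is not a multiple of $H^k$. Then $G^k=x\wedge G^{k-1}$ and $H^k=G^{k-1}\wedge y$ for some $x,y\in V$, and the *crossing value* is the scalar $c$ with $x\wedge G^{k-1}\wedge y=c\,G^{k+1}$.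 Let $\beta_\sigma=\rho_1\rho_2\cdots\rho_n$, where $\rho_j$ is the word $1\,2\cdots(d-1)$ if $\sigma(j)=1$ and $(d-1)\cdots 2\,1$ if $\sigma(j)=-1$, and the last letter of each $\rho_j$ is marked. The *cyclic decorated flag moduli space* $\mathfrak M(\beta_\sigma)$ is the set of tuples $(G_1,\dots,G_{s+1})$ of decorated flags, $s=n(d-1)$, with $G_{s+1}=G_1$, such that for $1\le t\le s$ the flags $G_t,G_{t+1}$ are in relative position $s_k$ with $k$ the $t$-th letter of $\beta_\sigma$, with crossing value $1$ if that letter is unmarked. It carries the natural diagonal action of $\mathrm{SL}(V)$. **Theorem.** Let $\sigma$ be a $d$-admissible signature of size $n$. Then $\mathfrak M(\beta_\sigma)$ is Zariski locally closed in the space of $(s+1)$-tuples of $(d-1)$-tuples of elements of $\bigwedge V$, we have $f\in R_\sigma$, and there is an $\mathrm{SL}(V)$-equivariant isomorphism of varieties $$\Phi:\mathfrak M(\beta_\sigma)\stackrel{\sim}{\longrightarrow}V^\sigma\setminus\{f=0\}.$$ Composition with $\Phi$ induces an isomorphism of $\mathbb C$-algebras $$R_\sigma[1/f]\cong\mathbb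 C[\mathfrak M(\beta_\sigma)]^{\mathrm{SL}(V)}$$ onto the invariant regular functions and, provided that $\mathfrak M(\beta_\sigma)$ is not empty (that is, $f\neq0$), an isomorphism of $\mathbb C$-algebras $$\mathrm{Frac}(R_\sigma)\cong\mathbb C(\mathfrak M(\beta_\sigma))^{\mathrm{SL}(V)}$$ onto the invariant rational functions. -/

import Mathlib

open scoped BigOperators

noncomputable section

namespace FlagModuli

/-! ## Quasi-affine varieties inside a complex vector space -/

section Varieties

variable (W : Type*) [AddCommGroup W] [Module ℂ W]

/-- The algebra of polynomial functions on a vector space: it is generated by the linear forms. -/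
def polyFun : Subalgebra ℂ (W → ℂ) :=
  Algebra.adjoin ℂ (Set.range fun (l : Module.Dual ℂ W) (w : W) => l w)

/-- The Zariski topology of a vector space, with the principal open sets `{p ≠ 0}` as basis. -/
@[reducible] def zariski : TopologicalSpace W :=
  TopologicalSpace.generateFrom {U | ∃ p ∈ polyFun W, U = {w | p w ≠ 0}}

variable {W}

/-- The Zariski topology of a subset of a vector space. -/
@[reducible] def zariskiOn (X : Set W) : TopologicalSpace X :=
  (zariski W).induced Subtype.val

/-- `φ` is regular at `x`: near `x` it is a quotient of two polynomial functions. -/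
def IsRegularAt {X : Set W} (φ : X → ℂ) (x : X) : Prop :=
  ∃ p ∈ polyFun W, ∃ q ∈ polyFun W, q x ≠ 0 ∧ ∀ y : X, q y ≠ 0 → φ y = p y / q y

theorem isRegularAt_const {X : Set W} (c : ℂ) (x : X) : IsRegularAt (fun _ : X => c) x :=
  ⟨algebraMap ℂ (W → ℂ) c, (polyFun W).algebraMap_mem c, 1, one_mem _, by simp, by simp⟩

theorem IsRegularAt.add {X : Set W} {φ ψ : X → ℂ} {x : X} (h : IsRegularAt φ x)
    (h' : IsRegularAt ψ x) : IsRegularAt (φ + ψ) x := by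
  obtain ⟨p, hp, q, hq, hqx, e⟩ := h
  obtain ⟨p', hp', q', hq', hqx', e'⟩ := h'
  refine ⟨p * q' + p' * q, add_mem (mul_mem hp hq') (mul_mem hp' hq), q * q', mul_mem hq hq',
    mul_ne_zero hqx hqx', fun y hy => ?_⟩
  have h1 : q y ≠ 0 := left_ne_zero_of_mul hy
  have h2 : q' y ≠ 0 := right_ne_zero_of_mul hy
  simp only [Pi.add_apply, Pi.mul_apply, e y h1, e' y h2]
  field_simp

theorem IsRegularAt.mul {X : Set W} {φ ψ : X → ℂ} {x : X} (h : IsRegularAt φ x)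
    (h' : IsRegularAt ψ x) : IsRegularAt (φ * ψ) x := by
  obtain ⟨p, hp, q, hq, hqx, e⟩ := h
  obtain ⟨p', hp', q', hq', hqx', e'⟩ := h'
  refine ⟨p * p', mul_mem hp hp', q * q', mul_mem hq hq', mul_ne_zero hqx hqx', fun y hy => ?_⟩
  have h1 : q y ≠ 0 := left_ne_zero_of_mul hy
  have h2 : q' y ≠ 0 := right_ne_zero_of_mul hy
  simp only [Pi.mul_apply, e y h1, e' y h2]
  field_simp

/-- A regular map of quasi-affine varieties: all its coordinate functions are regular. -/
def IsRegularMap {W' : Type*} [AddCommGroup W'] [Module ℂ W'] {X : Set W} {Y : Set W'}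
    (F : X → Y) : Prop :=
  ∀ (l : Module.Dual ℂ W') (x : X), IsRegularAt (fun y : X => l (F y : W')) x

/-- The filter on `X` generated by the dense Zariski open subsets. -/
def generic (X : Set W) : Filter X :=
  letI := zariskiOn X
  { sets := {s | ∃ U ⊆ s, IsOpen U ∧ Dense U}
    univ_sets := ⟨Set.univ, subset_rfl, isOpen_univ, dense_univ⟩
    sets_of_superset := fun ⟨U, hU, h⟩ hst => ⟨U, hU.trans hst, h⟩
    inter_sets := fun ⟨U, hU, ho, hd⟩ ⟨U', hU', ho', hd'⟩ =>
      ⟨U ∩ U', Set.inter_subset_inter hU hU', ho.inter ho', hd.inter_of_isOpen_left hd' ho⟩ }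

instance germAlgebra {α : Type*} (l : Filter α) : Algebra ℂ (l.Germ ℂ) :=
  Algebra.ofModule
    (fun r x y => Filter.Germ.inductionOn₂ x y fun f g =>
      congrArg Filter.Germ.ofFun (smul_mul_assoc r f g))
    (fun r x y => Filter.Germ.inductionOn₂ x y fun f g =>
      congrArg Filter.Germ.ofFun (mul_smul_comm r f g))

variable {G : Type*} [Group G] [MulAction G W]

/-- The algebra `ℂ[X]^G` of invariant regular functions on a `G`-stable subset `X`. -/
def regularInvariants (X : SubMulAction G W) : Subalgebra ℂ (↥(X : Set W) → ℂ) where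
  carrier := {φ | (∀ x, IsRegularAt φ x) ∧
    ∀ (g : G) (x : ↥(X : Set W)), φ ⟨g • (x : W), X.smul_mem g x.2⟩ = φ x}
  mul_mem' := fun ⟨h, i⟩ ⟨h', i'⟩ =>
    ⟨fun x => (h x).mul (h' x), fun g x => by simp only [Pi.mul_apply, i g x, i' g x]⟩
  add_mem' := fun ⟨h, i⟩ ⟨h', i'⟩ =>
    ⟨fun x => (h x).add (h' x), fun g x => by simp only [Pi.add_apply, i g x, i' g x]⟩
  algebraMap_mem' := fun c => ⟨fun x => isRegularAt_const c x, fun _ _ => rfl⟩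

/-- The algebra `ℂ(X)^G` of invariant rational functions on a `G`-stable subset `X`. A rational
function is a function that is regular on a dense open subset, up to equality on dense open
subsets; `g ∈ G` acts by `φ ↦ φ ∘ g⁻¹`. -/
def rationalInvariants (X : SubMulAction G W) :
    Subalgebra ℂ ((generic (X : Set W)).Germ ℂ) where
  carrier := {ξ | ∃ φ : ↥(X : Set W) → ℂ, (φ : (generic (X : Set W)).Germ ℂ) = ξ ∧
    (∀ᶠ x in generic (X : Set W), IsRegularAt φ x) ∧
    ∀ g : G, ∀ᶠ x : ↥(X : Set W) in generic (X : Set W),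
      φ ⟨g • (x : W), X.smul_mem g x.2⟩ = φ x}
  mul_mem' := by
    rintro _ _ ⟨φ, rfl, h, i⟩ ⟨φ', rfl, h', i'⟩
    refine ⟨φ * φ', rfl, ?_, fun g => ?_⟩
    · filter_upwards [h, h'] with x hx hx' using hx.mul hx'
    · filter_upwards [i g, i' g] with x hx hx'
      simp only [Pi.mul_apply, hx, hx']
  add_mem' := by
    rintro _ _ ⟨φ, rfl, h, i⟩ ⟨φ', rfl, h', i'⟩
    refine ⟨φ + φ', rfl, ?_, fun g => ?_⟩
    · filter_upwards [h, h'] with x hx hx' using hx.add hx'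
    · filter_upwards [i g, i' g] with x hx hx'
      simp only [Pi.add_apply, hx, hx']
  algebraMap_mem' := fun c => ⟨fun _ => c, by
      rw [Algebra.algebraMap_eq_smul_one]
      exact congrArg Filter.Germ.ofFun (funext fun _ => (mul_one c).symm),
    Filter.Eventually.of_forall fun x => isRegularAt_const c x,
    fun _ => Filter.Eventually.of_forall fun _ => rfl⟩

end Varieties

/-! ## Signatures -/

/-- A signature of size `n`: an `n`-periodic map `ℤ → {1, -1}`. A vertex `j` is black if
`σ j = 1` and white if `σ j = -1`. -/
structure Signature (n : ℕ) where
  toFun : ℤ → ℤˣ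
  periodic : ∀ j, toFun (j + n) = toFun j
  three_le : 3 ≤ n

namespace Signature

variable {n : ℕ} (σ : Signature n)

/-- The lengths `m ≥ 1` with `σ(j) + σ(j+1) + ⋯ + σ(j+m-1) ≡ k mod d`. -/
def hits (d : ℕ) (j k : ℤ) : Set ℕ :=
  {m | 1 ≤ m ∧ ∑ i ∈ Finset.range m, (σ.toFun (j + i) : ℤ) ≡ k [ZMOD d]}

/-- `σ` is `d`-admissible: from every `j`, all residues mod `d` are partial sums. -/
def IsAdmissible (d : ℕ) : Prop :=
  ∀ (j : ℤ) (k : ℕ), k < d → (σ.hits d j k).Nonempty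

/-- The smallest length of a segment starting at `j` that has sum `k` mod `d`. -/
def len (d : ℕ) (j k : ℤ) : ℕ := sInf (σ.hits d j k)

/-- The colour of the `p`-th position of `[1, n]`, the positions being numbered from `0`. -/
def colour (p : Fin n) : ℤˣ := σ.toFun ((p : ℕ) + 1)

/-- The element of `[1, n]` congruent to `j` mod `n`, as a position numbered from `0`. -/
def position (j : ℤ) : Fin n :=
  ⟨((j - 1) % n).toNat, by
    have := σ.three_le
    have h1 := Int.emod_nonneg (j - 1) (b := (n : ℤ)) (by omega)
    have h2 := Int.emod_lt_of_pos (j - 1) (b := (n : ℤ)) (by omega)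
    omega⟩

end Signature

/-! ## The mixed exterior algebra -/

section Exterior

variable (V : Type*) [AddCommGroup V] [Module ℂ V]

/-- The projection of the exterior algebra to its part of degree `k`. -/
def gradePart (k : ℕ) : ExteriorAlgebra ℂ V →ₗ[ℂ] ⋀[ℂ]^k V :=
  DirectSum.component ℂ ℕ (fun i => ⋀[ℂ]^i V) k ∘ₗ
    (DirectSum.decomposeLinearEquiv (fun i : ℕ => ⋀[ℂ]^i V)).toLinearMap

/-- The pairing between `⋀V` and `⋀V*`: it is `det (wᵢ(vⱼ))` on `⋀ᵏV × ⋀ᵏV*`, and distinct degrees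
are orthogonal. -/
def pairing : ExteriorAlgebra ℂ V →ₗ[ℂ] ExteriorAlgebra ℂ (Module.Dual ℂ V) →ₗ[ℂ] ℂ :=
  ∑ k ∈ Finset.range (Module.finrank ℂ V + 1),
    (exteriorPower.pairingDual ℂ V k).flip.compl₁₂ (gradePart V k)
      (gradePart (Module.Dual ℂ V) k)

/-- A volume form of a `d`-dimensional space and the dual volume form. -/
structure VolumeForm (d : ℕ) where
  e : ExteriorAlgebra ℂ V
  eDual : ExteriorAlgebra ℂ (Module.Dual ℂ V)
  e_mem : e ∈ ⋀[ℂ]^d V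
  eDual_mem : eDual ∈ ⋀[ℂ]^d (Module.Dual ℂ V)
  pairing_eq_one : pairing V e eDual = 1

end Exterior


section Identification

open Module

variable {V : Type*} [AddCommGroup V] [Module ℂ V]

theorem gradePart_of_mem {k : ℕ} {x : ExteriorAlgebra ℂ V} (hx : x ∈ ⋀[ℂ]^k V) :
    gradePart V k x = ⟨x, hx⟩ := by
  have := DirectSum.decompose_of_mem (fun i : ℕ => ⋀[ℂ]^i V) hx
  simp only [gradePart, LinearMap.comp_apply, LinearEquiv.coe_coe,
    DirectSum.decomposeLinearEquiv_apply, this]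
  change (DirectSum.of (fun i : ℕ => ⋀[ℂ]^i V) k ⟨x, hx⟩) k = _
  simp

theorem gradePart_of_mem_ne {k l : ℕ} (h : k ≠ l) {x : ExteriorAlgebra ℂ V}
    (hx : x ∈ ⋀[ℂ]^k V) : gradePart V l x = 0 := by
  have := DirectSum.decompose_of_mem (fun i : ℕ => ⋀[ℂ]^i V) hx
  simp only [gradePart, LinearMap.comp_apply, LinearEquiv.coe_coe,
    DirectSum.decomposeLinearEquiv_apply, this]
  change (DirectSum.of (fun i : ℕ => ⋀[ℂ]^i V) k ⟨x, hx⟩) l = _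
  exact DirectSum.of_eq_of_ne _ _ _ h.symm

theorem pairing_of_mem {k : ℕ} (hk : k ≤ finrank ℂ V) {x : ExteriorAlgebra ℂ V}
    {y : ExteriorAlgebra ℂ (Dual ℂ V)} (hx : x ∈ ⋀[ℂ]^k V) (hy : y ∈ ⋀[ℂ]^k (Dual ℂ V)) :
    pairing V x y = exteriorPower.pairingDual ℂ V k ⟨y, hy⟩ ⟨x, hx⟩ := by
  simp only [pairing, LinearMap.sum_apply, LinearMap.compl₁₂_apply, LinearMap.flip_apply]
  rw [Finset.sum_eq_single k]
  · rw [gradePart_of_mem hx, gradePart_of_mem hy]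
  · intro l _ hl
    rw [gradePart_of_mem_ne hl.symm hx, map_zero]
  · intro h
    exact absurd (Finset.mem_range.2 (Nat.lt_succ_of_le hk)) h

theorem pairing_of_mem_ne {k l : ℕ} (h : k ≠ l) {x : ExteriorAlgebra ℂ V}
    {y : ExteriorAlgebra ℂ (Dual ℂ V)} (hx : x ∈ ⋀[ℂ]^k V) (hy : y ∈ ⋀[ℂ]^l (Dual ℂ V)) :
    pairing V x y = 0 := by
  simp only [pairing, LinearMap.sum_apply, LinearMap.compl₁₂_apply, LinearMap.flip_apply]
  refine Finset.sum_eq_zero fun m _ => ?_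
  by_cases hm : k = m
  · subst hm
    rw [gradePart_of_mem_ne h.symm hy, map_zero, LinearMap.zero_apply]
  · rw [gradePart_of_mem_ne hm hx, map_zero]

theorem basis_mem {I : Type*} [LinearOrder I] {M : Type*} [AddCommGroup M] [Module ℂ M]
    (b : Basis I ℂ M) (s : Finset I) : b.ExteriorAlgebra s ∈ ⋀[ℂ]^s.card M := by
  rw [ExteriorAlgebra.basis_apply]
  exact (exteriorPower.ιMulti_family ℂ s.card b _).2

theorem pairing_basis [FiniteDimensional ℂ V] {n : ℕ} (b : Basis (Fin n) ℂ V)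
    (s t : Finset (Fin n)) :
    pairing V (b.ExteriorAlgebra s) (b.dualBasis.ExteriorAlgebra t) = if s = t then 1 else 0 := by
  have hn : finrank ℂ V = n := by simpa using finrank_eq_card_basis b
  by_cases hst : s.card = t.card
  · have hk : s.card ≤ finrank ℂ V := by
      rw [hn]; simpa using Finset.card_le_univ s
    have ht := basis_mem b.dualBasis t
    rw [← hst] at ht
    rw [pairing_of_mem hk (basis_mem b s) ht]
    have e1 : (⟨b.ExteriorAlgebra s, basis_mem b s⟩ : ⋀[ℂ]^s.card V) =
        exteriorPower.ιMulti_family ℂ s.card b (Set.powersetCard.ofCard rfl) :=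
      Subtype.ext (ExteriorAlgebra.basis_apply_ofCard b rfl)
    have e2 : (⟨b.dualBasis.ExteriorAlgebra t, ht⟩ : ⋀[ℂ]^s.card (Dual ℂ V)) =
        exteriorPower.ιMulti_family ℂ s.card b.coord (Set.powersetCard.ofCard hst.symm) := by
      refine Subtype.ext ((ExteriorAlgebra.basis_apply_ofCard b.dualBasis hst.symm).trans ?_)
      congr 2
      exact b.coe_dualBasis
    rw [e1, e2]
    change exteriorPower.ιMultiDual ℂ s.card b _ _ = _
    split_ifs with h
    · subst h
      exact exteriorPower.ιMultiDual_apply_diag ℂ _ b _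
    · refine exteriorPower.ιMultiDual_apply_nondiag ℂ _ b _ _ fun h' => h ?_
      exact (congrArg Subtype.val h').symm
  · rw [pairing_of_mem_ne hst (basis_mem b s) (basis_mem b.dualBasis t), if_neg]
    rintro rfl
    exact hst rfl

theorem pairing_bijective [FiniteDimensional ℂ V] : Function.Bijective (pairing V) := by
  let b := finBasis ℂ V
  have : Module.Finite ℂ (ExteriorAlgebra ℂ V) := Module.Finite.of_basis b.ExteriorAlgebra
  have : Module.Finite ℂ (ExteriorAlgebra ℂ (Dual ℂ V)) :=
    Module.Finite.of_basis b.dualBasis.ExteriorAlgebra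
  have key : pairing V =
      (b.ExteriorAlgebra.equiv b.dualBasis.ExteriorAlgebra.dualBasis (Equiv.refl _)).toLinearMap := by
    refine b.ExteriorAlgebra.ext fun s => b.dualBasis.ExteriorAlgebra.ext fun t => ?_
    rw [pairing_basis]
    simp [Finsupp.single_apply, eq_comm]
  rw [key]
  exact LinearEquiv.bijective _

variable {d : ℕ} (vol : VolumeForm V d)

/-- The identification map `ψ : ⋀V* → ⋀V`, which sends `w` to the element `x` with
`⟨x, μ⟩ = ⟨e, w ∧ μ⟩` for all `μ`. -/
def psi [FiniteDimensional ℂ V] : ExteriorAlgebra ℂ (Dual ℂ V) →ₗ[ℂ] ExteriorAlgebra ℂ V :=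
  (LinearEquiv.ofBijective (pairing V) pairing_bijective).symm.toLinearMap ∘ₗ
    (LinearMap.mul ℂ (ExteriorAlgebra ℂ (Dual ℂ V))).compr₂ (pairing V vol.e)

theorem pairing_psi [FiniteDimensional ℂ V] (w μ : ExteriorAlgebra ℂ (Dual ℂ V)) :
    pairing V (psi vol w) μ = pairing V vol.e (w * μ) := by
  have := (LinearEquiv.ofBijective (pairing V) pairing_bijective).apply_symm_apply
    ((LinearMap.mul ℂ (ExteriorAlgebra ℂ (Dual ℂ V))).compr₂ (pairing V vol.e) w)
  exact LinearMap.congr_fun this μ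

theorem VolumeForm.exists_eq_smul [FiniteDimensional ℂ V] (hV : finrank ℂ V = d)
    (b : Basis (Fin d) ℂ V) :
    ∃ c : ℂ, c ≠ 0 ∧ vol.e = c • b.ExteriorAlgebra Finset.univ := by
  have hmem : b.ExteriorAlgebra Finset.univ ∈ ⋀[ℂ]^d V := by
    simpa using basis_mem b Finset.univ
  have h1 : finrank ℂ (⋀[ℂ]^d V) = 1 := by rw [exteriorPower.finrank_eq, hV, Nat.choose_self]
  have h0 : (⟨_, hmem⟩ : ⋀[ℂ]^d V) ≠ 0 := fun h =>
    b.ExteriorAlgebra.ne_zero Finset.univ (congrArg Subtype.val h)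
  obtain ⟨c, hc⟩ := exists_smul_eq_of_finrank_eq_one h1 h0 ⟨vol.e, vol.e_mem⟩
  have hc' : vol.e = c • b.ExteriorAlgebra Finset.univ := (congrArg Subtype.val hc).symm
  refine ⟨c, ?_, hc'⟩
  rintro rfl
  have := vol.pairing_eq_one
  simp [hc'] at this

theorem psi_bijective [FiniteDimensional ℂ V] (hV : finrank ℂ V = d) :
    Function.Bijective (psi vol) := by
  let b : Basis (Fin d) ℂ V := finBasisOfFinrankEq ℂ V hV
  obtain ⟨c, hc, he⟩ := vol.exists_eq_smul hV b
  have : Module.Finite ℂ (ExteriorAlgebra ℂ V) := Module.Finite.of_basis b.ExteriorAlgebra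
  have : Module.Finite ℂ (ExteriorAlgebra ℂ (Dual ℂ V)) :=
    Module.Finite.of_basis b.dualBasis.ExteriorAlgebra
  have hdim : finrank ℂ (ExteriorAlgebra ℂ (Dual ℂ V)) = finrank ℂ (ExteriorAlgebra ℂ V) := by
    rw [finrank_eq_card_basis b.ExteriorAlgebra,
      finrank_eq_card_basis b.dualBasis.ExteriorAlgebra]
  have key : ∀ s t : Finset (Fin d), pairing V vol.e
      (b.dualBasis.ExteriorAlgebra t * b.dualBasis.ExteriorAlgebra sᶜ) ≠ 0 ↔ t = s := by
    intro s t
    by_cases hd : Disjoint t sᶜ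
    · obtain ⟨ε, hε⟩ : ∃ ε : ℤˣ, b.dualBasis.ExteriorAlgebra t *
          b.dualBasis.ExteriorAlgebra sᶜ = ε • b.dualBasis.ExteriorAlgebra (t.disjUnion sᶜ hd) :=
        ⟨_, ExteriorAlgebra.basis_mul_of_disjoint b.dualBasis
          (Set.powersetCard.ofCard (s := t) rfl) (Set.powersetCard.ofCard (s := sᶜ) rfl) hd⟩
      have hu : Finset.univ = t.disjUnion sᶜ hd ↔ t = s := by
        rw [Finset.disjUnion_eq_union]
        constructor
        · intro h
          refine Finset.Subset.antisymm
            (fun a ha => not_not.1 fun h' => Finset.disjoint_left.1 hd ha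
              (Finset.mem_compl.2 h')) (fun a ha => ?_)
          have := h ▸ Finset.mem_univ a
          rcases Finset.mem_union.1 this with h | h
          · exact h
          · exact absurd ha (Finset.mem_compl.1 h)
        · rintro rfl
          exact (Finset.union_compl t).symm
      rw [hε, he, Units.smul_def, map_zsmul, map_smul, LinearMap.smul_apply, pairing_basis]
      by_cases hts : t = s
      · rw [if_pos (hu.2 hts)]
        simp [hts, hc]
      · rw [if_neg (fun h => hts (hu.1 h))]
        simp [hts]
    · have := ExteriorAlgebra.basis_mul_of_not_disjoint b.dualBasis
        (Set.powersetCard.ofCard (s := t) rfl) (Set.powersetCard.ofCard (s := sᶜ) rfl) hd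
      rw [show b.dualBasis.ExteriorAlgebra t * b.dualBasis.ExteriorAlgebra sᶜ = _ from this]
      simp only [map_zero, ne_eq, not_true_eq_false, false_iff]
      rintro rfl
      exact hd disjoint_compl_right
  have hinj : Function.Injective (psi vol) := by
    rw [injective_iff_map_eq_zero]
    intro w hw
    refine b.dualBasis.ExteriorAlgebra.ext_elem fun s => ?_
    have h0 : pairing V vol.e (w * b.dualBasis.ExteriorAlgebra sᶜ) = 0 := by
      rw [← pairing_psi, hw, map_zero, LinearMap.zero_apply]
    rw [← b.dualBasis.ExteriorAlgebra.sum_repr w, Finset.sum_mul, map_sum,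
      Finset.sum_eq_single s] at h0
    · rw [smul_mul_assoc, map_smul, smul_eq_mul] at h0
      simpa using (mul_eq_zero.1 h0).resolve_right ((key s s).2 rfl)
    · intro t _ hts
      rw [smul_mul_assoc, map_smul, not_not.1 (fun h => hts ((key s t).1 h)), smul_zero]
    · simp
  exact ⟨hinj, (LinearMap.injective_iff_surjective_of_finrank_eq_finrank hdim).1 hinj⟩

end Identification

/-! ### The mixed wedge -/

section MixedWedge

open Module

variable {V : Type*} [AddCommGroup V] [Module ℂ V] [FiniteDimensional ℂ V] {d n : ℕ}
  (vol : VolumeForm V d)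

/-- The intersection product of `⋀V`, transported from the product of `⋀V*` by the bijection `ψ`. -/
def intersection (x y : ExteriorAlgebra ℂ V) : ExteriorAlgebra ℂ V :=
  psi vol (Function.invFun (psi vol) x * Function.invFun (psi vol) y)

/-- The mixed wedge: for `x` of degree `p` and `y` of degree `q` it is the exterior product if
`p + q ≤ d` and the intersection product if `p + q > d`. -/
def mixedWedge (x y : ExteriorAlgebra ℂ V) : ExteriorAlgebra ℂ V :=
  ∑ p ∈ Finset.range (d + 1), ∑ q ∈ Finset.range (d + 1),
    if p + q ≤ d then (gradePart V p x : ExteriorAlgebra ℂ V) * gradePart V q y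
    else intersection vol (gradePart V p x) (gradePart V q y)

/-- The configuration space `V^σ` of vectors at the black and covectors at the white positions. -/
def Conf (σ : Signature n) (V : Type*) [AddCommGroup V] [Module ℂ V] : Type _ :=
  ({p : Fin n // σ.colour p = 1} → V) × ({p : Fin n // σ.colour p = -1} → Dual ℂ V)

instance (σ : Signature n) : AddCommGroup (Conf σ V) :=
  inferInstanceAs (AddCommGroup (({p : Fin n // σ.colour p = 1} → V) ×
    ({p : Fin n // σ.colour p = -1} → Dual ℂ V)))

instance (σ : Signature n) : Module ℂ (Conf σ V) :=
  inferInstanceAs (Module ℂ (({p : Fin n // σ.colour p = 1} → V) ×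
    ({p : Fin n // σ.colour p = -1} → Dual ℂ V)))

/-- The action of `SL(V)` on `V^σ`: `g u` on vectors and `u ∘ g⁻¹` on covectors. -/
instance (σ : Signature n) : MulAction (SpecialLinearGroup ℂ V) (Conf σ V) where
  smul g u := (fun p => g (u.1 p),
    fun p => u.2 p ∘ₗ ((g⁻¹ : SpecialLinearGroup ℂ V) : V ≃ₗ[ℂ] V).toLinearMap)
  one_smul _ := rfl
  mul_smul g h u := by
    refine Prod.ext rfl (funext fun p => LinearMap.ext fun v => ?_)
    change u.2 p (((g * h)⁻¹ : SpecialLinearGroup ℂ V) v) =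
      u.2 p ((h⁻¹ : SpecialLinearGroup ℂ V) ((g⁻¹ : SpecialLinearGroup ℂ V) v))
    rw [mul_inv_rev]
    rfl

/-- The mixed Plücker ring `R_σ(V) = ℂ[V^σ]^{SL(V)}`. -/
def mixedPluckerRing (σ : Signature n) (V : Type*) [AddCommGroup V] [Module ℂ V]
    [FiniteDimensional ℂ V] : Subalgebra ℂ (Conf σ V → ℂ) where
  carrier := {p | p ∈ polyFun (Conf σ V) ∧
    ∀ (g : SpecialLinearGroup ℂ V) (u : Conf σ V), p (g • u) = p u}
  mul_mem' := fun ⟨h, i⟩ ⟨h', i'⟩ =>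
    ⟨mul_mem h h', fun g u => by simp only [Pi.mul_apply, i g u, i' g u]⟩
  add_mem' := fun ⟨h, i⟩ ⟨h', i'⟩ =>
    ⟨add_mem h h', fun g u => by simp only [Pi.add_apply, i g u, i' g u]⟩
  algebraMap_mem' := fun c => ⟨Subalgebra.algebraMap_mem _ c, fun _ _ => rfl⟩

/-- The entry `u_j`, `j ∈ ℤ`, extended periodically, as an element of the mixed exterior algebra:
covectors are identified with elements of degree `d - 1` by `ψ`. -/
def entry {σ : Signature n} (u : Conf σ V) (j : ℤ) : ExteriorAlgebra ℂ V :=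
  if h : σ.colour (σ.position j) = 1 then ExteriorAlgebra.ι ℂ (u.1 ⟨_, h⟩)
  else psi vol (ExteriorAlgebra.ι ℂ (u.2 ⟨_, (Int.units_eq_one_or _).resolve_left h⟩))

/-- The iterated mixed wedge `u_j ⋏ (u_{j+1} ⋏ (⋯ ⋏ u_{j+m-1}))` of `m` entries. -/
def segment {σ : Signature n} (u : Conf σ V) : ℤ → ℕ → ExteriorAlgebra ℂ V
  | _, 0 => 1
  | j, 1 => entry vol u j
  | j, m + 2 => mixedWedge vol (entry vol u j) (segment u (j + 1) (m + 1))

/-- The function `f_j`: the mixed wedge of the shortest segment from `j` with sum `0` mod `d`, a top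
form identified with its determinant `⟨·, e*⟩`. -/
def frozen (σ : Signature n) (j : ℤ) (u : Conf σ V) : ℂ :=
  pairing V (segment vol u j (σ.len d j 0)) vol.eDual

/-- The function `f = f_1 f_2 ⋯ f_n`. -/
def frozenProduct (σ : Signature n) (u : Conf σ V) : ℂ :=
  ∏ p : Fin n, frozen vol σ ((p : ℕ) + 1) u

/-- The generic configuration space `V^σ \ {f = 0}`. -/
def genericConf (σ : Signature n) : Set (Conf σ V) := {u | frozenProduct vol σ u ≠ 0}

end MixedWedge

/-! ## Decorated flags and their moduli spaces -/

section Flags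

open Module

variable {V : Type*} [AddCommGroup V] [Module ℂ V] {d n s : ℕ} (vol : VolumeForm V d)

/-- The action of `SL(V)` on the exterior algebra. -/
instance : MulAction (SpecialLinearGroup ℂ V) (ExteriorAlgebra ℂ V) where
  smul g x := ExteriorAlgebra.map (g : V ≃ₗ[ℂ] V).toLinearMap x
  one_smul x := by
    change ExteriorAlgebra.map (LinearMap.id : V →ₗ[ℂ] V) x = x
    rw [ExteriorAlgebra.map_id]
    rfl
  mul_smul g h x := by
    change ExteriorAlgebra.map ((g : V ≃ₗ[ℂ] V).toLinearMap ∘ₗ (h : V ≃ₗ[ℂ] V).toLinearMap) x =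
      ExteriorAlgebra.map _ (ExteriorAlgebra.map _ x)
    rw [← ExteriorAlgebra.map_comp_map]
    rfl

theorem smul_ext_def (g : SpecialLinearGroup ℂ V) (x : ExteriorAlgebra ℂ V) :
    g • x = ExteriorAlgebra.map (g : V ≃ₗ[ℂ] V).toLinearMap x := rfl

/-- The tuples `(F¹, …, F^{d-1})` of elements of the exterior algebra. -/
abbrev FlagTuple (V : Type*) [AddCommGroup V] [Module ℂ V] (d : ℕ) : Type _ :=
  Fin (d - 1) → ExteriorAlgebra ℂ V

/-- The part `F^k` of a tuple, with `F⁰ = 1` and with `F^d` the top form `e` of determinant `1`. -/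
def part (F : FlagTuple V d) (k : ℕ) : ExteriorAlgebra ℂ V :=
  if h : 1 ≤ k ∧ k ≤ d - 1 then F ⟨k - 1, by omega⟩ else if k = 0 then 1 else vol.e

/-- Decorated flags: tuples of nonzero `F^k ∈ ⋀ᵏV`, `1 ≤ k ≤ d - 1`, with
`F^{k+1} = F^k ∧ v` for some `v ∈ V`. -/
def IsDecoratedFlag (F : FlagTuple V d) : Prop :=
  (∀ k, 1 ≤ k → k ≤ d - 1 → part vol F k ∈ ⋀[ℂ]^k V ∧ part vol F k ≠ 0) ∧
  ∀ k, 1 ≤ k → k < d - 1 → ∃ v : V, part vol F (k + 1) = part vol F k * ExteriorAlgebra.ι ℂ v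

/-- `G` and `H` are in relative position `s_k`. -/
def RelPosition (G H : FlagTuple V d) (k : ℕ) : Prop :=
  (∀ i, 1 ≤ i → i ≤ d - 1 → i ≠ k → part vol G i = part vol H i) ∧
  ∀ c : ℂ, part vol G k ≠ c • part vol H k

/-- `z` is the wedge of `u ∈ ⋀ᵖV` and `v ∈ ⋀^qV` over `w ∈ ⋀ʳV`. -/
def IsWedgeOver (p q r : ℕ) (u v w z : ExteriorAlgebra ℂ V) : Prop :=
  ∃ u₁ ∈ ⋀[ℂ]^(p - r) V, ∃ v₁ ∈ ⋀[ℂ]^(q - r) V, u = u₁ * w ∧ v = w * v₁ ∧ z = u₁ * w * v₁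

/-- The crossing value of `G` and `H` (in relative position `s_k`) is `c`: the wedge of `G^k` and
`H^k` over `G^{k-1}` is `c` times `G^{k+1}`. -/
def HasCrossingValue (G H : FlagTuple V d) (k : ℕ) (c : ℂ) : Prop :=
  ∃ z, IsWedgeOver k k (k - 1) (part vol G k) (part vol H k) (part vol G (k - 1)) z ∧
    z = c • part vol G (k + 1)

/-- A marked word of length `s`. -/
structure MarkedWord (s : ℕ) where
  letter : Fin s → ℕ
  marked : Fin s → Prop

/-- The concatenation of `n` marked words of length `m`. -/
def MarkedWord.concat {m : ℕ} (w : Fin n → MarkedWord m) : MarkedWord (n * m) where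
  letter t := (w (finProdFinEquiv.symm t).1).letter (finProdFinEquiv.symm t).2
  marked t := (w (finProdFinEquiv.symm t).1).marked (finProdFinEquiv.symm t).2

/-- The word `1 2 ⋯ (d-1)` with the last letter marked. -/
def rho (d : ℕ) : MarkedWord (d - 1) where
  letter i := i + 1
  marked i := (i : ℕ) + 1 = d - 1

/-- The word `(d-1) ⋯ 2 1` with the last letter marked. -/
def rhoStar (d : ℕ) : MarkedWord (d - 1) where
  letter i := d - 1 - i
  marked i := (i : ℕ) + 1 = d - 1

/-- The marked word `β_σ = ρ_1 ρ_2 ⋯ ρ_n`. -/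
def Signature.word (σ : Signature n) (d : ℕ) : MarkedWord (n * (d - 1)) :=
  MarkedWord.concat fun p => if σ.colour p = 1 then rho d else rhoStar d

/-- Normalized cyclic decorations of a marked word `β`: tuples of decorated flags, equal at both
ends, consecutive ones being in the relative position given by the letter between them, with
crossing value `1` if that letter is unmarked. -/
def IsNormalizedCyclicDecoration (β : MarkedWord s) (D : Fin (s + 1) → FlagTuple V d) : Prop :=
  (∀ i, IsDecoratedFlag vol (D i)) ∧ D 0 = D (Fin.last s) ∧
  (∀ t : Fin s, RelPosition vol (D t.castSucc) (D t.succ) (β.letter t)) ∧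
  ∀ t : Fin s, ¬ β.marked t → HasCrossingValue vol (D t.castSucc) (D t.succ) (β.letter t) 1

theorem smul_ext_mem (g : SpecialLinearGroup ℂ V) {k : ℕ} {x : ExteriorAlgebra ℂ V}
    (hx : x ∈ ⋀[ℂ]^k V) : g • x ∈ ⋀[ℂ]^k V := by
  have h := Submodule.mem_map_of_mem
    (f := (ExteriorAlgebra.map (g : V ≃ₗ[ℂ] V).toLinearMap).toLinearMap) hx
  rw [ExteriorAlgebra.exteriorPower, Submodule.map_pow] at h
  refine pow_le_pow_left' (?_ : _ ≤ LinearMap.range (ExteriorAlgebra.ι ℂ : V →ₗ[ℂ] _)) k h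
  rintro _ ⟨_, ⟨v, rfl⟩, rfl⟩
  exact ⟨g v, (ExteriorAlgebra.map_apply_ι _ v).symm⟩

theorem smul_volume [FiniteDimensional ℂ V] (hV : finrank ℂ V = d) (g : SpecialLinearGroup ℂ V) :
    g • vol.e = vol.e := by
  let b : Basis (Fin d) ℂ V := finBasisOfFinrankEq ℂ V hV
  let L : ExteriorAlgebra ℂ V →ₗ[ℂ] ℂ := (pairing V).flip vol.eDual
  have hL : ∀ x ∈ ⋀[ℂ]^d V, L (g • x) = L x := by
    intro x hx
    rw [← ExteriorAlgebra.ιMulti_span_fixedDegree] at hx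
    induction hx using Submodule.span_induction with
    | mem x h =>
      obtain ⟨w, rfl⟩ := h
      have h1 := (L.compAlternatingMap (ExteriorAlgebra.ιMulti ℂ d)).eq_smul_basis_det b
      have h2 := fun w => DFunLike.congr_fun h1 w
      simp only [LinearMap.compAlternatingMap_apply, AlternatingMap.smul_apply] at h2
      rw [smul_ext_def, ExteriorAlgebra.map_apply_ιMulti, h2 (_ ∘ w), h2 w]
      have h3 := b.det_comp (g : V ≃ₗ[ℂ] V).toLinearMap w
      rw [SpecialLinearGroup.det_eq_one, one_mul] at h3
      rw [h3]
    | zero => rw [smul_ext_def, map_zero]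
    | add x y _ _ hx hy =>
      rw [smul_ext_def] at hx hy ⊢
      rw [map_add, map_add, map_add, hx, hy]
    | smul a x _ hx =>
      rw [smul_ext_def] at hx ⊢
      rw [map_smul, map_smul, map_smul, hx]
  have h1 : finrank ℂ (⋀[ℂ]^d V) = 1 := by rw [exteriorPower.finrank_eq, hV, Nat.choose_self]
  have he : L vol.e = 1 := vol.pairing_eq_one
  have h0 : (⟨_, vol.e_mem⟩ : ⋀[ℂ]^d V) ≠ 0 := fun h => by
    have h' : vol.e = 0 := congrArg Subtype.val h
    rw [h', map_zero] at he
    exact zero_ne_one he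
  obtain ⟨c, hc⟩ := exists_smul_eq_of_finrank_eq_one h1 h0 ⟨_, smul_ext_mem g vol.e_mem⟩
  have hc' : c • vol.e = g • vol.e := congrArg Subtype.val hc
  have := hL _ vol.e_mem
  rw [← hc', map_smul, he, smul_eq_mul, mul_one] at this
  rw [← hc', this, one_smul]

theorem smul_part [FiniteDimensional ℂ V] (hV : finrank ℂ V = d) (g : SpecialLinearGroup ℂ V)
    (F : FlagTuple V d) (k : ℕ) : part vol (g • F) k = g • part vol F k := by
  unfold part
  split_ifs
  · rfl
  · rw [smul_ext_def, map_one]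
  · exact (smul_volume vol hV g).symm

theorem smul_isDecoratedFlag [FiniteDimensional ℂ V] (hV : finrank ℂ V = d)
    (g : SpecialLinearGroup ℂ V) {F : FlagTuple V d} (h : IsDecoratedFlag vol F) :
    IsDecoratedFlag vol (g • F) := by
  refine ⟨fun k h1 h2 => ?_, fun k h1 h2 => ?_⟩
  · rw [smul_part vol hV]
    refine ⟨smul_ext_mem g (h.1 k h1 h2).1, fun h0 => (h.1 k h1 h2).2 ?_⟩
    have : g⁻¹ • g • part vol F k = g⁻¹ • (0 : ExteriorAlgebra ℂ V) := by rw [h0]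
    rwa [inv_smul_smul, smul_ext_def, map_zero] at this
  · obtain ⟨v, hv⟩ := h.2 k h1 h2
    refine ⟨g v, ?_⟩
    rw [smul_part vol hV, smul_part vol hV, hv, smul_ext_def, map_mul,
      ExteriorAlgebra.map_apply_ι]
    rfl

theorem smul_relPosition [FiniteDimensional ℂ V] (hV : finrank ℂ V = d)
    (g : SpecialLinearGroup ℂ V) {F H : FlagTuple V d} {k : ℕ} (h : RelPosition vol F H k) :
    RelPosition vol (g • F) (g • H) k := by
  refine ⟨fun i h1 h2 h3 => ?_, fun c hc => h.2 c ?_⟩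
  · rw [smul_part vol hV, smul_part vol hV, h.1 i h1 h2 h3]
  · rw [smul_part vol hV, smul_part vol hV, smul_ext_def, smul_ext_def, ← map_smul,
      ← smul_ext_def, ← smul_ext_def] at hc
    exact MulAction.injective g hc

theorem smul_hasCrossingValue [FiniteDimensional ℂ V] (hV : finrank ℂ V = d)
    (g : SpecialLinearGroup ℂ V) {F H : FlagTuple V d} {k : ℕ} {c : ℂ}
    (h : HasCrossingValue vol F H k c) : HasCrossingValue vol (g • F) (g • H) k c := by
  obtain ⟨z, ⟨x, hx, y, hy, e1, e2, e3⟩, e4⟩ := h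
  refine ⟨g • z, ⟨g • x, smul_ext_mem g hx, g • y, smul_ext_mem g hy, ?_, ?_, ?_⟩, ?_⟩
  · rw [smul_part vol hV, smul_part vol hV, e1]; exact map_mul _ _ _
  · rw [smul_part vol hV, smul_part vol hV, e2]; exact map_mul _ _ _
  · rw [smul_part vol hV, e3, smul_ext_def, map_mul, map_mul]; rfl
  · rw [smul_part vol hV, e4]; exact map_smul _ _ _

/-- The cyclic decorated flag moduli space `𝔐(β)`, with its action of `SL(V)`. -/
def cyclicModuli [FiniteDimensional ℂ V] (hV : finrank ℂ V = d) (β : MarkedWord s) :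
    SubMulAction (SpecialLinearGroup ℂ V) (Fin (s + 1) → FlagTuple V d) where
  carrier := {D | IsNormalizedCyclicDecoration vol β D}
  smul_mem' g _ := fun ⟨h1, h2, h3, h4⟩ =>
    ⟨fun i => smul_isDecoratedFlag vol hV g (h1 i), congrArg (g • ·) h2,
      fun t => smul_relPosition vol hV g (h3 t),
      fun t ht => smul_hasCrossingValue vol hV g (h4 t ht)⟩

/-- The space `𝔐(β_σ)`. -/
abbrev signatureModuli [FiniteDimensional ℂ V] (hV : finrank ℂ V = d) (σ : Signature n) :
    SubMulAction (SpecialLinearGroup ℂ V) (Fin (n * (d - 1) + 1) → FlagTuple V d) :=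
  cyclicModuli vol hV (σ.word d)

end Flags

end FlagModuli

end

open FlagModuli

/-! A decoration splits into n blocks of d-1 letters, one block for each vertex. Inside a block
every letter occurs once, so each part of the flag changes once on the way from the first flag A of
the block to its last flag B. For a black vertex, write A¹ = v: the crossing conditions at the
unmarked letters propagate this upwards to Aᵏ = v ∧ Bᵏ⁻¹. For a white vertex, write A^{d-1} = ψ(φ):
they propagate this downwards to Aᵏ = φ ∩ Bᵏ⁺¹. The marked letter carries only the relative
position, which amounts to v ∧ B^{d-1} ≠ 0, respectively φ ∩ B¹ ≠ 0. This is `isBlackBlock_of_rel`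
and `isWhiteBlock_of_rel`; conversely, two flags related in this way determine the flags between
them, and these satisfy all the conditions of the block.

A decoration therefore amounts to vectors and covectors u_j and flags F_j, periodic in j, with F_jᵏ
= u_j ⋏ F_{j+1}^{k-σ(j)} for 0 < k < d, together with n conditions of nonvanishing. The recursion,
started at (j, k), stops when the degree becomes 0 or d, where the part is 1 or e, and admissibility
makes it stop. Hence F_jᵏ is the product of the shortest segment from j with sum k mod d (`level`,
`eq_level`): the flags are polynomials in u, and the remaining conditions say that f_j(u) ≠ 0. In
the other direction, f(u) ≠ 0 forces all levels to be nonzero (`level_ne_zero`) and consecutive ones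
to divide each other (`exists_level_succ_eq`), so that the levels do form decorated flags.

Thus `blockCoord`, which reads off the u_j and is linear on the ambient space, and `decoration`,
which is polynomial, restrict to mutually inverse equivariant maps (`moduliModel`). Everything else
follows from such a pair of maps. Local closedness is the fixed point description `mem_iff`. A
regular function becomes polynomial after multiplication by a power of f, by the Nullstellensatz
(`exists_pow_mul_eq`). An invariant rational function is a reduced fraction of polynomials, whose
denominator is invariant up to a character of SL(V); there are no nontrivial characters, so
numerator and denominator are both invariant (`invariant_of_isRelPrime`, `character_eq_one`). -/

open scoped BigOperators

noncomputable section

namespace FlagModuli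

open Module

/-! ### Polynomial maps between vector spaces -/

section PolynomialMaps

variable {W W' : Type*} [AddCommGroup W] [Module ℂ W] [AddCommGroup W'] [Module ℂ W']

theorem linear_mem_polyFun (l : Dual ℂ W) : (fun w => l w) ∈ polyFun W :=
  Algebra.subset_adjoin ⟨l, rfl⟩

theorem const_mem_polyFun (c : ℂ) : (fun _ : W => c) ∈ polyFun W :=
  (polyFun W).algebraMap_mem c

theorem sum_mem_polyFun {ι : Type*} (s : Finset ι) {f : ι → W → ℂ}
    (h : ∀ i ∈ s, f i ∈ polyFun W) : (fun w => ∑ i ∈ s, f i w) ∈ polyFun W := by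
  convert sum_mem (S := polyFun W) h using 1
  ext w
  simp

/-- A polynomial map of vector spaces. -/
def IsPolyMap (F : W → W') : Prop :=
  ∀ l : Dual ℂ W', (fun w => l (F w)) ∈ polyFun W

theorem IsPolyMap.comp_mem {F : W → W'} (hF : IsPolyMap F) {p : W' → ℂ} (hp : p ∈ polyFun W') :
    (fun w => p (F w)) ∈ polyFun W := by
  refine Algebra.adjoin_induction (p := fun p _ => (fun w => p (F w)) ∈ polyFun W)
    ?_ ?_ ?_ ?_ hp
  · rintro _ ⟨l, rfl⟩
    exact hF l
  · exact fun c => const_mem_polyFun c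
  · exact fun _ _ _ _ h h' => add_mem h h'
  · exact fun _ _ _ _ h h' => mul_mem h h'

theorem isPolyMap_linear (L : W →ₗ[ℂ] W') : IsPolyMap L :=
  fun l => linear_mem_polyFun (l ∘ₗ L)

theorem isPolyMap_const (c : W') : IsPolyMap (fun _ : W => c) :=
  fun l => const_mem_polyFun (l c)

/-- Expanding the left argument in a basis suffices, so only the left factor has to be
finite-dimensional. In the applications it is V or V*, and the right factor is the exterior algebra.
-/
theorem IsPolyMap.bilinear {M N : Type*} [AddCommGroup M] [Module ℂ M] [FiniteDimensional ℂ M]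
    [AddCommGroup N] [Module ℂ N] (B : M →ₗ[ℂ] N →ₗ[ℂ] W') {F : W → M} {F' : W → N}
    (hF : IsPolyMap F) (hF' : IsPolyMap F') : IsPolyMap (fun w => B (F w) (F' w)) := by
  intro l
  let b := finBasis ℂ M
  have h : (fun w => l (B (F w) (F' w))) =
      fun w => ∑ i, b.coord i (F w) * (l ∘ₗ B (b i)) (F' w) := by
    ext w
    conv_lhs => rw [← b.sum_repr (F w)]
    simp only [map_sum, map_smul, LinearMap.sum_apply, LinearMap.smul_apply, smul_eq_mul,
      Basis.coord_apply, LinearMap.comp_apply]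
  rw [h]
  exact sum_mem_polyFun _ fun i _ => mul_mem (hF _) (hF' _)

theorem isPolyMap_pi {ι : Type*} [Finite ι] {M : ι → Type*} [∀ i, AddCommGroup (M i)]
    [∀ i, Module ℂ (M i)] {F : W → ∀ i, M i} (h : ∀ i, IsPolyMap (fun w => F w i)) :
    IsPolyMap F := by
  classical
  have := Fintype.ofFinite ι
  intro l
  have h' : (fun w => l (F w)) = fun w => ∑ i, (l ∘ₗ LinearMap.single ℂ M i) (F w i) := by
    ext w
    simp only [LinearMap.comp_apply, ← map_sum]
    congr 1
    exact (LinearMap.sum_single_apply M (F w)).symm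
  rw [h']
  exact sum_mem_polyFun _ fun i _ => h i _

end PolynomialMaps

/-! ### Polynomial functions as a polynomial ring; the Nullstellensatz -/

section PolynomialRing

variable {W : Type*} [AddCommGroup W] [Module ℂ W] {ι : Type*}

theorem aeval_coord_apply (b : Basis ι ℂ W) (p : MvPolynomial ι ℂ) (w : W) :
    MvPolynomial.aeval (fun i => (fun w => b.repr w i : W → ℂ)) p w =
      MvPolynomial.eval (b.repr w) p := by
  induction p using MvPolynomial.induction_on with
  | C a => simp
  | add p q hp hq => simp [hp, hq]
  | mul_X p i hp => simp [hp]

variable [Fintype ι]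

theorem polyFun_eq_range (b : Basis ι ℂ W) :
    polyFun W = (MvPolynomial.aeval (R := ℂ) (fun i => (fun w => b.repr w i : W → ℂ))).range := by
  rw [← Algebra.adjoin_range_eq_range_aeval]
  refine le_antisymm (Algebra.adjoin_le ?_) (Algebra.adjoin_mono ?_)
  · rintro _ ⟨l, rfl⟩
    have h : (fun w => l w) = ∑ i, l (b i) • (fun w => b.repr w i : W → ℂ) := by
      ext w
      conv_lhs => rw [← b.sum_repr w]
      simp only [map_sum, map_smul, smul_eq_mul, Finset.sum_apply, Pi.smul_apply, mul_comm]
    change (fun w => l w) ∈ _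
    rw [h]
    exact sum_mem fun i _ => Subalgebra.smul_mem _ (Algebra.subset_adjoin (Set.mem_range_self i)) _
  · rintro _ ⟨i, rfl⟩
    exact ⟨b.coord i, rfl⟩

/-- Polynomial functions are polynomials in the coordinates. -/
def polyFunEquiv (b : Basis ι ℂ W) : MvPolynomial ι ℂ ≃ₐ[ℂ] polyFun W :=
  (AlgEquiv.ofInjective (MvPolynomial.aeval (R := ℂ) (fun i => (fun w => b.repr w i : W → ℂ)))
    (by
      -- Injectivity: ℂ is infinite, and every tuple of scalars is the coordinate tuple of a vector.
      intro p q h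
      refine MvPolynomial.funext fun x => ?_
      have := congrFun h (b.equivFun.symm x)
      rw [aeval_coord_apply, aeval_coord_apply] at this
      have hx : ⇑(b.repr (b.equivFun.symm x)) = x := b.equivFun.apply_symm_apply x
      rwa [hx] at this)).trans
  (Subalgebra.equivOfEq _ _ (polyFun_eq_range b).symm)

theorem polyFunEquiv_apply (b : Basis ι ℂ W) (p : MvPolynomial ι ℂ) (w : W) :
    (polyFunEquiv b p).1 w = MvPolynomial.eval (b.repr w) p :=
  aeval_coord_apply b p w

variable [FiniteDimensional ℂ W]

instance : IsDomain (polyFun W) :=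
  (polyFunEquiv (finBasis ℂ W)).symm.toMulEquiv.isDomain _

instance : UniqueFactorizationMonoid (polyFun W) :=
  (polyFunEquiv (finBasis ℂ W)).toMulEquiv.uniqueFactorizationMonoid inferInstance

/-- This is what turns a cofactor that is a unit, depending on a group element, into a scalar and
hence into a character. -/
theorem polyFun_unit_eq_const {p : polyFun W} (h : IsUnit p) :
    ∃ c : ℂ, p = algebraMap ℂ _ c := by
  have h' := h.map (polyFunEquiv (finBasis ℂ W)).symm
  rw [MvPolynomial.isUnit_iff_eq_C_of_isReduced] at h'
  obtain ⟨c, -, hc⟩ := h'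
  refine ⟨c, ?_⟩
  rw [← (polyFunEquiv (finBasis ℂ W)).apply_symm_apply p, hc]
  exact (polyFunEquiv (finBasis ℂ W)).commutes c

theorem mul_ne_zero_polyFun {p q : W → ℂ} (hp : p ∈ polyFun W) (hq : q ∈ polyFun W)
    (hp0 : p ≠ 0) (hq0 : q ≠ 0) : p * q ≠ 0 := by
  have h : (⟨p, hp⟩ : polyFun W) * ⟨q, hq⟩ ≠ 0 :=
    mul_ne_zero (fun h => hp0 (congrArg Subtype.val h)) (fun h => hq0 (congrArg Subtype.val h))
  exact fun h' => h (Subtype.ext h')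

/-- The Nullstellensatz for polynomial functions. -/
theorem exists_pow_mem_of_forall_exists (I : Ideal (polyFun W)) (f : polyFun W)
    (h : ∀ w, f.1 w ≠ 0 → ∃ q ∈ I, q.1 w ≠ 0) : ∃ N : ℕ, f ^ N ∈ I := by
  let b := finBasis ℂ W
  let E := polyFunEquiv b
  -- The hypothesis says that f vanishes on the zero locus of I.
  have key : E.symm f ∈ (I.comap (E : MvPolynomial _ ℂ →+* polyFun W)).radical := by
    rw [← MvPolynomial.vanishingIdeal_zeroLocus_eq_radical (K := ℂ),
      MvPolynomial.mem_vanishingIdeal_iff]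
    intro x hx
    rw [MvPolynomial.mem_zeroLocus_iff] at hx
    let w := b.equivFun.symm x
    have hw : ⇑(b.repr w) = x := b.equivFun.apply_symm_apply x
    have hE : ∀ p : polyFun W, MvPolynomial.aeval x (E.symm p) = p.1 w := by
      intro p
      conv_rhs => rw [← E.apply_symm_apply p]
      rw [polyFunEquiv_apply, hw]
      rfl
    rw [hE]
    by_contra h0
    obtain ⟨q, hq, hq0⟩ := h w h0
    refine hq0 ?_
    rw [← hE]
    refine hx _ ?_
    rw [Ideal.mem_comap]
    change E (E.symm q) ∈ I
    rwa [E.apply_symm_apply]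
  obtain ⟨N, hN⟩ := key
  refine ⟨N, ?_⟩
  rw [Ideal.mem_comap, map_pow] at hN
  change (E (E.symm f)) ^ N ∈ I at hN
  rwa [E.apply_symm_apply] at hN

end PolynomialRing

/-! ### The Zariski topology -/

section ZariskiTopology

variable {W : Type*} [AddCommGroup W] [Module ℂ W]

theorem zariski_isTopologicalBasis :
    @TopologicalSpace.IsTopologicalBasis W (zariski W)
      {U | ∃ p ∈ polyFun W, U = {w | p w ≠ 0}} := by
  let _ := zariski W
  refine ⟨?_, ?_, rfl⟩
  · rintro _ ⟨p, hp, rfl⟩ _ ⟨q, hq, rfl⟩ x ⟨hx, hx'⟩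
    refine ⟨_, ⟨p * q, mul_mem hp hq, rfl⟩, mul_ne_zero hx hx', fun y hy => ?_⟩
    exact ⟨left_ne_zero_of_mul hy, right_ne_zero_of_mul hy⟩
  · refine Set.eq_univ_of_forall fun x => ⟨_, ⟨1, one_mem _, rfl⟩, ?_⟩
    simp

theorem isOpen_zariski_ne {p : W → ℂ} (hp : p ∈ polyFun W) :
    @IsOpen _ (zariski W) {w | p w ≠ 0} :=
  TopologicalSpace.isOpen_generateFrom_of_mem ⟨p, hp, rfl⟩

theorem isClosed_zariski_eq {p q : W → ℂ} (hp : p ∈ polyFun W) (hq : q ∈ polyFun W) :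
    @IsClosed _ (zariski W) {w | p w = q w} := by
  let _ := zariski W
  refine ⟨?_⟩
  convert isOpen_zariski_ne (sub_mem hp hq) using 1
  ext w
  simp [sub_eq_zero]

theorem mem_generic_iff {X : Set W} {s : Set X} :
    s ∈ generic X ↔ ∃ U ⊆ s, @IsOpen _ (zariskiOn X) U ∧ @Dense _ (zariskiOn X) U := Iff.rfl

end ZariskiTopology

/-! ### Regular functions on a set modelled on a principal open set -/

section QuasiAffine

variable {W U G : Type*} [AddCommGroup W] [Module ℂ W] [AddCommGroup U] [Module ℂ U]
  [Group G] [MulAction G W] [MulAction G U]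

/-- A `G`-stable subset `X` of `W` that is identified by polynomial maps with the principal open
subset `{f ≠ 0}` of a representation `U` of `G`. -/
structure PrincipalOpenModel (X : SubMulAction G W) (f : U → ℂ) where
  param : U → W
  coord : W → U
  isPolyMap_param : IsPolyMap param
  isPolyMap_coord : IsPolyMap coord
  f_mem : f ∈ polyFun U
  f_smul : ∀ (g : G) u, f (g • u) = f u
  f_coord : ∀ D ∈ X, f (coord D) ≠ 0
  param_coord : ∀ D ∈ X, param (coord D) = D
  param_mem : ∀ u, f u ≠ 0 → param u ∈ X
  coord_param : ∀ u, f u ≠ 0 → coord (param u) = u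
  param_smul : ∀ (g : G) u, param (g • u) = g • param u

namespace PrincipalOpenModel

variable {X : SubMulAction G W} {f : U → ℂ} (P : PrincipalOpenModel X f)

include P

/-- The set is the fixed locus of `param ∘ coord` inside a principal open set. Since both maps are
polynomial on whole spaces, being fixed is a system of polynomial equations, and local closedness
follows. -/
theorem mem_iff (D : W) : D ∈ X ↔ f (P.coord D) ≠ 0 ∧ P.param (P.coord D) = D :=
  ⟨fun h => ⟨P.f_coord D h, P.param_coord D h⟩, fun h => h.2 ▸ P.param_mem _ h.1⟩

theorem isLocallyClosed : @IsLocallyClosed _ (zariski W) X.carrier := by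
  let _ := zariski W
  refine ⟨{D | f (P.coord D) ≠ 0}, ⋂ l : Dual ℂ W, {D | l (P.param (P.coord D)) = l D},
    isOpen_zariski_ne (P.isPolyMap_coord.comp_mem P.f_mem),
    isClosed_iInter fun l => isClosed_zariski_eq
      (P.isPolyMap_coord.comp_mem (P.isPolyMap_param l)) (linear_mem_polyFun l), ?_⟩
  ext D
  refine (P.mem_iff D).trans (and_congr_right fun _ => ?_)
  rw [Set.mem_iInter]
  rw [← sub_eq_zero, ← Module.forall_dual_apply_eq_zero_iff ℂ]
  simp only [map_sub, sub_eq_zero, Set.mem_ofPred_eq]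

/-- Equivariance is required of `param` only; its inverse inherits it. -/
theorem coord_smul (g : G) {D : W} (hD : D ∈ X) : P.coord (g • D) = g • P.coord D := by
  conv_lhs => rw [← P.param_coord D hD, ← P.param_smul]
  refine P.coord_param _ ?_
  rw [P.f_smul]
  exact P.f_coord D hD

/-- The isomorphism onto the principal open subset. -/
def equiv : ↥(X : Set W) ≃ ↥{u | f u ≠ 0} where
  toFun D := ⟨P.coord D, P.f_coord D D.2⟩
  invFun u := ⟨P.param u, P.param_mem u u.2⟩
  left_inv D := Subtype.ext (P.param_coord D D.2)
  right_inv u := Subtype.ext (P.coord_param u u.2)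

omit P in
theorem isRegularMap_of_isPolyMap {W W' : Type*} [AddCommGroup W] [Module ℂ W] [AddCommGroup W']
    [Module ℂ W'] {X : Set W} {Y : Set W'} {F : W → W'} (hF : IsPolyMap F) (Φ : X → Y)
    (h : ∀ x, (Φ x : W') = F x) : IsRegularMap Φ := fun l x =>
  ⟨_, hF l, 1, one_mem _, by simp, fun y _ => by simp [h]⟩

theorem isRegularMap_equiv : IsRegularMap P.equiv :=
  isRegularMap_of_isPolyMap P.isPolyMap_coord _ fun _ => rfl

theorem isRegularMap_equiv_symm : IsRegularMap P.equiv.symm :=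
  isRegularMap_of_isPolyMap P.isPolyMap_param _ fun _ => rfl

theorem isRegularAt_comp {p : U → ℂ} (hp : p ∈ polyFun U) (D : ↥(X : Set W)) :
    IsRegularAt (fun D : ↥(X : Set W) => p (P.coord D)) D :=
  ⟨_, P.isPolyMap_coord.comp_mem hp, 1, one_mem _, by simp, fun y _ => by simp⟩

theorem isRegularAt_inv_comp {p : U → ℂ} (hp : p ∈ polyFun U) (D : ↥(X : Set W))
    (h : p (P.coord D) ≠ 0) : IsRegularAt (fun D : ↥(X : Set W) => (p (P.coord D))⁻¹) D :=
  ⟨1, one_mem _, _, P.isPolyMap_coord.comp_mem hp, h, fun y _ => by simp⟩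

/-- Near each point, a regular function is a quotient of two polynomials in the coordinates. -/
theorem exists_quotient {φ : ↥(X : Set W) → ℂ} {D : ↥(X : Set W)} (h : IsRegularAt φ D) :
    ∃ p ∈ polyFun U, ∃ q ∈ polyFun U, q (P.coord D) ≠ 0 ∧
      ∀ D' : ↥(X : Set W), q (P.coord D') ≠ 0 → φ D' = p (P.coord D') / q (P.coord D') := by
  obtain ⟨p, hp, q, hq, hqD, e⟩ := h
  refine ⟨_, P.isPolyMap_param.comp_mem hp, _, P.isPolyMap_param.comp_mem hq, ?_, fun D' h' => ?_⟩
  · rwa [P.param_coord D D.2]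
  · simp only [P.param_coord D' D'.2] at h' ⊢
    exact e D' h'

/-- The polynomials q for which q φ is polynomial form an ideal. Local presentations of φ show that
this ideal has no common zero where f ≠ 0, so it contains a power of f. -/
theorem exists_pow_mul_eq [FiniteDimensional ℂ U] {φ : ↥(X : Set W) → ℂ}
    (hφ : ∀ D, IsRegularAt φ D) :
    ∃ N : ℕ, ∃ p ∈ polyFun U, ∀ D : ↥(X : Set W), f (P.coord D) ^ N * φ D = p (P.coord D) := by
  let I : Ideal (polyFun U) :=
    { carrier := {q | ∃ p ∈ polyFun U, ∀ D : ↥(X : Set W), q.1 (P.coord D) * φ D = p (P.coord D)}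
      zero_mem' := ⟨0, zero_mem _, fun D => by simp⟩
      add_mem' := by
        rintro q q' ⟨p, hp, e⟩ ⟨p', hp', e'⟩
        refine ⟨p + p', add_mem hp hp', fun D => ?_⟩
        simp only [Subalgebra.coe_add, Pi.add_apply, add_mul, e, e']
      smul_mem' := by
        rintro r q ⟨p, hp, e⟩
        refine ⟨r.1 * p, mul_mem r.2 hp, fun D => ?_⟩
        simp only [smul_eq_mul, Subalgebra.coe_mul, Pi.mul_apply, mul_assoc, e] }
  obtain ⟨N, p, hp, e⟩ := exists_pow_mem_of_forall_exists I ⟨f, P.f_mem⟩ fun u hu => by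
    obtain ⟨p, hp, q, hq, hq0, e⟩ := P.exists_quotient (hφ ⟨P.param u, P.param_mem u hu⟩)
    rw [P.coord_param u hu] at hq0
    -- The identity q φ = p is known only where q ≠ 0. After multiplication by q it holds
    -- everywhere, which is why the denominator is squared.
    refine ⟨⟨q * q, mul_mem hq hq⟩, ⟨p * q, mul_mem hp hq, fun D => ?_⟩, mul_ne_zero hq0 hq0⟩
    simp only [Pi.mul_apply]
    by_cases h : q (P.coord D) = 0
    · simp [h]
    · rw [e D h]
      field_simp
  exact ⟨N, p, hp, e⟩

section Invariants

variable {R : Subalgebra ℂ (U → ℂ)}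
  (hR : ∀ p, p ∈ R ↔ p ∈ polyFun U ∧ ∀ (g : G) u, p (g • u) = p u)

include hR

theorem comp_coord_smul {p : U → ℂ} (hp : p ∈ R) (g : G) (D : ↥(X : Set W)) :
    p (P.coord (g • (D : W))) = p (P.coord D) := by
  rw [P.coord_smul g D.2, ((hR p).1 hp).2]

/-- Pull-back of invariant polynomials to invariant regular functions. -/
def pullback : R →ₐ[ℂ] regularInvariants X where
  toFun r := ⟨fun D => r.1 (P.coord D), P.isRegularAt_comp ((hR _).1 r.2).1,
    fun g D => P.comp_coord_smul hR r.2 g D⟩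
  map_one' := rfl
  map_mul' _ _ := rfl
  map_zero' := rfl
  map_add' _ _ := rfl
  commutes' _ := rfl

theorem exists_localizationEquiv [FiniteDimensional ℂ U] (hf : f ∈ R) :
    ∃ E : Localization.Away (⟨f, hf⟩ : R) ≃ₐ[ℂ] regularInvariants X,
      ∀ (r : R) (D : ↥(X : Set W)), (E (algebraMap _ _ r)).1 D = r.1 (P.coord D) := by
  let _ : Algebra R (regularInvariants X) := (P.pullback hR).toRingHom.toAlgebra
  have hmap : ∀ (r : R) (D : ↥(X : Set W)),
      (algebraMap R (regularInvariants X) r).1 D = r.1 (P.coord D) := fun _ _ => rfl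
  have : IsScalarTower ℂ R (regularInvariants X) :=
    IsScalarTower.of_algebraMap_eq fun c => ((P.pullback hR).commutes c).symm
  have hloc : IsLocalization.Away (⟨f, hf⟩ : R) (regularInvariants X) := by
    refine ⟨?_, ?_, ?_⟩
    · rintro ⟨_, N, rfl⟩
      rw [map_pow]
      refine IsUnit.pow N (IsUnit.of_mul_eq_one ⟨fun D => (f (P.coord D))⁻¹,
        fun D => P.isRegularAt_inv_comp P.f_mem D (P.f_coord D D.2), fun g D => ?_⟩ ?_)
      · exact congrArg _ (P.comp_coord_smul hR hf g D)
      · refine Subtype.ext (funext fun D => ?_)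
        exact mul_inv_cancel₀ (P.f_coord D D.2)
    · rintro ⟨φ, hφ, hφG⟩
      obtain ⟨N, p, hp, e⟩ := P.exists_pow_mul_eq hφ
      -- The function φ controls p only where f ≠ 0, so p itself is not known to be invariant. The
      -- additional factor f makes the numerator vanish on the rest.
      refine ⟨⟨⟨f * p, (hR _).2 ⟨mul_mem P.f_mem hp, fun g u => ?_⟩⟩,
        ⟨⟨f, hf⟩ ^ (N + 1), N + 1, rfl⟩⟩, ?_⟩
      · simp only [Pi.mul_apply, P.f_smul]
        by_cases hu : f u = 0
        · rw [hu, zero_mul, zero_mul]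
        · congr 1
          have h1 := e ⟨P.param u, P.param_mem u hu⟩
          have h2 := e ⟨g • P.param u, X.smul_mem g (P.param_mem u hu)⟩
          rw [hφG g ⟨P.param u, P.param_mem u hu⟩] at h2
          simp only [P.coord_smul g (P.param_mem u hu), P.coord_param u hu, P.f_smul] at h1 h2
          rw [← h1, ← h2]
      · refine Subtype.ext (funext fun D => ?_)
        change φ D * (f (P.coord D)) ^ (N + 1) = f (P.coord D) * p (P.coord D)
        rw [← e]
        ring
    · intro r r' h
      -- Two polynomials with the same pull-back agree where f ≠ 0, so f annihilates their
      -- difference. This also covers the case f = 0.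
      refine ⟨⟨⟨f, hf⟩, 1, pow_one _⟩, Subtype.ext (funext fun u => ?_)⟩
      change f u * r.1 u = f u * r'.1 u
      by_cases hu : f u = 0
      · rw [hu, zero_mul, zero_mul]
      · have h' := congrFun (congrArg Subtype.val h) ⟨P.param u, P.param_mem u hu⟩
        rw [hmap, hmap, P.coord_param u hu] at h'
        rw [h']
  refine ⟨(IsLocalization.algEquiv (Submonoid.powers (⟨f, hf⟩ : R)) (Localization.Away _)
    (regularInvariants X)).restrictScalars ℂ, fun r D => ?_⟩
  rw [AlgEquiv.restrictScalars_apply, AlgEquiv.commutes, hmap]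

end Invariants

end PrincipalOpenModel

end QuasiAffine
-- Invariant rational functions
section RationalInvariants

variable {W U G : Type*} [AddCommGroup W] [Module ℂ W] [AddCommGroup U] [Module ℂ U]
  [Group G] [MulAction G W] [MulAction G U] [FiniteDimensional ℂ U]

omit [AddCommGroup U] [Module ℂ U] [FiniteDimensional ℂ U] in
/-- Over a group without characters, polynomials that are invariant up to scalars are invariant. -/
theorem eq_of_forall_exists_smul (hχ : ∀ χ : G →* ℂ, χ = 1) {q : U → ℂ} (hq : q ≠ 0)
    (h : ∀ g : G, ∃ c : ℂ, ∀ u, q (g • u) = c * q u) (g : G) (u : U) : q (g • u) = q u := by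
  obtain ⟨v, hv⟩ := Function.ne_iff.1 hq
  choose c hc using h
  have h1 : c 1 = 1 := by
    have := hc 1 v
    rw [one_smul] at this
    exact mul_right_cancel₀ hv (by rw [← this, one_mul])
  have h2 : ∀ g g', c (g * g') = c g * c g' := fun g g' => by
    have := hc (g * g') v
    rw [mul_smul, hc, hc] at this
    exact mul_right_cancel₀ hv (by rw [← this, mul_assoc])
  have h3 : c g = 1 := DFunLike.congr_fun
    (hχ { toFun := c, map_one' := h1, map_mul' := h2 }) g
  rw [hc, h3, one_mul]

/-- If a quotient of coprime polynomials is invariant, so are numerator and denominator. -/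
theorem invariant_of_isRelPrime (hG : ∀ g : G, IsPolyMap (fun u : U => g • u))
    (hχ : ∀ χ : G →* ℂ, χ = 1) {p q : polyFun U} (hq : q ≠ 0) (hpq : IsRelPrime q p)
    (h : ∀ (g : G) (u : U), p.1 (g • u) * q.1 u = p.1 u * q.1 (g • u)) :
    (∀ (g : G) u, p.1 (g • u) = p.1 u) ∧ ∀ (g : G) u, q.1 (g • u) = q.1 u := by
  let act : G → polyFun U → polyFun U := fun g r => ⟨_, (hG g).comp_mem r.2⟩
  -- By invariance of the fraction, q divides p · (q ∘ g); it is coprime to p.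
  have hdvd : ∀ g, q ∣ act g q := fun g => by
    refine hpq.dvd_of_dvd_mul_left (?_ : q ∣ p * act g q)
    exact ⟨act g p, Subtype.ext (funext fun u => ((h g u).symm.trans (mul_comm _ _)))⟩
  choose r hr using hdvd
  have hr' : ∀ g u, q.1 (g • u) = q.1 u * (r g).1 u := fun g u =>
    congrFun (congrArg Subtype.val (hr g)) u
  -- Going from u to g u and back shows that r_g · (r_{g⁻¹} ∘ g) = 1.
  have hunit : ∀ g, IsUnit (r g) := fun g => by
    refine IsUnit.of_mul_eq_one (act g (r g⁻¹)) (mul_left_cancel₀ hq ?_)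
    refine Subtype.ext (funext fun u => ?_)
    have h1 := hr' g⁻¹ (g • u)
    rw [inv_smul_smul, hr' g u] at h1
    change q.1 u * ((r g).1 u * (r g⁻¹).1 (g • u)) = q.1 u * 1
    rw [mul_one, ← mul_assoc, ← h1]
  have hqinv : ∀ (g : G) u, q.1 (g • u) = q.1 u := by
    refine eq_of_forall_exists_smul hχ (fun h0 => hq (Subtype.ext h0)) fun g => ?_
    obtain ⟨c, hc⟩ := polyFun_unit_eq_const (hunit g)
    refine ⟨c, fun u => ?_⟩
    rw [hr', hc, mul_comm]
    rfl
  refine ⟨fun g => ?_, hqinv⟩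
  have hp : act g p = p := by
    refine mul_right_cancel₀ hq (Subtype.ext (funext fun u => ?_))
    change p.1 (g • u) * q.1 u = p.1 u * q.1 u
    rw [h, hqinv]
  exact fun u => congrFun (congrArg Subtype.val hp) u

namespace PrincipalOpenModel

variable {X : SubMulAction G W} {f : U → ℂ} (P : PrincipalOpenModel X f) (hne : f ≠ 0)

include P hne

omit [FiniteDimensional ℂ U] in
theorem nonempty : Nonempty ↥(X : Set W) := by
  obtain ⟨u, hu⟩ := Function.ne_iff.1 hne
  exact ⟨⟨P.param u, P.param_mem u hu⟩⟩

/-- The sets containing a dense open subset are those containing a nonempty principal open set. -/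
theorem mem_generic_iff_exists {s : Set ↥(X : Set W)} :
    s ∈ generic (X : Set W) ↔
      ∃ p ∈ polyFun U, p ≠ 0 ∧ ∀ D : ↥(X : Set W), p (P.coord D) ≠ 0 → D ∈ s := by
  let _ := zariski W
  -- A Zariski open set that meets X contains, within X, a nonempty principal open set of the
  -- parameter space.
  have key : ∀ O : Set W, IsOpen O → (∃ D ∈ O, D ∈ X) → ∃ p ∈ polyFun U, p ≠ 0 ∧
      ∀ D : ↥(X : Set W), p (P.coord D) ≠ 0 → (D : W) ∈ O := by
    rintro O hO ⟨D, hD, hDX⟩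
    obtain ⟨_, ⟨q, hq, rfl⟩, hqD, hqO⟩ :=
      zariski_isTopologicalBasis.exists_subset_of_mem_open hD hO
    refine ⟨_, P.isPolyMap_param.comp_mem hq, fun h => hqD ?_, fun D' h => hqO ?_⟩
    · have := congrFun h (P.coord D)
      simpa [P.param_coord D hDX] using this
    · rwa [P.param_coord D' D'.2] at h
  rw [mem_generic_iff]
  constructor
  · rintro ⟨O, hOs, ⟨O', hO', rfl⟩, hd⟩
    obtain ⟨D, hD⟩ := @Dense.nonempty _ (zariskiOn (X : Set W)) _ (P.nonempty hne) hd
    obtain ⟨p, hp, hp0, h⟩ := key O' hO' ⟨D, hD, D.2⟩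
    exact ⟨p, hp, hp0, fun D h' => hOs (h D h')⟩
  · rintro ⟨p, hp, hp0, h⟩
    refine ⟨{D | p (P.coord D) ≠ 0}, h,
      ⟨_, isOpen_zariski_ne (P.isPolyMap_coord.comp_mem hp), rfl⟩, ?_⟩
    refine (@dense_iff_inter_open _ (zariskiOn (X : Set W)) _).2 ?_
    rintro _ ⟨O, hO, rfl⟩ ⟨D, hD⟩
    obtain ⟨q, hq, hq0, h'⟩ := key O hO ⟨D, hD, D.2⟩
    -- Density is irreducibility: p, q and f are nonzero elements of a domain, so they are
    -- simultaneously nonzero at some point.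
    obtain ⟨u, hu⟩ := Function.ne_iff.1 (mul_ne_zero_polyFun (mul_mem hp hq) P.f_mem
      (mul_ne_zero_polyFun hp hq hp0 hq0) hne)
    have hfu : f u ≠ 0 := right_ne_zero_of_mul hu
    have hpq : p u * q u ≠ 0 := left_ne_zero_of_mul hu
    refine ⟨⟨P.param u, P.param_mem u hfu⟩, h' _ ?_, ?_⟩
    · simp only [P.coord_param u hfu]
      exact right_ne_zero_of_mul hpq
    · simp only [Set.mem_ofPred_eq, P.coord_param u hfu]
      exact left_ne_zero_of_mul hpq

/-- Polynomials that agree generically agree. -/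
theorem eq_of_eventually {p q : U → ℂ} (hp : p ∈ polyFun U) (hq : q ∈ polyFun U)
    (h : ∀ᶠ D : ↥(X : Set W) in generic (X : Set W), p (P.coord D) = q (P.coord D)) :
    p = q := by
  obtain ⟨r, hr, hr0, hrs⟩ := (P.mem_generic_iff_exists hne).1 h
  by_contra hpq
  obtain ⟨u, hu⟩ := Function.ne_iff.1 (mul_ne_zero_polyFun (mul_mem hr (sub_mem hp hq)) P.f_mem
    (mul_ne_zero_polyFun hr (sub_mem hp hq) hr0 (sub_ne_zero.2 hpq)) hne)
  have hfu : f u ≠ 0 := right_ne_zero_of_mul hu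
  have hu' : r u * (p u - q u) ≠ 0 := left_ne_zero_of_mul hu
  have := hrs ⟨P.param u, P.param_mem u hfu⟩ (by
    simp only [P.coord_param u hfu]; exact left_ne_zero_of_mul hu')
  simp only [Set.mem_ofPred_eq, P.coord_param u hfu] at this
  exact right_ne_zero_of_mul hu' (sub_eq_zero.2 this)

theorem eventually_ne {p : U → ℂ} (hp : p ∈ polyFun U) (hp0 : p ≠ 0) :
    ∀ᶠ D : ↥(X : Set W) in generic (X : Set W), p (P.coord D) ≠ 0 :=
  (P.mem_generic_iff_exists hne).2 ⟨p, hp, hp0, fun _ h => h⟩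

section Invariants

variable {R : Subalgebra ℂ (U → ℂ)}
  (hR : ∀ p, p ∈ R ↔ p ∈ polyFun U ∧ ∀ (g : G) u, p (g • u) = p u)
  (hG : ∀ g : G, IsPolyMap (fun u : U => g • u)) (hχ : ∀ χ : G →* ℂ, χ = 1)

include hR

omit hne [FiniteDimensional ℂ U] in
/-- Pull-back of invariant polynomials to invariant rational functions. -/
def rationalPullback : R →ₐ[ℂ] rationalInvariants X where
  toFun r := ⟨Filter.Germ.ofFun fun D => r.1 (P.coord D), fun D => r.1 (P.coord D), rfl,
    Filter.Eventually.of_forall (P.isRegularAt_comp ((hR _).1 r.2).1),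
    fun g => Filter.Eventually.of_forall (P.comp_coord_smul hR r.2 g)⟩
  map_one' := rfl
  map_mul' _ _ := rfl
  map_zero' := rfl
  map_add' _ _ := rfl
  commutes' c := by
    refine Subtype.ext ?_
    change _ = algebraMap ℂ ((generic (X : Set W)).Germ ℂ) c
    rw [Algebra.algebraMap_eq_smul_one]
    exact congrArg Filter.Germ.ofFun (funext fun D => rfl)

include hG hχ

/-- An invariant rational function is a quotient of invariant polynomials. -/
theorem exists_invariant_quotient {φ : ↥(X : Set W) → ℂ}
    (hφ : ∀ᶠ D in generic (X : Set W), IsRegularAt φ D)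
    (hφG : ∀ g : G, ∀ᶠ D : ↥(X : Set W) in generic (X : Set W),
      φ ⟨g • (D : W), X.smul_mem g D.2⟩ = φ D) :
    ∃ p q : R, q ≠ 0 ∧ ∀ᶠ D : ↥(X : Set W) in generic (X : Set W),
      φ D * q.1 (P.coord D) = p.1 (P.coord D) := by
  obtain ⟨s, hs, hs0, hsφ⟩ := (P.mem_generic_iff_exists hne).1 hφ
  -- One point of regularity is enough: the quotient found there represents φ wherever its
  -- denominator is nonzero, which is a dense open set.
  obtain ⟨u, hu⟩ := Function.ne_iff.1 (mul_ne_zero_polyFun hs P.f_mem hs0 hne)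
  have hfu : f u ≠ 0 := right_ne_zero_of_mul hu
  have hsu : s u ≠ 0 := left_ne_zero_of_mul hu
  have hreg := hsφ ⟨P.param u, P.param_mem u hfu⟩ (by simpa only [P.coord_param u hfu] using hsu)
  obtain ⟨p, hp, q, hq, hqu, e⟩ := P.exists_quotient hreg
  have hq0 : (⟨q, hq⟩ : polyFun U) ≠ 0 := fun h => hqu (congrFun (congrArg Subtype.val h) _)
  -- The common factor c is removed by unique factorization, so that coprimality can be used for the
  -- invariance.
  obtain ⟨q₀, p₀, c, hrel, hcq, hcp⟩ :=
    UniqueFactorizationMonoid.exists_reduced_factors (⟨q, hq⟩ : polyFun U) hq0 ⟨p, hp⟩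
  have hcq' : ∀ v, c.1 v * q₀.1 v = q v := fun v => congrFun (congrArg Subtype.val hcq) v
  have hcp' : ∀ v, c.1 v * p₀.1 v = p v := fun v => congrFun (congrArg Subtype.val hcp) v
  have hq₀ : q₀ ≠ 0 := right_ne_zero_of_mul (hcq ▸ hq0)
  have e' : ∀ D : ↥(X : Set W), q (P.coord D) ≠ 0 →
      φ D * q₀.1 (P.coord D) = p₀.1 (P.coord D) := fun D hD => by
    rw [e D hD]
    rw [← hcq', ← hcp'] at *
    have h1 := left_ne_zero_of_mul hD
    have h2 := right_ne_zero_of_mul hD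
    field_simp
  have hqne : q ≠ 0 := fun h => hq0 (Subtype.ext h)
  have hinv := invariant_of_isRelPrime hG hχ hq₀ hrel fun g => by
    obtain ⟨t, ht, ht0, htφ⟩ := (P.mem_generic_iff_exists hne).1 (hφG g)
    have hqg : (fun v => q (g • v)) ≠ 0 := fun h => hqne (funext fun v => by
      rw [← smul_inv_smul g v]
      exact congrFun h (g⁻¹ • v))
    -- The cross-multiplied identity of polynomials holds generically, hence identically.
    refine congrFun (P.eq_of_eventually hne (mul_mem ((hG g).comp_mem p₀.2) q₀.2)
      (mul_mem p₀.2 ((hG g).comp_mem q₀.2)) ?_)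
    filter_upwards [P.eventually_ne hne hq hqne, P.eventually_ne hne ((hG g).comp_mem hq) hqg,
      hφG g] with D h1 h2 h3
    have h4 := e' D h1
    have h5 := e' ⟨g • (D : W), X.smul_mem g D.2⟩ (by rwa [P.coord_smul g D.2])
    rw [h3] at h5
    simp only [P.coord_smul g D.2] at h5
    rw [← h4, ← h5]
    ring
  refine ⟨⟨p₀.1, (hR _).2 ⟨p₀.2, hinv.1⟩⟩, ⟨q₀.1, (hR _).2 ⟨q₀.2, hinv.2⟩⟩,
    fun h => hq₀ (Subtype.ext (congrArg (fun r : R => r.1) h)), ?_⟩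
  filter_upwards [P.eventually_ne hne hq hqne] with D h1 using e' D h1

theorem exists_fractionRingEquiv :
    ∃ E : FractionRing R ≃ₐ[ℂ] rationalInvariants X,
      ∀ r : R, (E (algebraMap _ _ r)).1 =
        (Filter.Germ.ofFun fun D => r.1 (P.coord D) : (generic (X : Set W)).Germ ℂ) := by
  let _ : Algebra R (rationalInvariants X) := (P.rationalPullback hR).toRingHom.toAlgebra
  have hmap : ∀ r : R, (algebraMap R (rationalInvariants X) r).1 =
      (Filter.Germ.ofFun fun D => r.1 (P.coord D) : (generic (X : Set W)).Germ ℂ) := fun _ => rfl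
  have : IsScalarTower ℂ R (rationalInvariants X) :=
    IsScalarTower.of_algebraMap_eq fun c => ((P.rationalPullback hR).commutes c).symm
  have hle : R ≤ polyFun U := fun p hp => ((hR p).1 hp).1
  have hdom : IsDomain R :=
    (Subalgebra.inclusion_injective hle).isDomain (Subalgebra.inclusion hle).toRingHom
  have hne' : ∀ r : R, r ≠ 0 → r.1 ≠ 0 := fun r hr h => hr (Subtype.ext h)
  have hloc : IsLocalization (nonZeroDivisors R) (rationalInvariants X) := by
    refine ⟨?_, ?_, ?_⟩
    · rintro ⟨r, hr⟩
      have hev := P.eventually_ne hne ((hR _).1 r.2).1 (hne' r (nonZeroDivisors.ne_zero hr))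
      refine IsUnit.of_mul_eq_one ⟨Filter.Germ.ofFun fun D => (r.1 (P.coord D))⁻¹,
        fun D => (r.1 (P.coord D))⁻¹, rfl, ?_, fun g => ?_⟩ (Subtype.ext ?_)
      · filter_upwards [hev] with D hD using P.isRegularAt_inv_comp ((hR _).1 r.2).1 D hD
      · exact Filter.Eventually.of_forall fun D =>
          congrArg _ (P.comp_coord_smul hR r.2 g D)
      · refine Filter.Germ.coe_eq.2 ?_
        filter_upwards [hev] with D hD using mul_inv_cancel₀ hD
    · rintro ⟨_, φ, rfl, hφ, hφG⟩
      obtain ⟨p, q, hq, e⟩ := P.exists_invariant_quotient hne hR hG hχ hφ hφG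
      exact ⟨⟨p, ⟨q, mem_nonZeroDivisors_of_ne_zero hq⟩⟩,
        Subtype.ext (Filter.Germ.coe_eq.2 e)⟩
    · intro r r' h
      refine ⟨1, ?_⟩
      have h' := Filter.Germ.coe_eq.1 (congrArg Subtype.val h)
      rw [Subtype.ext (P.eq_of_eventually hne ((hR _).1 r.2).1 ((hR _).1 r'.2).1 h')]
  refine ⟨(IsLocalization.algEquiv (nonZeroDivisors R) (FractionRing R)
    (rationalInvariants X)).restrictScalars ℂ, fun r => ?_⟩
  rw [AlgEquiv.restrictScalars_apply, AlgEquiv.commutes, hmap]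

end Invariants

end PrincipalOpenModel

end RationalInvariants
-- The special linear group has no nontrivial characters
section Characters

open Matrix Matrix.SpecialLinearGroup

variable {ι F : Type*} [Fintype ι] [DecidableEq ι] [Field F]

/-- The torus rescales the parameter of a transvection, which makes every transvection a commutator.
-/
theorem diag2n_mul_transvection {i j : ι} (hij : i ≠ j) {c : F} (hc : c ≠ 0) (a : F) :
    diag2n hij c hc * transvection hij a = transvection hij (c ^ 2 * a) * diag2n hij c hc := by
  refine Subtype.ext ?_
  ext x y
  simp only [coe_mul, diag2n_coe, transvection_coe, Matrix.mul_add, Matrix.add_mul, mul_one,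
    one_mul]
  simp [Matrix.single_apply, Matrix.diagonal_mul, Matrix.mul_diagonal]
  by_cases h : i = x ∧ j = y
  · obtain ⟨rfl, rfl⟩ := h
    simp [hij.symm]
    field_simp
  · simp [h]

/-- The Weyl element of the plane of i and j exchanges the two diagonal entries, so a character
takes the same value on a torus element and on its inverse. -/
theorem weyl_mul_diag2n {i j : ι} (hij : i ≠ j) {c : F} (hc : c ≠ 0) :
    transvection hij 1 * transvection hij.symm (-1) * transvection hij 1 * diag2n hij c hc =
      diag2n hij c⁻¹ (inv_ne_zero hc) *
        (transvection hij 1 * transvection hij.symm (-1) * transvection hij 1) := by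
  have hw : ((transvection hij 1 * transvection hij.symm (-1) * transvection hij 1 :
      SpecialLinearGroup ι F) : Matrix ι ι F) =
      1 - Matrix.single i i 1 - Matrix.single j j 1 + Matrix.single i j 1
        - Matrix.single j i 1 := by
    simp only [coe_mul, transvection_coe, Matrix.mul_add, Matrix.add_mul, mul_one, one_mul]
    simp [hij.symm]
    ext x y
    simp only [Matrix.sub_apply, Matrix.add_apply, Matrix.single_apply, Matrix.one_apply]
    by_cases hxi : i = x <;> by_cases hxj : j = x <;> by_cases hyi : i = y <;>
      by_cases hyj : j = y <;> simp_all
  refine Subtype.ext ?_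
  rw [coe_mul, coe_mul _ (_ * _), hw]
  ext x y
  simp only [diag2n_coe, Matrix.diagonal_mul, Matrix.mul_diagonal, Matrix.sub_apply,
    Matrix.add_apply, Matrix.single_apply, Matrix.one_apply]
  clear hw
  by_cases hxi : i = x <;> by_cases hxj : j = x <;> by_cases hyi : i = y <;>
    by_cases hyj : j = y <;> first
      | exact absurd (hxi.trans hxj.symm) hij
      | exact absurd (hyi.trans hyj.symm) hij
      | simp_all [eq_comm]

theorem diag2n_mul_diag2n {i j : ι} (hij : i ≠ j) {b c : F} (hb : b ≠ 0) (hc : c ≠ 0) :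
    diag2n hij b hb * diag2n hij c hc = diag2n hij (b * c) (mul_ne_zero hb hc) := by
  refine Subtype.ext ?_
  rw [coe_mul, diag2n_coe, diag2n_coe, diag2n_coe, Matrix.diagonal_mul_diagonal]
  congr 1
  ext x
  split_ifs <;> simp [mul_comm]

theorem matrix_character_eq_one (χ : SpecialLinearGroup ι ℂ →* ℂ) [Nontrivial ι] : χ = 1 := by
  have hinv : ∀ g, χ g ≠ 0 := fun g h => by
    have := χ.map_mul g g⁻¹
    rw [mul_inv_cancel, map_one, h, zero_mul] at this
    exact one_ne_zero this
  have ht : ∀ (i j : ι) (hij : i ≠ j) (a : ℂ), χ (transvection hij a) = 1 := by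
    intro i j hij a
    -- With c = 2 and parameter a/3, conjugation gives the parameter 4a/3 = a/3 + a; cancelling the
    -- transvection with parameter a/3 leaves the one with parameter a.
    have h := congrArg χ (diag2n_mul_transvection hij (two_ne_zero' ℂ) (a / 3))
    rw [map_mul, map_mul, mul_comm] at h
    have h' := mul_right_cancel₀ (hinv _) h
    have h3 : transvection hij ((2 : ℂ) ^ 2 * (a / 3)) =
        transvection hij (a / 3) * transvection hij a := by
      refine Subtype.ext ?_
      simp only [coe_mul, transvection_coe, Matrix.mul_add, Matrix.add_mul, mul_one, one_mul]
      simp [hij.symm]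
      rw [add_assoc, ← Matrix.single_add]
      congr 2
      ring
    rw [h3, map_mul] at h'
    exact mul_left_cancel₀ (hinv _) (h'.symm.trans (mul_one _).symm)
  refine MonoidHom.ext fun g => ?_
  refine diagonal_transvection_induction' (fun g => χ g = 1) g ?_ ht ?_
  · intro i j hij c hc
    -- A square root of c is taken because χ(diag b) = χ(diag b⁻¹) only gives χ(diag b)² = 1, that
    -- is, triviality on squares.
    obtain ⟨b, rfl⟩ : ∃ b, c = b ^ 2 := (IsAlgClosed.exists_pow_nat_eq c two_pos).imp
      fun _ h => h.symm
    have hb : b ≠ 0 := by rintro rfl; simp at hc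
    have h := congrArg χ (weyl_mul_diag2n hij hb)
    rw [map_mul χ (_ * _), map_mul χ (diag2n hij _ _), mul_comm] at h
    have h' := mul_right_cancel₀ (hinv _) h
    have h1 : diag2n hij b hb * diag2n hij b⁻¹ (inv_ne_zero hb) = 1 := by
      rw [diag2n_mul_diag2n]
      refine Subtype.ext ?_
      simp [diag2n_coe, hb]
    have h2 := diag2n_mul_diag2n hij hb hb
    simp only [← pow_two] at h2
    rw [← h2, pow_two, map_mul]
    nth_rw 2 [h']
    rw [← map_mul, h1, map_one]
  · intro A B hA hB
    rw [map_mul, hA, hB, one_mul]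

/-- `SL(V)` has no nontrivial characters. -/
theorem character_eq_one {V : Type*} [AddCommGroup V] [Module ℂ V] [FiniteDimensional ℂ V]
    (hV : 2 ≤ finrank ℂ V) (χ : _root_.SpecialLinearGroup ℂ V →* ℂ) : χ = 1 := by
  have : Nontrivial (Fin (finrank ℂ V)) := Fin.nontrivial_iff_two_le.2 hV
  let E := toLin_equiv (finBasis ℂ V)
  have h := matrix_character_eq_one (χ.comp E.toMonoidHom)
  refine MonoidHom.ext fun g => ?_
  have := DFunLike.congr_fun h (E.symm g)
  rw [MonoidHom.comp_apply] at this
  change χ (E (E.symm g)) = 1 at this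
  rwa [E.apply_symm_apply] at this

end Characters

/-! ### Contraction by a covector as the adjoint of multiplication -/

section Contraction

variable {V : Type*} [AddCommGroup V] [Module ℂ V]

open CliffordAlgebra in
theorem contractLeft_ιMulti (u : Dual ℂ V) (k : ℕ) (v : Fin (k + 1) → V) :
    contractLeft (Q := (0 : QuadraticForm ℂ V)) u (ExteriorAlgebra.ιMulti ℂ (k + 1) v) =
      ∑ i : Fin (k + 1), ((-1 : ℂ) ^ (i : ℕ) * u (v i)) •
        ExteriorAlgebra.ιMulti ℂ k (v ∘ i.succAbove) := by
  induction k with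
  | zero =>
    rw [ExteriorAlgebra.ιMulti_succ_apply, contractLeft_ι_mul]
    simp
  | succ k ih =>
    rw [ExteriorAlgebra.ιMulti_succ_apply, contractLeft_ι_mul, Fin.sum_univ_succ, ih]
    rw [sub_eq_add_neg, Finset.mul_sum, ← Finset.sum_neg_distrib]
    congr 1
    · simp only [Fin.val_zero, pow_zero, one_mul, Fin.succAbove_zero]
      rfl
    · refine Finset.sum_congr rfl fun i _ => ?_
      rw [ExteriorAlgebra.ιMulti_succ_apply]
      have h : Matrix.vecTail (v ∘ i.succ.succAbove) = Matrix.vecTail v ∘ i.succAbove := by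
        ext j
        simp [Matrix.vecTail]
      rw [h, mul_smul_comm, ← neg_smul]
      simp [Matrix.vecTail, pow_succ]

variable [FiniteDimensional ℂ V]

omit [FiniteDimensional ℂ V] in
theorem ιMulti_mem (k : ℕ) (v : Fin k → V) : ExteriorAlgebra.ιMulti ℂ k v ∈ ⋀[ℂ]^k V :=
  ExteriorAlgebra.ιMulti_range ℂ k ⟨v, rfl⟩

theorem pairing_ιMulti (k : ℕ) (v : Fin k → V) (f : Fin k → Dual ℂ V) :
    pairing V (ExteriorAlgebra.ιMulti ℂ k v) (ExteriorAlgebra.ιMulti ℂ k f) =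
      Matrix.det (.of fun i j => f j (v i)) := by
  rw [← exteriorPower.pairingDual_ιMulti_ιMulti]
  by_cases hk : k ≤ finrank ℂ V
  · exact pairing_of_mem hk (ιMulti_mem k v) (ExteriorAlgebra.ιMulti_range ℂ k ⟨f, rfl⟩)
  -- The sum that defines the pairing stops at degree dim V; beyond it both sides vanish.
  · have h0 : finrank ℂ (⋀[ℂ]^k V) = 0 := by
      rw [exteriorPower.finrank_eq, Nat.choose_eq_zero_of_lt (not_le.1 hk)]
    have := finrank_zero_iff.1 h0
    have h1 : exteriorPower.ιMulti ℂ k v = 0 := Subsingleton.elim _ _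
    have h2 : ExteriorAlgebra.ιMulti ℂ k v = 0 := congrArg Subtype.val h1
    rw [h1, h2, map_zero, map_zero, LinearMap.zero_apply]

omit [FiniteDimensional ℂ V] in
theorem pairing_ιMulti_ne {k l : ℕ} (h : k ≠ l) (v : Fin k → V) (f : Fin l → Dual ℂ V) :
    pairing V (ExteriorAlgebra.ιMulti ℂ k v) (ExteriorAlgebra.ιMulti ℂ l f) = 0 :=
  pairing_of_mem_ne h (ιMulti_mem k v) (ExteriorAlgebra.ιMulti_range ℂ l ⟨f, rfl⟩)

omit [FiniteDimensional ℂ V] in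
/-- Bilinear maps on exterior algebras are determined by their values on decomposable elements. -/
theorem bilinear_ext {A : Type*} [AddCommGroup A] [Module ℂ A]
    {B B' : ExteriorAlgebra ℂ V →ₗ[ℂ] ExteriorAlgebra ℂ (Dual ℂ V) →ₗ[ℂ] A}
    (h : ∀ k l (v : Fin k → V) (f : Fin l → Dual ℂ V),
      B (ExteriorAlgebra.ιMulti ℂ k v) (ExteriorAlgebra.ιMulti ℂ l f) =
        B' (ExteriorAlgebra.ιMulti ℂ k v) (ExteriorAlgebra.ιMulti ℂ l f)) : B = B' := by
  refine LinearMap.ext_on_range (ExteriorAlgebra.ιMulti_span ℂ V) fun ⟨k, v⟩ => ?_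
  exact LinearMap.ext_on_range (ExteriorAlgebra.ιMulti_span ℂ (Dual ℂ V)) fun ⟨l, f⟩ => h k l v f

open CliffordAlgebra in
-- On products of vectors and covectors this is the expansion of a determinant along its first
-- column.
theorem pairing_contractLeft (u : Dual ℂ V) (x : ExteriorAlgebra ℂ V)
    (μ : ExteriorAlgebra ℂ (Dual ℂ V)) :
    pairing V (contractLeft (Q := (0 : QuadraticForm ℂ V)) u x) μ =
      pairing V x (ExteriorAlgebra.ι ℂ u * μ) := by
  have : (pairing V).comp (contractLeft (Q := (0 : QuadraticForm ℂ V)) u) =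
      (pairing V).compl₂ (LinearMap.mulLeft ℂ (ExteriorAlgebra.ι ℂ u)) := by
    refine bilinear_ext fun k l v f => ?_
    simp only [LinearMap.comp_apply, LinearMap.compl₂_apply, LinearMap.mulLeft_apply]
    have hu : ExteriorAlgebra.ι ℂ u * ExteriorAlgebra.ιMulti ℂ l f =
        ExteriorAlgebra.ιMulti ℂ (l + 1) (Matrix.vecCons u f) := by
      rw [ExteriorAlgebra.ιMulti_succ_apply]
      simp
    rw [hu]
    rcases k with _ | k
    · rw [pairing_ιMulti_ne (Nat.succ_ne_zero l).symm]
      simp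
    · rw [contractLeft_ιMulti, map_sum, LinearMap.sum_apply]
      simp only [map_smul, LinearMap.smul_apply, smul_eq_mul]
      by_cases hkl : k = l
      · subst hkl
        rw [pairing_ιMulti, Matrix.det_succ_column_zero]
        refine Finset.sum_congr rfl fun i _ => ?_
        rw [pairing_ιMulti]
        rfl
      · rw [pairing_ιMulti_ne (by omega)]
        exact Finset.sum_eq_zero fun i _ => by rw [pairing_ιMulti_ne hkl, mul_zero]
  exact LinearMap.congr_fun (LinearMap.congr_fun this x) μ

omit [FiniteDimensional ℂ V] in
open CliffordAlgebra in
theorem reverse_ιMulti (k : ℕ) (v : Fin k → V) :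
    reverse (Q := (0 : QuadraticForm ℂ V)) (ExteriorAlgebra.ιMulti ℂ k v) =
      ExteriorAlgebra.ιMulti ℂ k (v ∘ Fin.rev) := by
  rw [ExteriorAlgebra.ιMulti_apply, ExteriorAlgebra.ιMulti_apply]
  have h := reverse_prod_map_ι (Q := (0 : QuadraticForm ℂ V)) (List.ofFn v)
  rw [List.map_ofFn] at h
  refine h.trans (congrArg List.prod ?_)
  refine List.ext_getElem (by simp) fun i hi _ => ?_
  simp only [List.length_reverse, List.length_ofFn] at hi
  simp only [List.getElem_reverse, List.getElem_ofFn, Function.comp_apply, List.length_ofFn]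
  congr 2
  exact Fin.ext (by simp [Fin.val_rev]; omega)

open CliffordAlgebra in
-- Reversing the rows and the columns of a matrix together does not change its determinant. This
-- carries adjointness over from left to right contraction, the side on which flags grow.
theorem pairing_reverse (x : ExteriorAlgebra ℂ V) (μ : ExteriorAlgebra ℂ (Dual ℂ V)) :
    pairing V (reverse (Q := (0 : QuadraticForm ℂ V)) x)
      (reverse (Q := (0 : QuadraticForm ℂ (Dual ℂ V))) μ) = pairing V x μ := by
  have : (pairing V).compl₁₂ (reverse (Q := (0 : QuadraticForm ℂ V)))
      (reverse (Q := (0 : QuadraticForm ℂ (Dual ℂ V)))) = pairing V := by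
    refine bilinear_ext fun k l v f => ?_
    rw [LinearMap.compl₁₂_apply, reverse_ιMulti, reverse_ιMulti]
    by_cases hkl : k = l
    · subst hkl
      rw [pairing_ιMulti, pairing_ιMulti]
      exact Matrix.det_submatrix_equiv_self Fin.revPerm (.of fun i j => f j (v i))
    · rw [pairing_ιMulti_ne hkl, pairing_ιMulti_ne hkl]
  exact LinearMap.congr_fun (LinearMap.congr_fun this x) μ

/-- The contraction of `x ∈ ⋀V` with a covector from the right. -/
def contract (u : Dual ℂ V) : ExteriorAlgebra ℂ V →ₗ[ℂ] ExteriorAlgebra ℂ V :=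
  (CliffordAlgebra.contractRight (Q := (0 : QuadraticForm ℂ V))).flip u

omit [FiniteDimensional ℂ V] in
theorem contract_mul_ι (u : Dual ℂ V) (x : ExteriorAlgebra ℂ V) (v : V) :
    contract u (x * ExteriorAlgebra.ι ℂ v) = u v • x - contract u x * ExteriorAlgebra.ι ℂ v :=
  CliffordAlgebra.contractRight_mul_ι u v x

omit [FiniteDimensional ℂ V] in
theorem contract_one (u : Dual ℂ V) : contract u 1 = 0 :=
  CliffordAlgebra.contractRight_one _ u

omit [FiniteDimensional ℂ V] in
theorem contract_contract (u : Dual ℂ V) (x : ExteriorAlgebra ℂ V) :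
    contract u (contract u x) = 0 :=
  CliffordAlgebra.contractRight_contractRight u x

open CliffordAlgebra in
theorem pairing_contract (u : Dual ℂ V) (x : ExteriorAlgebra ℂ V)
    (μ : ExteriorAlgebra ℂ (Dual ℂ V)) :
    pairing V (contract u x) μ = pairing V x (μ * ExteriorAlgebra.ι ℂ u) := by
  have h : contract u x = reverse (Q := (0 : QuadraticForm ℂ V))
    (contractLeft u (reverse (Q := (0 : QuadraticForm ℂ V)) x)) := rfl
  rw [h, ← pairing_reverse, reverse_reverse, pairing_contractLeft, ← pairing_reverse x]
  congr 1
  rw [reverse.map_mul]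
  congr 1
  exact (reverse_ι u).symm

end Contraction

/-! ### Blades: multiples of exterior products of vectors -/

section Blades

variable {V : Type*} [AddCommGroup V] [Module ℂ V]

/-- The exterior product of a list of vectors. -/
def wedge (l : List V) : ExteriorAlgebra ℂ V := (l.map (ExteriorAlgebra.ι ℂ)).prod

theorem wedge_nil : wedge ([] : List V) = 1 := rfl

theorem wedge_singleton (v : V) : wedge [v] = ExteriorAlgebra.ι ℂ v := by simp [wedge]

theorem wedge_concat (l : List V) (v : V) : wedge (l ++ [v]) = wedge l * ExteriorAlgebra.ι ℂ v := by
  simp [wedge]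

theorem wedge_cons (v : V) (l : List V) : wedge (v :: l) = ExteriorAlgebra.ι ℂ v * wedge l := by
  simp [wedge]

theorem wedge_mem (l : List V) : wedge l ∈ ⋀[ℂ]^l.length V := by
  induction l with
  | nil => exact Submodule.one_le.1 (pow_zero _).ge
  | cons v l ih =>
    rw [wedge_cons, List.length_cons, add_comm]
    refine SetLike.mul_mem_graded ?_ ih
    change ExteriorAlgebra.ι ℂ v ∈ LinearMap.range (ExteriorAlgebra.ι ℂ) ^ 1
    rw [pow_one]
    exact ⟨v, rfl⟩

theorem ι_mul_ι_swap (v w : V) : ExteriorAlgebra.ι ℂ v * ExteriorAlgebra.ι ℂ w =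
    -(ExteriorAlgebra.ι ℂ w * ExteriorAlgebra.ι ℂ v) :=
  eq_neg_of_add_eq_zero_left (ExteriorAlgebra.ι_add_mul_swap v w)

theorem ι_mul_wedge (v : V) (l : List V) :
    ExteriorAlgebra.ι ℂ v * wedge l = (-1 : ℂ) ^ l.length • (wedge l * ExteriorAlgebra.ι ℂ v) := by
  induction l with
  | nil => simp [wedge_nil]
  | cons w l ih =>
    rw [wedge_cons, ← mul_assoc, ι_mul_ι_swap, neg_mul, mul_assoc, ih, List.length_cons, pow_succ,
      mul_smul_comm, mul_assoc]
    simp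

theorem wedge_mul_ι_of_mem {v : V} {l : List V} (h : v ∈ l) :
    wedge l * ExteriorAlgebra.ι ℂ v = 0 := by
  induction l using List.reverseRecOn with
  | nil => simp at h
  | append_singleton l w ih =>
    rw [wedge_concat]
    rcases List.mem_append.1 h with h | h
    · rw [mul_assoc, ι_mul_ι_swap, mul_neg, ← mul_assoc, ih h, zero_mul, neg_zero]
    · rw [List.mem_singleton.1 h, mul_assoc, ExteriorAlgebra.ι_sq_zero, mul_zero]

theorem wedge_mul_ι_of_mem_span {v : V} {l : List V}
    (h : v ∈ Submodule.span ℂ {w | w ∈ l}) : wedge l * ExteriorAlgebra.ι ℂ v = 0 := by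
  induction h using Submodule.span_induction with
  | mem w hw => exact wedge_mul_ι_of_mem hw
  | zero => simp
  | add x y _ _ hx hy => rw [map_add, mul_add, hx, hy, add_zero]
  | smul a x _ hx => rw [map_smul, mul_smul_comm, hx, smul_zero]

theorem contract_wedge_eq_zero {u : Dual ℂ V} {l : List V} (h : ∀ v ∈ l, u v = 0) :
    contract u (wedge l) = 0 := by
  induction l using List.reverseRecOn with
  | nil => exact contract_one u
  | append_singleton l w ih =>
    rw [wedge_concat, contract_mul_ι, h w (by simp), zero_smul,
      ih fun v hv => h v (List.mem_append_left _ hv), zero_mul, sub_zero]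

/-- A covector that does not vanish on all factors of an exterior product vanishes on all factors
but the last one of another presentation of the product. -/
theorem exists_wedge_concat {u : Dual ℂ V} {l : List V} (h : ∃ v ∈ l, u v ≠ 0) :
    ∃ (l' : List V) (w : V), l'.length + 1 = l.length ∧ u w ≠ 0 ∧ (∀ v ∈ l', u v = 0) ∧
      wedge l = wedge (l' ++ [w]) := by
  induction l using List.reverseRecOn with
  | nil => simp at h
  | append_singleton l w ih =>
    by_cases hl : ∃ v ∈ l, u v ≠ 0
    · obtain ⟨l', x, hlen, hx, hl', e⟩ := ih hl
      refine ⟨l' ++ [(u w / u x) • x - w], x, by simp [hlen], hx, ?_, ?_⟩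
      · intro v hv
        rcases List.mem_append.1 hv with hv | hv
        · exact hl' v hv
        · rw [List.mem_singleton.1 hv]
          simp [hx]
      · rw [wedge_concat, e, wedge_concat, wedge_concat, wedge_concat, map_sub, map_smul,
          mul_sub, sub_mul, mul_assoc, mul_assoc, ι_mul_ι_swap x w, mul_assoc, smul_mul_assoc,
          ExteriorAlgebra.ι_sq_zero]
        simp
    · push Not at hl
      refine ⟨l, w, by simp, ?_, hl, rfl⟩
      obtain ⟨v, hv, hv0⟩ := h
      rcases List.mem_append.1 hv with hv | hv
      · exact absurd (hl v hv) hv0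
      · rwa [← List.mem_singleton.1 hv]

theorem contract_wedge_concat {u : Dual ℂ V} {l : List V} (h : ∀ v ∈ l, u v = 0) (w : V) :
    contract u (wedge (l ++ [w])) = u w • wedge l := by
  rw [wedge_concat, contract_mul_ι, contract_wedge_eq_zero h, zero_mul, sub_zero]

theorem forall_eq_zero_of_contract_eq_zero {u : Dual ℂ V} {l : List V} (hl : wedge l ≠ 0)
    (h : contract u (wedge l) = 0) : ∀ v ∈ l, u v = 0 := by
  by_contra! h'
  obtain ⟨l', w, -, hw, hl', e⟩ := exists_wedge_concat h'
  rw [e, contract_wedge_concat hl', smul_eq_zero] at h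
  rw [e, wedge_concat, h.resolve_left hw, zero_mul] at hl
  exact hl rfl

theorem exists_dual_of_wedge_mul_ne_zero {l : List V} {v : V}
    (h : v ∉ Submodule.span ℂ {w | w ∈ l}) : ∃ u : Dual ℂ V, u v = 1 ∧ ∀ w ∈ l, u w = 0 := by
  obtain ⟨u, hu, hl⟩ := Submodule.exists_dual_map_eq_bot_of_notMem h inferInstance
  refine ⟨(u v)⁻¹ • u, by simp [hu], fun w hw => ?_⟩
  have : u w ∈ Submodule.map u (Submodule.span ℂ {w | w ∈ l}) :=
    ⟨w, Submodule.subset_span hw, rfl⟩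
  rw [hl, Submodule.mem_bot] at this
  simp [this]

/-- The scalar multiples of products of `k` vectors. -/
def IsBlade (k : ℕ) (x : ExteriorAlgebra ℂ V) : Prop :=
  ∃ (c : ℂ) (l : List V), l.length = k ∧ x = c • wedge l

theorem IsBlade.mem {k : ℕ} {x : ExteriorAlgebra ℂ V} (h : IsBlade k x) : x ∈ ⋀[ℂ]^k V := by
  obtain ⟨c, l, rfl, rfl⟩ := h
  exact Submodule.smul_mem _ _ (wedge_mem l)

theorem isBlade_one : IsBlade 0 (1 : ExteriorAlgebra ℂ V) := ⟨1, [], rfl, by simp [wedge_nil]⟩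

theorem isBlade_ι (v : V) : IsBlade 1 (ExteriorAlgebra.ι ℂ v) :=
  ⟨1, [v], rfl, by simp [wedge_singleton]⟩

theorem IsBlade.mul_ι {k : ℕ} {x : ExteriorAlgebra ℂ V} (h : IsBlade k x) (v : V) :
    IsBlade (k + 1) (x * ExteriorAlgebra.ι ℂ v) := by
  obtain ⟨c, l, rfl, rfl⟩ := h
  exact ⟨c, l ++ [v], by simp, by rw [wedge_concat, smul_mul_assoc]⟩

theorem IsBlade.ι_mul {k : ℕ} {x : ExteriorAlgebra ℂ V} (h : IsBlade k x) (v : V) :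
    IsBlade (k + 1) (ExteriorAlgebra.ι ℂ v * x) := by
  obtain ⟨c, l, rfl, rfl⟩ := h
  exact ⟨c, v :: l, by simp, by rw [wedge_cons, mul_smul_comm]⟩

theorem IsBlade.smul {k : ℕ} {x : ExteriorAlgebra ℂ V} (h : IsBlade k x) (a : ℂ) :
    IsBlade k (a • x) := by
  obtain ⟨c, l, rfl, rfl⟩ := h
  exact ⟨a * c, l, rfl, by rw [mul_smul]⟩

theorem IsBlade.contract {k : ℕ} {x : ExteriorAlgebra ℂ V} (h : IsBlade (k + 1) x)
    (u : Dual ℂ V) : IsBlade k (contract u x) := by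
  obtain ⟨c, l, hl, rfl⟩ := h
  by_cases h0 : ∃ v ∈ l, u v ≠ 0
  · obtain ⟨l', w, hlen, -, hl', e⟩ := exists_wedge_concat h0
    refine ⟨c * u w, l', by omega, ?_⟩
    rw [e, map_smul, contract_wedge_concat hl', mul_smul]
  · push Not at h0
    refine ⟨0, l.tail, by simp [hl], ?_⟩
    rw [map_smul, contract_wedge_eq_zero h0, smul_zero, zero_smul]

/-- Presented with all factors but the last in the kernel of u, the blade is its contraction times a
multiple of the last factor. -/
theorem IsBlade.exists_eq_contract_mul {k : ℕ} {x : ExteriorAlgebra ℂ V} (h : IsBlade k x)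
    {u : Dual ℂ V} (hu : FlagModuli.contract u x ≠ 0) :
    ∃ w, x = FlagModuli.contract u x * ExteriorAlgebra.ι ℂ w := by
  obtain ⟨c, l, rfl, rfl⟩ := h
  have h0 : ∃ v ∈ l, u v ≠ 0 := by
    by_contra! h0
    rw [map_smul, contract_wedge_eq_zero h0, smul_zero] at hu
    exact hu rfl
  obtain ⟨l', w, -, hw, hl', e⟩ := exists_wedge_concat h0
  refine ⟨(u w)⁻¹ • w, ?_⟩
  rw [e, map_smul, contract_wedge_concat hl', wedge_concat, map_smul, mul_smul_comm,
    smul_mul_assoc, smul_mul_assoc, smul_comm c, smul_smul, inv_mul_cancel₀ hw, one_smul]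

/-- Contraction preserves divisibility by a vector. -/
theorem IsBlade.exists_contract_mul_ι {k : ℕ} {x : ExteriorAlgebra ℂ V} (h : IsBlade k x)
    {u : Dual ℂ V} (hu : FlagModuli.contract u x ≠ 0) (v : V) :
    ∃ w, FlagModuli.contract u (x * ExteriorAlgebra.ι ℂ v) =
      FlagModuli.contract u x * ExteriorAlgebra.ι ℂ w := by
  obtain ⟨w, hw⟩ := h.exists_eq_contract_mul hu
  refine ⟨u v • w - v, ?_⟩
  rw [contract_mul_ι, map_sub, map_smul, mul_sub, mul_smul_comm, ← hw]

theorem IsBlade.exists_dual {k : ℕ} {x : ExteriorAlgebra ℂ V} (h : IsBlade k x) {v : V}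
    (hv : x * ExteriorAlgebra.ι ℂ v ≠ 0) :
    ∃ u : Dual ℂ V, u v = 1 ∧ FlagModuli.contract u x = 0 := by
  obtain ⟨c, l, rfl, rfl⟩ := h
  obtain ⟨u, hu, hl⟩ := exists_dual_of_wedge_mul_ne_zero (l := l) (v := v) fun h => by
    rw [smul_mul_assoc, wedge_mul_ι_of_mem_span h, smul_zero] at hv
    exact hv rfl
  exact ⟨u, hu, by rw [map_smul, contract_wedge_eq_zero hl, smul_zero]⟩

theorem IsBlade.exists_mul_ne_zero [FiniteDimensional ℂ V] {k : ℕ} {x : ExteriorAlgebra ℂ V}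
    (h : IsBlade k x) (hx : x ≠ 0) (hk : k < finrank ℂ V) :
    ∃ v, x * ExteriorAlgebra.ι ℂ v ≠ 0 := by
  classical
  obtain ⟨c, l, rfl, rfl⟩ := h
  obtain ⟨v, -, hv⟩ := SetLike.exists_of_lt (lt_top_iff_ne_top.2 (fun h => by
    have h1 := finrank_span_finset_le_card (R := ℂ) l.toFinset
    rw [List.coe_toFinset, Set.finrank, h, finrank_top] at h1
    have := l.toFinset_card_le
    omega) : Submodule.span ℂ {w | w ∈ l} < ⊤)
  obtain ⟨u, hu, hl⟩ := exists_dual_of_wedge_mul_ne_zero hv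
  refine ⟨v, fun h0 => hx ?_⟩
  have := congrArg (FlagModuli.contract u) h0
  rwa [contract_mul_ι, hu, one_smul, map_smul, contract_wedge_eq_zero hl, smul_zero, zero_mul,
    sub_zero, map_zero] at this

theorem IsBlade.ι_mul_eq {k : ℕ} {x : ExteriorAlgebra ℂ V} (h : IsBlade k x) (v : V) :
    ExteriorAlgebra.ι ℂ v * x = (-1 : ℂ) ^ k • (x * ExteriorAlgebra.ι ℂ v) := by
  obtain ⟨c, l, rfl, rfl⟩ := h
  rw [mul_smul_comm, ι_mul_wedge, smul_mul_assoc, smul_comm]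

/-- If `a ∧ x ∧ y = 0` and `x ∧ y ≠ 0`, then `a ∧ x` is a multiple of `x ∧ y`. -/
theorem IsBlade.exists_ι_mul_eq_smul {k : ℕ} {x : ExteriorAlgebra ℂ V} (h : IsBlade k x) {a y : V}
    (hxy : x * ExteriorAlgebra.ι ℂ y ≠ 0)
    (h0 : ExteriorAlgebra.ι ℂ a * x * ExteriorAlgebra.ι ℂ y = 0) :
    ∃ c : ℂ, ExteriorAlgebra.ι ℂ a * x = c • (x * ExteriorAlgebra.ι ℂ y) := by
  -- Contracting x ∧ a ∧ y = 0 with a covector that is 1 on y and kills x gives x ∧ a = u(a) x ∧ y.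
  obtain ⟨u, hu, hux⟩ := h.exists_dual hxy
  rw [h.ι_mul_eq, smul_mul_assoc, smul_eq_zero] at h0
  have h1 := h0.resolve_left (pow_ne_zero _ (by simp))
  have h2 := congrArg (FlagModuli.contract u) h1
  rw [contract_mul_ι, hu, contract_mul_ι, hux, map_zero, zero_mul, sub_zero, one_smul,
    sub_eq_zero] at h2
  exact ⟨(-1) ^ k * u a, by rw [h.ι_mul_eq, h2, smul_mul_assoc, mul_smul]⟩

theorem exists_eq_ι_of_mem {x : ExteriorAlgebra ℂ V} (h : x ∈ ⋀[ℂ]^1 V) :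
    ∃ v, x = ExteriorAlgebra.ι ℂ v := by
  rw [ExteriorAlgebra.exteriorPower, pow_one] at h
  obtain ⟨v, hv⟩ := h
  exact ⟨v, hv.symm⟩

end Blades

/-! ### Admissible signatures and induction along paths -/

namespace Signature

variable {n : ℕ} (σ : Signature n) {d : ℕ}

theorem toFun_add_mul (j k : ℤ) : σ.toFun (j + k * n) = σ.toFun j := by
  have hper : Function.Periodic σ.toFun (n : ℤ) := σ.periodic
  exact hper.int_mul k j

theorem colour_position (j : ℤ) : σ.colour (σ.position j) = σ.toFun j := by
  have h3 := σ.three_le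
  have h1 := Int.emod_nonneg (j - 1) (b := (n : ℤ)) (by omega)
  have h := σ.toFun_add_mul ((j - 1) % n + 1) ((j - 1) / n)
  have e : (j - 1) % n + 1 + (j - 1) / n * n = j := by
    have := Int.emod_add_mul_ediv (j - 1) n
    rw [mul_comm] at this
    omega
  rw [e] at h
  rw [h, colour]
  congr 1
  simp only [position]
  omega

theorem position_add (j : ℤ) : σ.position (j + n) = σ.position j := by
  refine Fin.ext ?_
  simp only [position]
  rw [show j + n - 1 = j - 1 + n by ring, Int.add_emod_right]

theorem position_val_add_one (p : Fin n) : σ.position ((p : ℕ) + 1) = p := by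
  refine Fin.ext ?_
  simp only [position]
  have := p.2
  rw [add_sub_cancel_right, Int.emod_eq_of_lt (by omega) (by omega)]
  omega

theorem mem_hits_succ {j k : ℤ} {m : ℕ} (hm : 1 ≤ m) :
    m + 1 ∈ σ.hits d j k ↔ m ∈ σ.hits d (j + 1) (k - σ.toFun j) := by
  simp only [hits, Set.mem_ofPred_eq, hm, true_and, Nat.le_add_left]
  rw [Finset.sum_range_succ']
  have : ∀ i : ℕ, σ.toFun (j + (i + 1 : ℕ)) = σ.toFun (j + 1 + i) := fun i => by
    congr 1; push_cast; ring
  simp only [this, Nat.cast_zero, add_zero]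
  constructor
  · intro h
    have := h.sub_right (σ.toFun j : ℤ)
    rwa [add_sub_cancel_right] at this
  · intro h
    have := h.add_right (σ.toFun j : ℤ)
    rwa [sub_add_cancel] at this

theorem one_mem_hits {j k : ℤ} : 1 ∈ σ.hits d j k ↔ (σ.toFun j : ℤ) ≡ k [ZMOD d] := by
  simp [hits]

theorem hits_congr {j k k' : ℤ} (h : k ≡ k' [ZMOD d]) : σ.hits d j k = σ.hits d j k' := by
  ext m
  exact and_congr_right fun _ => ⟨fun h' => h'.trans h, fun h' => h'.trans h.symm⟩

variable {σ}

theorem IsAdmissible.nonempty (hσ : σ.IsAdmissible d) (hd : 0 < d) (j k : ℤ) :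
    (σ.hits d j k).Nonempty := by
  have h1 := Int.emod_nonneg k (b := (d : ℤ)) (by omega)
  have h2 := Int.emod_lt_of_pos k (b := (d : ℤ)) (by omega)
  have h := hσ j (k % d).toNat (by omega)
  rw [Int.toNat_of_nonneg h1] at h
  rwa [σ.hits_congr (Int.mod_modEq k d)] at h

theorem len_eq_one {j k : ℤ} (h : (σ.toFun j : ℤ) ≡ k [ZMOD d]) : σ.len d j k = 1 :=
  le_antisymm (Nat.sInf_le (σ.one_mem_hits.2 h))
    (Nat.sInf_mem (s := σ.hits d j k) ⟨1, σ.one_mem_hits.2 h⟩).1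

theorem IsAdmissible.one_le_len (hσ : σ.IsAdmissible d) (hd : 0 < d) (j k : ℤ) :
    1 ≤ σ.len d j k :=
  (Nat.sInf_mem (hσ.nonempty hd j k)).1

/-- A shortest segment that is not a single vertex remains shortest, for the corrected residue, when
its first vertex is removed. -/
theorem IsAdmissible.len_eq_succ (hσ : σ.IsAdmissible d) (hd : 0 < d) {j k : ℤ}
    (h : ¬ (σ.toFun j : ℤ) ≡ k [ZMOD d]) :
    σ.len d j k = σ.len d (j + 1) (k - σ.toFun j) + 1 := by
  refine le_antisymm (Nat.sInf_le ?_) ?_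
  · exact (σ.mem_hits_succ (hσ.one_le_len hd _ _)).2 (Nat.sInf_mem (hσ.nonempty hd _ _))
  · have hmem : σ.len d j k ∈ σ.hits d j k := Nat.sInf_mem (hσ.nonempty hd j k)
    obtain ⟨m, hm⟩ : ∃ m, σ.len d j k = m + 1 := ⟨σ.len d j k - 1, by
      have := hmem.1
      omega⟩
    have hm1 : 1 ≤ m := by
      by_contra h0
      obtain rfl : m = 0 := by omega
      rw [hm, zero_add] at hmem
      exact h (σ.one_mem_hits.1 hmem)
    rw [hm] at hmem ⊢
    exact Nat.succ_le_succ (Nat.sInf_le ((σ.mem_hits_succ hm1).1 hmem))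

theorem toFun_cases (σ : Signature n) (j : ℤ) :
    σ.toFun j = 1 ∧ (σ.toFun j : ℤ) = 1 ∨ σ.toFun j = -1 ∧ (σ.toFun j : ℤ) = -1 := by
  rcases Int.units_eq_one_or (σ.toFun j) with h | h <;> simp [h]

/-- Induction along the paths that start at `(j, k)` and go from `(j, k)` to
`(j + 1, k - σ j)` until the level leaves the open interval `(a, b)`. -/
theorem IsAdmissible.forward_induction (hσ : σ.IsAdmissible d) (hd : 0 < d) {a b : ℤ}
    (hab : b ≤ a + d) {Q : ℤ → ℤ → Prop} (ha : ∀ j, Q j a) (hb : ∀ j, Q j b)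
    (hstep : ∀ j k, a < k → k < b → Q (j + 1) (k - σ.toFun j) → Q j k) (j k : ℤ)
    (hak : a ≤ k) (hkb : k ≤ b) : Q j k := by
  -- If the path stayed inside the interval for m steps, its level would be congruent to a mod d.
  -- The open interval is contained in (a, a + d) and has no such level, so m bounds the length of
  -- the path.
  obtain ⟨m, -, hm⟩ := hσ.nonempty hd j (k - a)
  induction m generalizing j k with
  | zero =>
    rcases hak.eq_or_lt with rfl | hak
    · exact ha j
    rcases hkb.eq_or_lt with rfl | hkb
    · exact hb j
    rw [Finset.sum_range_zero] at hm
    have h1 := Int.eq_zero_of_dvd_of_nonneg_of_lt (by omega) (by omega) hm.dvd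
    omega
  | succ m ih =>
    rcases hak.eq_or_lt with rfl | hak
    · exact ha j
    rcases hkb.eq_or_lt with rfl | hkb
    · exact hb j
    refine hstep j k hak hkb ?_
    have hs := σ.toFun_cases j
    refine ih (j + 1) _ (by omega) (by omega) ?_
    rw [Finset.sum_range_succ'] at hm
    have : ∀ i : ℕ, σ.toFun (j + (i + 1 : ℕ)) = σ.toFun (j + 1 + i) := fun i => by
      congr 1; push_cast; ring
    simp only [this, Nat.cast_zero, add_zero] at hm
    have h := hm.sub_right (σ.toFun j : ℤ)
    rwa [add_sub_cancel_right, sub_right_comm] at h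

theorem sum_shift (σ : Signature n) (j k : ℤ) (m : ℕ) :
    ∑ i ∈ Finset.range m, (σ.toFun (j + k * n + i) : ℤ) =
      ∑ i ∈ Finset.range m, (σ.toFun (j + i) : ℤ) := by
  refine Finset.sum_congr rfl fun i _ => ?_
  rw [add_right_comm, σ.toFun_add_mul]

theorem sum_period (σ : Signature n) (j : ℤ) (N : ℕ) :
    ∑ i ∈ Finset.range (N * n), (σ.toFun (j + i) : ℤ) =
      N * ∑ i ∈ Finset.range n, (σ.toFun (j + i) : ℤ) := by
  induction N with
  | zero => simp
  | succ N ih =>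
    rw [Nat.succ_mul, Finset.sum_range_add, ih]
    have := σ.sum_shift j N n
    push_cast
    simp only [add_assoc] at this ⊢
    rw [this]
    ring

/-- Induction along the paths that start at `(j, k)` and go from `(j, k)` to
`(j - 1, k + σ (j - 1))` until the level leaves the open interval `(0, d)`. -/
theorem IsAdmissible.backward_induction (hσ : σ.IsAdmissible d) (hd : 0 < d)
    {Q : ℤ → ℤ → Prop} (h0 : ∀ j, Q j 0) (hd' : ∀ j, Q j d)
    (hstep : ∀ j k : ℤ, 0 < k → k < d → Q (j - 1) (k + σ.toFun (j - 1)) → Q j k) (j k : ℤ)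
    (hk0 : 0 ≤ k) (hkd : k ≤ d) : Q j k := by
  have main : ∀ (m : ℕ) (j k : ℤ), 0 ≤ k → k ≤ d →
      ∑ i ∈ Finset.range m, (σ.toFun (j - m + i) : ℤ) ≡ -k [ZMOD d] → Q j k := by
    intro m
    induction m with
    | zero =>
      intro j k hk0 hkd hm
      rcases hk0.eq_or_lt with rfl | hk0
      · exact h0 j
      rcases hkd.eq_or_lt with rfl | hkd
      · exact hd' j
      rw [Finset.sum_range_zero] at hm
      have h1 := Int.eq_zero_of_dvd_of_nonneg_of_lt (by omega) (by omega)
        (dvd_neg.2 (by simpa using hm.symm.dvd) : (d : ℤ) ∣ - -k)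
      omega
    | succ m ih =>
      intro j k hk0 hkd hm
      rcases hk0.eq_or_lt with rfl | hk0
      · exact h0 j
      rcases hkd.eq_or_lt with rfl | hkd
      · exact hd' j
      refine hstep j k hk0 hkd ?_
      have hs := σ.toFun_cases (j - 1)
      refine ih (j - 1) _ (by omega) (by omega) ?_
      rw [Finset.sum_range_succ] at hm
      have e1 : ∀ i : ℕ, j - (m + 1 : ℕ) + (i : ℤ) = j - 1 - m + i := fun i => by
        push_cast; ring
      have e2 : j - 1 - m + (m : ℤ) = j - 1 := by ring
      simp only [e1, e2] at hm
      have h := hm.sub_right (σ.toFun (j - 1) : ℤ)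
      rwa [add_sub_cancel_right, ← neg_add'] at h
  -- Admissibility provides segments after j, while one ending at j - 1 with sum -k is needed. A
  -- segment of length m after j with sum k is completed on the left to d m whole periods, whose
  -- total is 0 mod d; the complement has length l = d m n - m.
  obtain ⟨m, hm1, hm⟩ := hσ.nonempty hd j k
  have hn := σ.three_le
  obtain ⟨l, hl⟩ : ∃ l : ℕ, m + l = (d * m) * n :=
    ⟨(d * m) * n - m, Nat.add_sub_cancel' (by nlinarith [Nat.mul_le_mul hd (le_refl m)])⟩
  refine main l j k hk0 hkd ?_
  have hsum := σ.sum_period j (d * m)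
  rw [← hl, Finset.sum_range_add] at hsum
  have e : ∀ i : ℕ, (σ.toFun (j + ((m + i : ℕ) : ℤ)) : ℤ) = σ.toFun (j - l + i) := fun i => by
    have hl' : ((m : ℤ) + l) = ((d * m : ℕ) : ℤ) * n := by exact_mod_cast hl
    rw [← σ.toFun_add_mul (j - l + i) ((d * m : ℕ) : ℤ), ← hl']
    congr 2
    push_cast
    ring
  simp only [e] at hsum
  have h2 : ∑ i ∈ Finset.range l, (σ.toFun (j - l + i) : ℤ) =
      d * (m * ∑ i ∈ Finset.range n, (σ.toFun (j + i) : ℤ)) -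
        ∑ i ∈ Finset.range m, (σ.toFun (j + i) : ℤ) := by
    push_cast at hsum
    linarith
  rw [h2, ← zero_sub]
  exact Int.ModEq.sub (Int.modEq_zero_iff_dvd.2 (dvd_mul_right _ _)) hm

end Signature

/-! ### Intersection with a covector as a signed contraction -/

section Meet

variable {V : Type*} [AddCommGroup V] [Module ℂ V] {d : ℕ}

/-- The intersection with the covector `u`, on the exterior algebra of a `d`-dimensional space. -/
def meet (d : ℕ) (u : Dual ℂ V) : ExteriorAlgebra ℂ V →ₗ[ℂ] ExteriorAlgebra ℂ V :=
  (-1 : ℂ) ^ (d + 1) • contract u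

theorem meet_apply (d : ℕ) (u : Dual ℂ V) (x : ExteriorAlgebra ℂ V) :
    meet d u x = (-1 : ℂ) ^ (d + 1) • contract u x := rfl

theorem neg_one_pow_ne_zero (k : ℕ) : (-1 : ℂ) ^ k ≠ 0 := pow_ne_zero _ (by simp)

theorem meet_eq_zero_iff (d : ℕ) (u : Dual ℂ V) (x : ExteriorAlgebra ℂ V) :
    meet d u x = 0 ↔ contract u x = 0 := by
  rw [meet_apply, smul_eq_zero, or_iff_right (neg_one_pow_ne_zero _)]

theorem meet_mul_ι (d : ℕ) (u : Dual ℂ V) (x : ExteriorAlgebra ℂ V) (v : V) :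
    meet d u (x * ExteriorAlgebra.ι ℂ v) =
      ((-1) ^ (d + 1) * u v) • x - meet d u x * ExteriorAlgebra.ι ℂ v := by
  rw [meet_apply, meet_apply, contract_mul_ι, smul_sub, smul_smul, smul_mul_assoc]

theorem meet_meet (d : ℕ) (u : Dual ℂ V) (x : ExteriorAlgebra ℂ V) :
    meet d u (meet d u x) = 0 := by
  rw [meet_apply, meet_apply, map_smul, contract_contract, smul_zero, smul_zero]

theorem IsBlade.meet {k : ℕ} {x : ExteriorAlgebra ℂ V} (h : IsBlade (k + 1) x) (u : Dual ℂ V) :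
    IsBlade k (meet d u x) :=
  (h.contract u).smul _

theorem IsBlade.exists_meet_mul_ι {k : ℕ} {x : ExteriorAlgebra ℂ V} (h : IsBlade k x)
    {u : Dual ℂ V} (hu : FlagModuli.meet d u x ≠ 0) (v : V) :
    ∃ w, FlagModuli.meet d u (x * ExteriorAlgebra.ι ℂ v) =
      FlagModuli.meet d u x * ExteriorAlgebra.ι ℂ w := by
  rw [Ne, meet_eq_zero_iff] at hu
  obtain ⟨w, hw⟩ := h.exists_contract_mul_ι hu v
  exact ⟨w, by rw [meet_apply, hw, meet_apply, smul_mul_assoc]⟩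

theorem map_contract (g : V ≃ₗ[ℂ] V) (u : Dual ℂ V) (x : ExteriorAlgebra ℂ V) :
    ExteriorAlgebra.map g.toLinearMap (contract u x) =
      contract (u ∘ₗ g.symm.toLinearMap) (ExteriorAlgebra.map g.toLinearMap x) := by
  induction x using CliffordAlgebra.right_induction with
  | algebraMap r =>
    have h : ∀ u : Dual ℂ V, contract u (algebraMap ℂ (ExteriorAlgebra ℂ V) r) = 0 := fun u => by
      rw [Algebra.algebraMap_eq_smul_one, map_smul, contract_one, smul_zero]
    rw [AlgHom.commutes, h, h, map_zero]
  | add x y hx hy => simp only [map_add, hx, hy]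
  | mul_ι v x hx =>
    change ExteriorAlgebra.map g.toLinearMap (contract u (x * ExteriorAlgebra.ι ℂ v)) =
      contract _ (ExteriorAlgebra.map g.toLinearMap (x * ExteriorAlgebra.ι ℂ v))
    rw [contract_mul_ι, map_sub, map_smul, map_mul, map_mul, ExteriorAlgebra.map_apply_ι,
      contract_mul_ι, hx]
    simp

theorem smul_meet (d : ℕ) (g : SpecialLinearGroup ℂ V) (u : Dual ℂ V) (x : ExteriorAlgebra ℂ V) :
    g • meet d u x =
      meet d (u ∘ₗ ((g⁻¹ : SpecialLinearGroup ℂ V) : V ≃ₗ[ℂ] V).toLinearMap) (g • x) := by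
  rw [smul_ext_def, smul_ext_def, meet_apply, map_smul, map_contract]
  rfl

variable [FiniteDimensional ℂ V] (hV : finrank ℂ V = d) (vol : VolumeForm V d)

include hV

omit vol in
theorem eq_zero_of_mem_of_lt {k : ℕ} (hk : d < k) {x : ExteriorAlgebra ℂ V} (hx : x ∈ ⋀[ℂ]^k V) :
    x = 0 := by
  have h0 : finrank ℂ (⋀[ℂ]^k V) = 0 := by
    rw [exteriorPower.finrank_eq, hV, Nat.choose_eq_zero_of_lt hk]
  have := finrank_zero_iff.1 h0
  exact congrArg Subtype.val (Subsingleton.elim (⟨x, hx⟩ : ⋀[ℂ]^k V) 0)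

omit [FiniteDimensional ℂ V] hV in
theorem volume_ne_zero : vol.e ≠ 0 := fun h => by
  have := vol.pairing_eq_one
  rw [h, map_zero, LinearMap.zero_apply] at this
  exact zero_ne_one this

theorem eq_smul_volume {x : ExteriorAlgebra ℂ V} (hx : x ∈ ⋀[ℂ]^d V) :
    x = pairing V x vol.eDual • vol.e := by
  have h1 : finrank ℂ (⋀[ℂ]^d V) = 1 := by rw [exteriorPower.finrank_eq, hV, Nat.choose_self]
  have h0 : (⟨_, vol.e_mem⟩ : ⋀[ℂ]^d V) ≠ 0 := fun h =>
    volume_ne_zero vol (congrArg Subtype.val h)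
  obtain ⟨c, hc⟩ := exists_smul_eq_of_finrank_eq_one h1 h0 ⟨x, hx⟩
  have hc' : c • vol.e = x := congrArg Subtype.val hc
  rw [← hc', map_smul, LinearMap.smul_apply, vol.pairing_eq_one, smul_eq_mul, mul_one]

theorem isBlade_volume : IsBlade d vol.e := by
  let b : Basis (Fin d) ℂ V := finBasisOfFinrankEq ℂ V hV
  have hb : ExteriorAlgebra.ιMulti ℂ d b = wedge (List.ofFn b) := by
    rw [ExteriorAlgebra.ιMulti_apply, wedge, List.map_ofFn]
    rfl
  have h1 : pairing V (ExteriorAlgebra.ιMulti ℂ d b) (ExteriorAlgebra.ιMulti ℂ d b.coord) = 1 := by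
    rw [pairing_ιMulti, ← Matrix.det_one (n := Fin d)]
    congr 1
    ext i j
    simp [Matrix.one_apply, Finsupp.single_apply]
  have h2 := eq_smul_volume hV vol (ιMulti_mem d b)
  have hc : pairing V (ExteriorAlgebra.ιMulti ℂ d b) vol.eDual ≠ 0 := fun h => by
    rw [h2, h, zero_smul, map_zero, LinearMap.zero_apply] at h1
    exact zero_ne_one h1
  refine ⟨(pairing V (ExteriorAlgebra.ιMulti ℂ d b) vol.eDual)⁻¹, List.ofFn b, by simp, ?_⟩
  rw [← hb, eq_inv_smul_iff₀ hc, ← h2]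

omit hV in
theorem psi_one : psi vol 1 = vol.e := by
  refine pairing_bijective.1 (LinearMap.ext fun μ => ?_)
  rw [pairing_psi, one_mul]

omit hV in
-- Only elements ν of degree d - 1 contribute to ⟨e, u ∧ ν⟩, and moving u to their right costs
-- (-1)^{d-1} = (-1)^{d+1}. This is the sign in `meet`.
theorem psi_ι_mul (u : Dual ℂ V) (w : ExteriorAlgebra ℂ (Dual ℂ V)) :
    psi vol (ExteriorAlgebra.ι ℂ u * w) = meet d u (psi vol w) := by
  have key : ∀ ν : ExteriorAlgebra ℂ (Dual ℂ V), pairing V vol.e (ExteriorAlgebra.ι ℂ u * ν) =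
      (-1) ^ (d + 1) * pairing V vol.e (ν * ExteriorAlgebra.ι ℂ u) := by
    intro ν
    have h : (pairing V vol.e).comp (LinearMap.mulLeft ℂ (ExteriorAlgebra.ι ℂ u)) =
        (-1 : ℂ) ^ (d + 1) •
          (pairing V vol.e).comp (LinearMap.mulRight ℂ (ExteriorAlgebra.ι ℂ u)) := by
      refine LinearMap.ext_on_range (ExteriorAlgebra.ιMulti_span ℂ (Dual ℂ V)) fun ⟨l, f⟩ => ?_
      have hf : ExteriorAlgebra.ιMulti ℂ l f = wedge (List.ofFn f) := by
        rw [ExteriorAlgebra.ιMulti_apply, wedge, List.map_ofFn]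
        rfl
      simp only [LinearMap.comp_apply, LinearMap.smul_apply, LinearMap.mulLeft_apply,
        LinearMap.mulRight_apply, hf, smul_eq_mul]
      by_cases hl : l + 1 = d
      · rw [ι_mul_wedge, List.length_ofFn, map_smul, smul_eq_mul]
        congr 1
        rw [← hl]
        ring
      · rw [← wedge_cons, ← wedge_concat,
          pairing_of_mem_ne (k := d) (by simpa using Ne.symm hl) vol.e_mem (wedge_mem _),
          pairing_of_mem_ne (k := d) (by simpa using Ne.symm hl) vol.e_mem (wedge_mem _), mul_zero]
    exact LinearMap.congr_fun h ν
  refine pairing_bijective.1 (LinearMap.ext fun μ => ?_)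
  rw [pairing_psi, mul_assoc, key, meet_apply, map_smul, LinearMap.smul_apply, pairing_contract,
    pairing_psi, mul_assoc, smul_eq_mul]

omit hV in
theorem psi_ι (u : Dual ℂ V) : psi vol (ExteriorAlgebra.ι ℂ u) = meet d u vol.e := by
  rw [← psi_one vol, ← psi_ι_mul, mul_one]

theorem psi_invFun (y : ExteriorAlgebra ℂ V) : psi vol (Function.invFun (psi vol) y) = y :=
  Function.rightInverse_invFun (psi_bijective vol hV).2 y

/-- From here on, intersection with a covector is a contraction with a Leibniz rule, and the inverse
of ψ is no longer needed to compute it. -/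
theorem intersection_psi_ι (u : Dual ℂ V) (y : ExteriorAlgebra ℂ V) :
    intersection vol (psi vol (ExteriorAlgebra.ι ℂ u)) y = meet d u y := by
  rw [intersection, Function.leftInverse_invFun (psi_bijective vol hV).1, psi_ι_mul,
    psi_invFun hV]

theorem mixedWedge_of_mem {p q : ℕ} (hp : p ≤ d) (hq : q ≤ d) {x y : ExteriorAlgebra ℂ V}
    (hx : x ∈ ⋀[ℂ]^p V) (hy : y ∈ ⋀[ℂ]^q V) :
    mixedWedge vol x y = if p + q ≤ d then x * y else intersection vol x y := by
  -- The summands of the other degrees contain `invFun` at 0, whose value follows from the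
  -- bijectivity of ψ.
  have hinv : Function.invFun (psi vol) 0 = 0 := by
    refine (psi_bijective vol hV).1 ?_
    rw [psi_invFun hV, map_zero]
  rw [mixedWedge, Finset.sum_eq_single p, Finset.sum_eq_single q]
  · rw [gradePart_of_mem hx, gradePart_of_mem hy]
  · intro l _ hl
    rw [gradePart_of_mem_ne hl.symm hy]
    simp [intersection, hinv]
  · intro h
    exact absurd (Finset.mem_range.2 (by omega)) h
  · intro l _ hl
    rw [gradePart_of_mem_ne hl.symm hx]
    simp [intersection, hinv]
  · intro h
    exact absurd (Finset.mem_range.2 (by omega)) h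

/-- Leibniz rule applied to e ∧ b, which vanishes for reasons of degree. -/
theorem psi_ι_mul_ι (u : Dual ℂ V) (b : V) :
    psi vol (ExteriorAlgebra.ι ℂ u) * ExteriorAlgebra.ι ℂ b =
      ((-1) ^ (d + 1) * u b) • vol.e := by
  have h0 : vol.e * ExteriorAlgebra.ι ℂ b = 0 :=
    eq_zero_of_mem_of_lt hV (Nat.lt_succ_self d) ((isBlade_volume hV vol).mul_ι b).mem
  have h := meet_mul_ι d u vol.e b
  rw [h0, map_zero] at h
  rw [psi_ι]
  exact (sub_eq_zero.1 h.symm).symm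

theorem isBlade_psi_ι (hd : 1 ≤ d) (u : Dual ℂ V) :
    IsBlade (d - 1) (psi vol (ExteriorAlgebra.ι ℂ u)) := by
  rw [psi_ι]
  refine IsBlade.meet ?_ u
  rw [Nat.sub_add_cancel hd]
  exact isBlade_volume hV vol

/-- Every nonzero element of degree `d - 1` divides the volume form. -/
theorem IsBlade.exists_mul_eq_volume {x : ExteriorAlgebra ℂ V} (hd : 1 ≤ d) (h : IsBlade (d - 1) x)
    (hx : x ≠ 0) : ∃ v, x * ExteriorAlgebra.ι ℂ v = vol.e := by
  obtain ⟨v, hv⟩ := h.exists_mul_ne_zero hx (by omega)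
  have hm := (h.mul_ι v).mem
  rw [Nat.sub_add_cancel hd] at hm
  have e := eq_smul_volume hV vol hm
  have hc : pairing V (x * ExteriorAlgebra.ι ℂ v) vol.eDual ≠ 0 := fun h0 => by
    rw [h0, zero_smul] at e
    exact hv e
  refine ⟨(pairing V (x * ExteriorAlgebra.ι ℂ v) vol.eDual)⁻¹ • v, ?_⟩
  rw [map_smul, mul_smul_comm, inv_smul_eq_iff₀ hc]
  exact e

/-- Every nonzero element of degree `d - 1` is a covector. -/
theorem IsBlade.exists_eq_psi_ι {x : ExteriorAlgebra ℂ V} (hd : 1 ≤ d) (h : IsBlade (d - 1) x)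
    (hx : x ≠ 0) : ∃ u, x = psi vol (ExteriorAlgebra.ι ℂ u) := by
  obtain ⟨v, hv⟩ := h.exists_mul_eq_volume hV vol hd hx
  -- With e = x ∧ v, u(v) = 1 and u killing x, intersecting e with u gives x up to the sign that the
  -- witness corrects.
  obtain ⟨u, hu, hux⟩ := h.exists_dual (v := v) (by rw [hv]; exact volume_ne_zero vol)
  refine ⟨(-1 : ℂ) ^ (d + 1) • u, ?_⟩
  rw [map_smul, map_smul, psi_ι, ← hv, meet_mul_ι, (meet_eq_zero_iff d u x).2 hux, hu,
    zero_mul, sub_zero, mul_one, smul_smul, ← mul_pow]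
  simp

end Meet

/-! ### Products of shortest segments and the frozen functions -/

section Levels

variable {V : Type*} [AddCommGroup V] [Module ℂ V] [FiniteDimensional ℂ V] {d n : ℕ}
  (vol : VolumeForm V d) {σ : Signature n} (u : Conf σ V)

instance : FiniteDimensional ℂ (Conf σ V) :=
  inferInstanceAs (FiniteDimensional ℂ (({p : Fin n // σ.colour p = 1} → V) ×
    ({p : Fin n // σ.colour p = -1} → Dual ℂ V)))

omit [FiniteDimensional ℂ V] in
theorem isPolyMap_fst (p : {p : Fin n // σ.colour p = 1}) :
    IsPolyMap (fun u : Conf σ V => u.1 p) :=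
  isPolyMap_linear
    ({ toFun := fun u => u.1 p, map_add' := fun _ _ => rfl, map_smul' := fun _ _ => rfl } :
      Conf σ V →ₗ[ℂ] V)

omit [FiniteDimensional ℂ V] in
theorem isPolyMap_snd (p : {p : Fin n // σ.colour p = -1}) :
    IsPolyMap (fun u : Conf σ V => u.2 p) :=
  isPolyMap_linear
    ({ toFun := fun u => u.2 p, map_add' := fun _ _ => rfl, map_smul' := fun _ _ => rfl } :
      Conf σ V →ₗ[ℂ] Dual ℂ V)

theorem entry_black {j : ℤ} (h : σ.colour (σ.position j) = 1) :
    entry vol u j = ExteriorAlgebra.ι ℂ (u.1 ⟨_, h⟩) := dif_pos h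

theorem entry_white {j : ℤ} (h : σ.colour (σ.position j) = -1) :
    entry vol u j = psi vol (ExteriorAlgebra.ι ℂ (u.2 ⟨_, h⟩)) :=
  dif_neg (by rw [h]; decide)

/-- The operator `u_j ⋏ ·` on the elements whose degree is not extremal. -/
def step (d : ℕ) (u : Conf σ V) (j : ℤ) : ExteriorAlgebra ℂ V →ₗ[ℂ] ExteriorAlgebra ℂ V :=
  if h : σ.colour (σ.position j) = 1 then LinearMap.mulLeft ℂ (ExteriorAlgebra.ι ℂ (u.1 ⟨_, h⟩))
  else meet d (u.2 ⟨_, (Int.units_eq_one_or _).resolve_left h⟩)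

omit [FiniteDimensional ℂ V] in
theorem step_black {j : ℤ} (h : σ.colour (σ.position j) = 1) :
    step d u j = LinearMap.mulLeft ℂ (ExteriorAlgebra.ι ℂ (u.1 ⟨_, h⟩)) := dif_pos h

omit [FiniteDimensional ℂ V] in
theorem step_white {j : ℤ} (h : σ.colour (σ.position j) = -1) :
    step d u j = meet d (u.2 ⟨_, h⟩) :=
  dif_neg (by rw [h]; decide)

omit [FiniteDimensional ℂ V] in
theorem step_congr {j j' : ℤ} (h : σ.position j = σ.position j') : step d u j = step d u j' := by
  simp only [step, h]

/-- The element `u_j ⋏ u_{j+1} ⋏ ⋯` of degree `k` of the shortest segment from `j` whose sum is `k`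
modulo `d`, with the conventions `1` for `k = 0` and `e` for `k = d`. -/
def level (j k : ℤ) : ExteriorAlgebra ℂ V :=
  if k = 0 then 1 else if k = d then vol.e else segment vol u j (σ.len d j k)

theorem level_zero (j : ℤ) : level vol u j 0 = 1 := if_pos rfl

theorem level_top (hd : 0 < d) (j : ℤ) : level vol u j d = vol.e := by
  rw [level, if_neg (by omega), if_pos rfl]

theorem level_of_lt {j k : ℤ} (h0 : 0 < k) (hk : k < d) :
    level vol u j k = segment vol u j (σ.len d j k) := by
  rw [level, if_neg (by omega), if_neg (by omega)]

theorem segment_succ (j : ℤ) {m : ℕ} (hm : 1 ≤ m) :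
    segment vol u j (m + 1) = mixedWedge vol (entry vol u j) (segment vol u (j + 1) m) := by
  obtain ⟨m, rfl⟩ : ∃ m', m = m' + 1 := ⟨m - 1, by omega⟩
  rw [segment]

omit [FiniteDimensional ℂ V] in
theorem not_modEq_of_lt {a b : ℤ} (h : a < b) (h' : b < a + d) : ¬ a ≡ b [ZMOD d] := fun h0 => by
  have := Int.eq_zero_of_dvd_of_nonneg_of_lt (by omega) (by omega) h0.dvd
  omega

variable (hd : 3 ≤ d) (hV : finrank ℂ V = d) (hσ : σ.IsAdmissible d)

include hd hV hσ

/-- Degree and recursion are proved together: whether the mixed wedge is an exterior product or an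
intersection depends on the degree of the shorter segment. -/
theorem isBlade_level_and_level_eq_step (j k : ℤ) (h0 : 0 ≤ k) (hk : k ≤ d) :
    IsBlade k.toNat (level vol u j k) ∧
      (0 < k → k < d → level vol u j k = step d u j (level vol u (j + 1) (k - σ.toFun j))) := by
  revert h0 hk
  refine hσ.forward_induction (by omega) (a := 0) (b := d) (by omega)
    (Q := fun j k => IsBlade k.toNat (level vol u j k) ∧
      (0 < k → k < d → level vol u j k = step d u j (level vol u (j + 1) (k - σ.toFun j))))
    (fun j => ?_) (fun j => ?_) (fun j k h0 hk hb => ?_) j k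
  · rw [level_zero]
    exact ⟨isBlade_one, fun h => absurd h (lt_irrefl _)⟩
  · rw [level_top vol u (by omega), Int.toNat_natCast]
    exact ⟨isBlade_volume hV vol, fun _ h => absurd h (lt_irrefl _)⟩
  · replace hb := hb.1
    have hcol := σ.colour_position j
    suffices h : level vol u j k = step d u j (level vol u (j + 1) (k - σ.toFun j)) by
      refine ⟨?_, fun _ _ => h⟩
      rw [h]
      rcases σ.toFun_cases j with ⟨hs, hs'⟩ | ⟨hs, hs'⟩ <;> rw [hs'] at hb ⊢
      · rw [step_black u (hcol.trans hs)]
        have := hb.ι_mul (u.1 ⟨_, hcol.trans hs⟩)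
        rwa [show (k - 1).toNat + 1 = k.toNat by omega] at this
      · rw [step_white u (hcol.trans hs)]
        rw [show (k - -1).toNat = k.toNat + 1 by omega] at hb
        exact hb.meet _
    rw [level_of_lt vol u h0 hk]
    rcases σ.toFun_cases j with ⟨hs, hs'⟩ | ⟨hs, hs'⟩ <;> rw [hs'] at hb ⊢
    · rw [step_black u (hcol.trans hs), LinearMap.mulLeft_apply]
      -- Here the shortest segment is the single vector u_j = u_j ∧ 1, whence the value 1 in degree
      -- 0.
      by_cases h1 : k = 1
      · subst h1
        rw [Signature.len_eq_one (by rw [hs']), segment, sub_self, level_zero, mul_one,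
          entry_black vol u (hcol.trans hs)]
      · rw [hσ.len_eq_succ (by omega) (by rw [hs']; exact not_modEq_of_lt (by omega) (by omega)),
          segment_succ _ _ _ (hσ.one_le_len (by omega) _ _), hs',
          ← level_of_lt vol u (by omega) (by omega), entry_black vol u (hcol.trans hs),
          mixedWedge_of_mem hV vol (by omega) (by omega) (isBlade_ι _).mem hb.mem,
          if_pos (by omega)]
    · rw [step_white u (hcol.trans hs)]
      -- Since -1 ≡ d - 1 mod d, the shortest segment is the single covector ψ(u_j) = u_j ∩ e,
      -- whence the value e in degree d.
      by_cases h1 : k = d - 1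
      · subst h1
        rw [Signature.len_eq_one, segment, sub_neg_eq_add, sub_add_cancel,
          level_top vol u (by omega), entry_white vol u (hcol.trans hs), psi_ι]
        rw [hs']
        exact (Int.modEq_iff_dvd.2 ⟨1, by ring⟩)
      · rw [hσ.len_eq_succ (by omega), segment_succ _ _ _ (hσ.one_le_len (by omega) _ _), hs',
          ← level_of_lt vol u (by omega) (by omega), entry_white vol u (hcol.trans hs),
          mixedWedge_of_mem hV vol (by omega) (by omega) (isBlade_psi_ι hV vol (by omega) _).mem
            hb.mem, if_neg (by omega), intersection_psi_ι hV]
        rw [hs']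
        exact not_modEq_of_lt (by omega) (by omega)

theorem isBlade_level {j k : ℤ} (h0 : 0 ≤ k) (hk : k ≤ d) :
    IsBlade k.toNat (level vol u j k) :=
  (isBlade_level_and_level_eq_step vol u hd hV hσ j k h0 hk).1

theorem level_eq_step {j k : ℤ} (h0 : 0 < k) (hk : k < d) :
    level vol u j k = step d u j (level vol u (j + 1) (k - σ.toFun j)) :=
  (isBlade_level_and_level_eq_step vol u hd hV hσ j k h0.le hk.le).2 h0 hk

omit [FiniteDimensional ℂ V] hd hV hσ in
theorem step_smul (g : SpecialLinearGroup ℂ V) (j : ℤ) (x : ExteriorAlgebra ℂ V) :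
    step d (g • u) j (g • x) = g • step d u j x := by
  rcases Int.units_eq_one_or (σ.colour (σ.position j)) with h | h
  · rw [step_black _ h, step_black _ h, LinearMap.mulLeft_apply, LinearMap.mulLeft_apply,
      smul_ext_def, smul_ext_def, map_mul, ExteriorAlgebra.map_apply_ι]
    rfl
  · rw [step_white _ h, step_white _ h, smul_meet]
    rfl

theorem level_smul (g : SpecialLinearGroup ℂ V) {j k : ℤ} (h0 : 0 ≤ k) (hk : k ≤ d) :
    level vol (g • u) j k = g • level vol u j k := by
  revert h0 hk
  refine hσ.forward_induction (by omega) (a := 0) (b := d) (by omega)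
    (Q := fun j k => level vol (g • u) j k = g • level vol u j k)
    (fun j => ?_) (fun j => ?_) (fun j k h0 hk hb => ?_) j k
  · rw [level_zero, level_zero, smul_ext_def, map_one]
  · rw [level_top _ _ (by omega), level_top _ _ (by omega), smul_volume vol hV]
  · rw [level_eq_step _ _ hd hV hσ h0 hk, level_eq_step _ _ hd hV hσ h0 hk, hb, step_smul]

omit hd hV hσ [FiniteDimensional ℂ V] in
theorem isPolyMap_step {F : Conf σ V → ExteriorAlgebra ℂ V} (hF : IsPolyMap F) (j : ℤ)
    [FiniteDimensional ℂ V] : IsPolyMap (fun u => step d u j (F u)) := by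
  rcases Int.units_eq_one_or (σ.colour (σ.position j)) with h | h
  · simp only [step_black _ h]
    exact IsPolyMap.bilinear ((LinearMap.mul ℂ (ExteriorAlgebra ℂ V)).comp (ExteriorAlgebra.ι ℂ))
      (isPolyMap_fst ⟨_, h⟩) hF
  · simp only [step_white _ h]
    exact IsPolyMap.bilinear
      ((-1 : ℂ) ^ (d + 1) • (CliffordAlgebra.contractRight (Q := (0 : QuadraticForm ℂ V))).flip)
      (isPolyMap_snd ⟨_, h⟩) hF

theorem isPolyMap_level {j k : ℤ} (h0 : 0 ≤ k) (hk : k ≤ d) :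
    IsPolyMap (fun u : Conf σ V => level vol u j k) := by
  revert h0 hk
  refine hσ.forward_induction (by omega) (a := 0) (b := d) (by omega)
    (Q := fun j k => IsPolyMap (fun u : Conf σ V => level vol u j k))
    (fun j => ?_) (fun j => ?_) (fun j k h0 hk hb => ?_) j k
  · simp only [level_zero]
    exact isPolyMap_const _
  · simp only [level_top vol _ (show 0 < d by omega)]
    exact isPolyMap_const _
  · simp only [level_eq_step vol _ hd hV hσ h0 hk]
    exact isPolyMap_step hb j

/-- The recursion for the levels determines them. -/
theorem eq_level {F : ℤ → ℤ → ExteriorAlgebra ℂ V} (hF0 : ∀ j, F j 0 = 1)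
    (hFd : ∀ j, F j d = vol.e)
    (hF : ∀ j k : ℤ, 0 < k → k < d → F j k = step d u j (F (j + 1) (k - σ.toFun j))) {j k : ℤ}
    (h0 : 0 ≤ k) (hk : k ≤ d) : F j k = level vol u j k := by
  revert h0 hk
  refine hσ.forward_induction (by omega) (a := 0) (b := d) (by omega)
    (Q := fun j k => F j k = level vol u j k)
    (fun j => ?_) (fun j => ?_) (fun j k h0 hk hb => ?_) j k
  · rw [hF0, level_zero]
  · rw [hFd, level_top _ _ (by omega)]
  · rw [hF j k h0 hk, level_eq_step _ _ hd hV hσ h0 hk, hb]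

theorem level_add_period {j k : ℤ} (h0 : 0 ≤ k) (hk : k ≤ d) :
    level vol u (j + n) k = level vol u j k := by
  refine eq_level vol u hd hV hσ (F := fun j k => level vol u (j + n) k)
    (fun j => level_zero _ _ _) (fun j => level_top _ _ (by omega) _) (fun j k h0 hk => ?_) h0 hk
  rw [level_eq_step _ _ hd hV hσ h0 hk, step_congr u (σ.position_add j), σ.periodic,
    add_right_comm]

/-- After u_j has been removed, the rest of the segment has sum -1 ≡ d - 1 mod d and is again
shortest. The degrees 1 and d - 1 add up to d, so the last product is exterior. -/
theorem frozen_black {j : ℤ} (h : σ.colour (σ.position j) = 1) :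
    frozen vol σ j u • vol.e =
      ExteriorAlgebra.ι ℂ (u.1 ⟨_, h⟩) * level vol u (j + 1) (d - 1) := by
  have hs : σ.toFun j = 1 := (σ.colour_position j).symm.trans h
  have hb := isBlade_level vol u hd hV hσ (j := j + 1) (k := d - 1) (by omega) (by omega)
  have hlen : σ.len d (j + 1) (0 - σ.toFun j) = σ.len d (j + 1) (d - 1) := by
    rw [Signature.len, Signature.len, σ.hits_congr]
    rw [hs]
    exact Int.modEq_iff_dvd.2 ⟨1, by simp⟩
  rw [frozen, hσ.len_eq_succ (by omega), segment_succ _ _ _ (hσ.one_le_len (by omega) _ _), hlen,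
    ← level_of_lt vol u (by omega) (by omega), entry_black vol u h,
    mixedWedge_of_mem hV vol (by omega) (by omega) (isBlade_ι _).mem hb.mem, if_pos (by omega)]
  · refine (eq_smul_volume hV vol ?_).symm
    have := (hb.ι_mul (u.1 ⟨_, h⟩)).mem
    rwa [show ((d : ℤ) - 1).toNat + 1 = d by omega] at this
  · rw [hs]
    exact fun h' => not_modEq_of_lt (d := d) (by simp) (by simp; omega) h'.symm

/-- The degrees d - 1 and 1 add up to exactly d, so the covector is multiplied exteriorly here,
unlike in the recursion for the levels. -/
theorem frozen_white {j : ℤ} (h : σ.colour (σ.position j) = -1) :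
    frozen vol σ j u • vol.e =
      psi vol (ExteriorAlgebra.ι ℂ (u.2 ⟨_, h⟩)) * level vol u (j + 1) 1 := by
  have hs : σ.toFun j = -1 := (σ.colour_position j).symm.trans h
  have hb := isBlade_level vol u hd hV hσ (j := j + 1) (k := 1) (by omega) (by omega)
  have hlen : σ.len d (j + 1) (0 - σ.toFun j) = σ.len d (j + 1) 1 := by
    rw [hs]
    rfl
  rw [frozen, hσ.len_eq_succ (by omega), segment_succ _ _ _ (hσ.one_le_len (by omega) _ _), hlen,
    ← level_of_lt vol u (by omega) (by omega), entry_white vol u h,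
    mixedWedge_of_mem hV vol (by omega) (by omega) (isBlade_psi_ι hV vol (by omega) _).mem hb.mem,
    if_pos (by simp; omega)]
  · refine (eq_smul_volume hV vol ?_).symm
    obtain ⟨b, hb'⟩ := exists_eq_ι_of_mem hb.mem
    rw [hb', psi_ι_mul_ι hV]
    exact Submodule.smul_mem _ _ vol.e_mem
  · rw [hs]
    exact not_modEq_of_lt (d := d) (by simp) (by simp; omega)

theorem frozen_smul (g : SpecialLinearGroup ℂ V) (j : ℤ) :
    frozen vol σ j (g • u) = frozen vol σ j u := by
  suffices h : frozen vol σ j (g • u) • vol.e = frozen vol σ j u • vol.e from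
    smul_left_injective ℂ (volume_ne_zero vol) h
  have hg : frozen vol σ j u • vol.e = g • (frozen vol σ j u • vol.e) := by
    conv_lhs => rw [← smul_volume vol hV g]
    exact (map_smul (ExteriorAlgebra.map (g : V ≃ₗ[ℂ] V).toLinearMap) _ _).symm
  rw [hg]
  rcases Int.units_eq_one_or (σ.colour (σ.position j)) with h | h
  · rw [frozen_black vol _ hd hV hσ h, frozen_black vol _ hd hV hσ h,
      level_smul vol u hd hV hσ g (by omega) (by omega), smul_ext_def, smul_ext_def, map_mul,
      ExteriorAlgebra.map_apply_ι]
    rfl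
  · rw [frozen_white vol _ hd hV hσ h, frozen_white vol _ hd hV hσ h,
      level_smul vol u hd hV hσ g (by omega) (by omega), psi_ι, psi_ι]
    have h1 := smul_meet d g (u.2 ⟨_, h⟩) vol.e
    rw [smul_volume vol hV] at h1
    have h2 : g • (meet d (u.2 ⟨_, h⟩) vol.e * level vol u (j + 1) 1) =
        (g • meet d (u.2 ⟨_, h⟩) vol.e) * g • level vol u (j + 1) 1 := map_mul _ _ _
    rw [h2, h1]
    rfl

theorem frozen_mem_polyFun (j : ℤ) : frozen vol σ j ∈ polyFun (Conf σ V) := by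
  have hfr : ∀ u : Conf σ V, frozen vol σ j u =
      (pairing V).flip vol.eDual (frozen vol σ j u • vol.e) := fun u => by
    rw [map_smul, LinearMap.flip_apply, vol.pairing_eq_one, smul_eq_mul, mul_one]
  have : frozen vol σ j = fun u => (pairing V).flip vol.eDual (frozen vol σ j u • vol.e) :=
    funext hfr
  rw [this]
  suffices h : IsPolyMap (fun u : Conf σ V => frozen vol σ j u • vol.e) from h _
  rcases Int.units_eq_one_or (σ.colour (σ.position j)) with h | h
  · simp only [frozen_black vol _ hd hV hσ h]
    have := isPolyMap_step (d := d) (isPolyMap_level vol hd hV hσ (j := j + 1) (k := d - 1)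
      (by omega) (by omega)) j
    simpa only [step_black _ h, LinearMap.mulLeft_apply] using this
  · simp only [frozen_white vol _ hd hV hσ h]
    refine IsPolyMap.bilinear ((LinearMap.mul ℂ (ExteriorAlgebra ℂ V)).comp
      (psi vol ∘ₗ (ExteriorAlgebra.ι ℂ)))
      (isPolyMap_snd ⟨_, h⟩) ?_
    exact isPolyMap_level vol hd hV hσ (by omega) (by omega)

theorem frozenProduct_mem_polyFun : frozenProduct vol σ ∈ polyFun (Conf σ V) := by
  have : frozenProduct vol σ = ∏ p : Fin n, frozen vol σ ((p : ℕ) + 1) := by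
    ext u
    rw [frozenProduct, Finset.prod_apply]
  rw [this]
  exact prod_mem fun p _ => frozen_mem_polyFun vol hd hV hσ _

theorem frozenProduct_smul (g : SpecialLinearGroup ℂ V) :
    frozenProduct vol σ (g • u) = frozenProduct vol σ u :=
  Finset.prod_congr rfl fun _ _ => frozen_smul vol u hd hV hσ g _

end Levels

/-! ### Generic configurations give decorated flags -/

section Nonvanishing

variable {V : Type*} [AddCommGroup V] [Module ℂ V] [FiniteDimensional ℂ V] {d n : ℕ}
  (vol : VolumeForm V d) {σ : Signature n} (u : Conf σ V)
  (hd : 3 ≤ d) (hV : finrank ℂ V = d) (hσ : σ.IsAdmissible d)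

include hd hV hσ

theorem frozen_smul_volume (j : ℤ) :
    frozen vol σ j u • vol.e =
      entry vol u j * level vol u (j + 1) (if σ.toFun j = 1 then d - 1 else 1) := by
  rcases Int.units_eq_one_or (σ.toFun j) with h | h
  · have h' := (σ.colour_position j).trans h
    rw [if_pos h, frozen_black vol u hd hV hσ h', entry_black vol u h']
  · have h' := (σ.colour_position j).trans h
    rw [if_neg (by rw [h]; decide), frozen_white vol u hd hV hσ h', entry_white vol u h']

theorem frozen_add_period (j : ℤ) : frozen vol σ (j + n) u = frozen vol σ j u := by
  refine smul_left_injective ℂ (volume_ne_zero vol) ?_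
  change frozen vol σ (j + n) u • vol.e = frozen vol σ j u • vol.e
  have he : entry vol u (j + n) = entry vol u j := by simp only [entry, σ.position_add]
  rw [frozen_smul_volume vol u hd hV hσ, frozen_smul_volume vol u hd hV hσ, he, σ.periodic,
    add_right_comm, level_add_period vol u hd hV hσ]
  · split_ifs <;> omega
  · split_ifs <;> omega

theorem frozenProduct_ne_zero_iff :
    frozenProduct vol σ u ≠ 0 ↔ ∀ j : ℤ, frozen vol σ j u ≠ 0 := by
  rw [frozenProduct, Finset.prod_ne_zero_iff]
  refine ⟨fun h j => ?_, fun h p _ => h _⟩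
  have hper : Function.Periodic (fun j => frozen vol σ j u) (n : ℤ) :=
    frozen_add_period vol u hd hV hσ
  have h1 := h (σ.position j) (Finset.mem_univ _)
  have h2 : frozen vol σ ((σ.position j : ℕ) + 1 + (j - 1) / n * n) u =
      frozen vol σ ((σ.position j : ℕ) + 1) u := hper.int_mul ((j - 1) / n) _
  have h3 := σ.three_le
  have h4 := Int.emod_nonneg (j - 1) (b := (n : ℤ)) (by omega)
  have h5 := Int.emod_add_mul_ediv (j - 1) n
  have e : ((σ.position j : ℕ) : ℤ) + 1 + (j - 1) / n * n = j := by
    simp only [Signature.position, Int.toNat_of_nonneg h4]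
    rw [mul_comm] at h5
    omega
  rw [e] at h2
  rwa [h2]

variable {u}

/-- A level is a right factor of the level one vertex earlier, as long as the earlier degree lies
strictly between 0 and d; when the path leaves this range, the level is a right factor of a frozen
top form. Following the path backwards, the nonvanishing of the f_j spreads to all levels. -/
theorem level_ne_zero (hu : frozenProduct vol σ u ≠ 0) {j k : ℤ} (h0 : 0 ≤ k) (hk : k ≤ d) :
    level vol u j k ≠ 0 := by
  have hf := (frozenProduct_ne_zero_iff vol u hd hV hσ).1 hu
  have he : ∀ j, frozen vol σ j u • vol.e ≠ 0 := fun j => smul_ne_zero (hf j) (volume_ne_zero vol)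
  revert h0 hk
  refine hσ.backward_induction (by omega) (Q := fun j k => level vol u j k ≠ 0)
    (fun j => ?_) (fun j => ?_) (fun j k h0 hk hb => ?_) j k
  · rw [level_zero]
    exact one_ne_zero
  · rw [level_top _ _ (by omega)]
    exact volume_ne_zero vol
  · intro h
    have hj := he (j - 1)
    rw [frozen_smul_volume vol u hd hV hσ, sub_add_cancel] at hj
    have hstep : 0 < k + σ.toFun (j - 1) → k + σ.toFun (j - 1) < d → False := fun h1 h2 => by
      rw [level_eq_step vol u hd hV hσ h1 h2, sub_add_cancel, add_sub_cancel_right, h,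
        map_zero] at hb
      exact hb rfl
    rcases σ.toFun_cases (j - 1) with ⟨hs, hs'⟩ | ⟨hs, hs'⟩
    · rw [hs'] at hstep
      obtain rfl : k = d - 1 := by
        by_contra hk'
        exact hstep (by omega) (by omega)
      rw [if_pos hs, h, mul_zero] at hj
      exact hj rfl
    · rw [hs'] at hstep
      obtain rfl : k = 1 := by
        by_contra hk'
        exact hstep (by omega) (by omega)
      rw [if_neg (by rw [hs]; decide), h, mul_zero] at hj
      exact hj rfl

/-- The levels of degrees k and k + 1 arise from the next pair by the same operator. Left
multiplication by a vector preserves right divisibility, and so does a contraction that does not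
kill the divisor. The degree k runs in (0, d - 1) rather than (0, d), so that both levels obey the
recursion. -/
theorem exists_level_succ_eq (hu : frozenProduct vol σ u ≠ 0) {j k : ℤ} (h0 : 0 ≤ k)
    (hk : k ≤ d - 1) : ∃ v, level vol u j (k + 1) = level vol u j k * ExteriorAlgebra.ι ℂ v := by
  have hblade := fun {j k} => isBlade_level vol u hd hV hσ (j := j) (k := k)
  have hne := fun {j k} => level_ne_zero vol hd hV hσ hu (j := j) (k := k)
  revert h0 hk
  refine hσ.forward_induction (by omega) (a := 0) (b := d - 1) (by omega)
    (Q := fun j k => ∃ v, level vol u j (k + 1) = level vol u j k * ExteriorAlgebra.ι ℂ v)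
    (fun j => ?_) (fun j => ?_) (fun j k h0 hk hb => ?_) j k
  · obtain ⟨v, hv⟩ := exists_eq_ι_of_mem (hblade (j := j) (k := 1) (by omega) (by omega)).mem
    exact ⟨v, by rw [zero_add, hv, level_zero, one_mul]⟩
  · have hb := hblade (j := j) (k := d - 1) (by omega) (by omega)
    rw [show ((d : ℤ) - 1).toNat = d - 1 by omega] at hb
    obtain ⟨v, hv⟩ := hb.exists_mul_eq_volume hV vol (by omega) (hne (by omega) (by omega))
    exact ⟨v, by rw [sub_add_cancel, level_top _ _ (by omega), hv]⟩
  · obtain ⟨v, hv⟩ := hb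
    have hcol := σ.colour_position j
    have h1 := level_eq_step vol u hd hV hσ (j := j) (k := k) h0 (by omega)
    have h2 := level_eq_step vol u hd hV hσ (j := j) (k := k + 1) (by omega) (by omega)
    rw [show k + 1 - (σ.toFun j : ℤ) = k - σ.toFun j + 1 by ring, hv] at h2
    rcases σ.toFun_cases j with ⟨hs, hs'⟩ | ⟨hs, hs'⟩
    · rw [step_black u (hcol.trans hs)] at h1 h2
      exact ⟨v, by rw [h1, h2, LinearMap.mulLeft_apply, LinearMap.mulLeft_apply, mul_assoc]⟩
    · rw [step_white u (hcol.trans hs)] at h1 h2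
      rw [h1, h2]
      refine (hblade (by omega) (by omega)).exists_meet_mul_ι ?_ v
      rw [← h1]
      exact hne (by omega) (by omega)

end Nonvanishing

/-! ### What the conditions of a block say about its end flags -/

section Blocks

variable {V : Type*} [AddCommGroup V] [Module ℂ V] {d : ℕ}
  (vol : VolumeForm V d)

/-- The parts `A⁰ = 1, A¹, …, A^d = e` of a decorated flag. -/
structure IsFlag (A : ℕ → ExteriorAlgebra ℂ V) : Prop where
  zero : A 0 = 1
  top : A d = vol.e
  isBlade : ∀ k ≤ d, IsBlade k (A k)
  ne_zero : ∀ k ≤ d, A k ≠ 0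
  succ : ∀ k < d, ∃ v, A (k + 1) = A k * ExteriorAlgebra.ι ℂ v

theorem part_zero (F : FlagTuple V d) : part vol F 0 = 1 := by
  rw [part, dif_neg (by omega), if_pos rfl]

theorem part_top (hd : 0 < d) (F : FlagTuple V d) : part vol F d = vol.e := by
  rw [part, dif_neg (by omega), if_neg (by omega)]

theorem part_of_le {F : FlagTuple V d} {k : ℕ} (h1 : 1 ≤ k) (h2 : k ≤ d - 1) :
    part vol F k = F ⟨k - 1, by omega⟩ := dif_pos ⟨h1, h2⟩

theorem isDecoratedFlag_iff [FiniteDimensional ℂ V] (hV : finrank ℂ V = d) (hd : 2 ≤ d)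
    (F : FlagTuple V d) : IsDecoratedFlag vol F ↔ IsFlag vol (part vol F) := by
  constructor
  · rintro ⟨h1, h2⟩
    have hb : ∀ k, k ≤ d - 1 → IsBlade k (part vol F k) := by
      intro k
      induction k with
      | zero =>
        intro _
        rw [part_zero]
        exact isBlade_one
      | succ k ih =>
        intro hk
        rcases k with _ | k
        · obtain ⟨v, hv⟩ := exists_eq_ι_of_mem (h1 1 le_rfl hk).1
          rw [zero_add, hv]
          exact isBlade_ι v
        · obtain ⟨v, hv⟩ := h2 (k + 1) (by omega) (by omega)
          rw [hv]
          exact (ih (by omega)).mul_ι v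
    have hne : ∀ k ≤ d, part vol F k ≠ 0 := by
      intro k hk
      rcases Nat.eq_zero_or_pos k with rfl | h0
      · rw [part_zero]
        exact one_ne_zero
      rcases hk.eq_or_lt with rfl | hk
      · rw [part_top _ (by omega)]
        exact volume_ne_zero vol
      · exact (h1 k h0 (by omega)).2
    refine ⟨part_zero vol F, part_top vol (by omega) F, fun k hk => ?_, hne, fun k hk => ?_⟩
    · rcases hk.eq_or_lt with rfl | hk
      · rw [part_top _ (by omega)]
        exact isBlade_volume hV vol
      · exact hb k (by omega)
    · by_cases hk1 : k + 1 = d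
      · obtain rfl : k = d - 1 := by omega
        obtain ⟨v, hv⟩ := (hb (d - 1) le_rfl).exists_mul_eq_volume hV vol (by omega)
          (hne _ (by omega))
        exact ⟨v, by rw [hk1, part_top _ (by omega), hv]⟩
      rcases Nat.eq_zero_or_pos k with rfl | h0
      · obtain ⟨v, hv⟩ := exists_eq_ι_of_mem (h1 1 le_rfl (by omega)).1
        exact ⟨v, by rw [zero_add, hv, part_zero, one_mul]⟩
      · exact h2 k h0 (by omega)
  · intro h
    exact ⟨fun k _ hk => ⟨(h.isBlade k (by omega)).mem, h.ne_zero k (by omega)⟩,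
      fun k _ hk => h.succ k (by omega)⟩

/-- The relative position `s_k` in terms of the parts of flags. -/
def Rel (d : ℕ) (A B : ℕ → ExteriorAlgebra ℂ V) (k : ℕ) : Prop :=
  (∀ i, 1 ≤ i → i ≤ d - 1 → i ≠ k → A i = B i) ∧ ∀ c : ℂ, A k ≠ c • B k

/-- The crossing value `1` in terms of the parts of flags. -/
def Crossing (A B : ℕ → ExteriorAlgebra ℂ V) (k : ℕ) : Prop :=
  ∃ x y : V, A k = ExteriorAlgebra.ι ℂ x * A (k - 1) ∧ B k = A (k - 1) * ExteriorAlgebra.ι ℂ y ∧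
    ExteriorAlgebra.ι ℂ x * A (k - 1) * ExteriorAlgebra.ι ℂ y = A (k + 1)

theorem hasCrossingValue_one_iff (G H : FlagTuple V d) {k : ℕ} (hk : 1 ≤ k) :
    HasCrossingValue vol G H k 1 ↔ Crossing (part vol G) (part vol H) k := by
  have h1 : k - (k - 1) = 1 := by omega
  constructor
  · rintro ⟨z, ⟨x, hx, y, hy, e1, e2, e3⟩, e4⟩
    rw [h1] at hx hy
    obtain ⟨x, rfl⟩ := exists_eq_ι_of_mem hx
    obtain ⟨y, rfl⟩ := exists_eq_ι_of_mem hy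
    exact ⟨x, y, e1, e2, by rw [← e3, e4, one_smul]⟩
  · rintro ⟨x, y, e1, e2, e3⟩
    refine ⟨_, ⟨_, ?_, _, ?_, e1, e2, rfl⟩, by rw [e3, one_smul]⟩
    · rw [h1]
      exact (isBlade_ι x).mem
    · rw [h1]
      exact (isBlade_ι y).mem

/-- A letter k occurs once in a block, so the k-th parts of the flags of the block form a sequence
with a single possible jump. -/
theorem eq_ite_of_forall_eq_succ {α : Type*} {x : ℕ → α} {m t : ℕ}
    (h : ∀ i < m, i ≠ t → x i = x (i + 1)) {i : ℕ} (hi : i ≤ m) :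
    x i = if t < i then x m else x 0 := by
  split_ifs with hti
  · obtain ⟨l, rfl⟩ := Nat.exists_eq_add_of_le hi
    induction l with
    | zero => rfl
    | succ l ih =>
      exact (ih (fun j hj => h j (by omega)) (by omega)).trans (h _ (by omega) (by omega))
  · push Not at hti
    induction i with
    | zero => rfl
    | succ i ih => rw [← h i (by omega) (by omega), ih (by omega) (by omega)]

/-- A flag `A` is obtained from a flag `B` by wedging with the vector `v`. -/
structure IsBlackBlock (d : ℕ) (A B : ℕ → ExteriorAlgebra ℂ V) (v : V) : Prop where
  eq_mul : ∀ k, 1 ≤ k → k < d → A k = ExteriorAlgebra.ι ℂ v * B (k - 1)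
  ne_zero : ExteriorAlgebra.ι ℂ v * B (d - 1) ≠ 0

/-- A flag `A` is obtained from a flag `B` by intersecting with the covector `φ`. -/
structure IsWhiteBlock (d : ℕ) (A B : ℕ → ExteriorAlgebra ℂ V) (φ : Dual ℂ V) : Prop where
  eq_meet : ∀ k, 1 ≤ k → k < d → A k = meet d φ (B (k + 1))
  ne_zero : meet d φ (B 1) ≠ 0

variable {vol} {E : ℕ → ℕ → ExteriorAlgebra ℂ V} {A B : ℕ → ExteriorAlgebra ℂ V}

theorem black_mix (hrel : ∀ i < d - 1, Rel d (E i) (E (i + 1)) (i + 1)) {i k : ℕ}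
    (hi : i ≤ d - 1) (h1 : 1 ≤ k) (hk : k < d) :
    E i k = if k - 1 < i then E (d - 1) k else E 0 k :=
  eq_ite_of_forall_eq_succ (x := fun i => E i k)
    (fun i hi hik => (hrel i hi).1 k h1 (by omega) (by omega)) hi

/-- If Aⁱ⁺¹ = v ∧ Bⁱ and Bⁱ⁺¹ = Bⁱ ∧ y, crossing value 1 gives Aⁱ⁺² = Aⁱ⁺¹ ∧ y = v ∧ Bⁱ⁺¹. At the
last letter, v ∧ B^{d-1} = 0 would make A^{d-1} = v ∧ B^{d-2} a multiple of B^{d-1}, against the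
relative position. -/
theorem isBlackBlock_of_rel (hd : 3 ≤ d) (hE : ∀ i ≤ d - 1, IsFlag vol (E i))
    (hrel : ∀ i < d - 1, Rel d (E i) (E (i + 1)) (i + 1))
    (hcr : ∀ i, i + 1 < d - 1 → Crossing (E i) (E (i + 1)) (i + 1)) {v : V}
    (hv : E 0 1 = ExteriorAlgebra.ι ℂ v) : IsBlackBlock d (E 0) (E (d - 1)) v := by
  have hB : ∀ i ≤ d - 1, E i i = E (d - 1) i := fun i hi => by
    rcases Nat.eq_zero_or_pos i with rfl | h0
    · rw [(hE 0 hi).zero, (hE _ le_rfl).zero]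
    · rw [black_mix hrel hi h0 (by omega), if_pos (by omega)]
  have hA : ∀ i k, i < k → k ≤ d - 1 → E i k = E 0 k := fun i k hi hk => by
    rw [black_mix hrel (by omega) (by omega) (by omega), if_neg (by omega)]
  have heq : ∀ i, i < d - 1 → E 0 (i + 1) = ExteriorAlgebra.ι ℂ v * E (d - 1) i := by
    intro i
    induction i with
    | zero =>
      intro _
      rw [hv, (hE _ le_rfl).zero, mul_one]
    | succ i ih =>
      intro hi
      obtain ⟨x, y, e1, e2, e3⟩ := hcr i hi
      rw [Nat.add_sub_cancel] at e1 e2 e3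
      rw [hA i (i + 1) (by omega) (by omega)] at e1
      rw [hB (i + 1) (by omega)] at e2
      rw [hA i (i + 1 + 1) (by omega) (by omega), ← e1, ih (by omega), mul_assoc,
        ← hB i (by omega), ← e2] at e3
      exact e3.symm
  refine ⟨fun k h1 hk => ?_, fun h0 => ?_⟩
  · have := heq (k - 1) (by omega)
    rwa [Nat.sub_add_cancel h1] at this
  · obtain ⟨y, hy⟩ := (hE _ le_rfl).succ (d - 2) (by omega)
    have h2 := (hrel (d - 2) (by omega)).2
    rw [show d - 2 + 1 = d - 1 by omega, hA _ _ (by omega) le_rfl] at h2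
    rw [show d - 2 + 1 = d - 1 by omega] at hy
    have hne := (hE _ le_rfl).ne_zero (d - 1) (by omega)
    rw [hy] at hne
    rw [hy, ← mul_assoc] at h0
    obtain ⟨c, hc⟩ := ((hE _ le_rfl).isBlade (d - 2) (by omega)).exists_ι_mul_eq_smul hne h0
    have h3 := heq (d - 2) (by omega)
    rw [show d - 2 + 1 = d - 1 by omega, hc, ← hy] at h3
    exact h2 c h3

theorem white_mix (hrel : ∀ i < d - 1, Rel d (E i) (E (i + 1)) (d - 1 - i)) {i k : ℕ}
    (hi : i ≤ d - 1) (h1 : 1 ≤ k) (hk : k < d) :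
    E i k = if d - 1 - k < i then E (d - 1) k else E 0 k :=
  eq_ite_of_forall_eq_succ (x := fun i => E i k)
    (fun i hi hik => (hrel i hi).1 k h1 (by omega) (by omega)) hi

/-- A covector whose contraction kills a nonzero product of vectors vanishes on each factor. -/
theorem IsBlade.contract_eq_zero_of_mul {k : ℕ} {x : ExteriorAlgebra ℂ V} (h : IsBlade k x) {v : V}
    (hv : x * ExteriorAlgebra.ι ℂ v ≠ 0) {φ : Dual ℂ V}
    (hφ : FlagModuli.contract φ (x * ExteriorAlgebra.ι ℂ v) = 0) :
    FlagModuli.contract φ x = 0 := by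
  obtain ⟨c, l, rfl, rfl⟩ := h
  rw [smul_mul_assoc, ← wedge_concat] at hv hφ
  rw [map_smul, smul_eq_zero] at hφ
  have h := forall_eq_zero_of_contract_eq_zero (right_ne_zero_of_smul hv)
    (hφ.resolve_left (left_ne_zero_of_smul hv))
  rw [map_smul, contract_wedge_eq_zero fun w hw => h w (List.mem_append_left _ hw), smul_zero]

theorem meet_ι (φ : Dual ℂ V) (v : V) :
    meet d φ (ExteriorAlgebra.ι ℂ v) = ((-1) ^ (d + 1) * φ v) • 1 := by
  rw [← one_mul (ExteriorAlgebra.ι ℂ v), meet_mul_ι, meet_apply, contract_one, smul_zero, zero_mul,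
    sub_zero]

/-- Let Aᵏ⁺¹ = φ ∩ Bᵏ⁺². Then φ kills Aᵏ⁺¹ and its factor Aᵏ. Crossing value 1 gives Bᵏ⁺² = Aᵏ⁺¹ ∧ y
and Bᵏ⁺¹ = Aᵏ ∧ y with the same y; intersecting the first with φ shows that ±φ(y) = 1, and then the
second gives φ ∩ Bᵏ⁺¹ = Aᵏ. At the last letter, φ ∩ B¹ = 0 would make A¹ a multiple of B¹. -/
theorem isWhiteBlock_of_rel (hd : 3 ≤ d) (hE : ∀ i ≤ d - 1, IsFlag vol (E i))
    (hrel : ∀ i < d - 1, Rel d (E i) (E (i + 1)) (d - 1 - i))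
    (hcr : ∀ i, i + 1 < d - 1 → Crossing (E i) (E (i + 1)) (d - 1 - i)) {φ : Dual ℂ V}
    (hφ : E 0 (d - 1) = meet d φ vol.e) : IsWhiteBlock d (E 0) (E (d - 1)) φ := by
  have hB : ∀ i k, d - k < i + 1 → k ≤ d → i ≤ d - 1 → E i k = E (d - 1) k := by
    intro i k hi hk hid
    rcases hk.eq_or_lt with rfl | hk
    · rw [(hE _ hid).top, (hE _ le_rfl).top]
    · rw [white_mix hrel hid (by omega) hk, if_pos (by omega)]
  have hA : ∀ i k, i ≤ d - 1 - k → 1 ≤ k → k < d → E i k = E 0 k := fun i k hi h1 hk => by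
    rw [white_mix hrel (by omega) h1 hk, if_neg (by omega)]
  have heq : ∀ i, i < d - 1 → E 0 (d - 1 - i) = meet d φ (E (d - 1) (d - i)) := by
    intro i
    induction i with
    | zero =>
      intro _
      rw [Nat.sub_zero, Nat.sub_zero, hφ, (hE _ le_rfl).top]
    | succ i ih =>
      intro hi
      specialize ih (by omega)
      obtain ⟨k, hk⟩ : ∃ k, d - 1 - i = k + 1 := ⟨d - 2 - i, by omega⟩
      obtain ⟨x, y, e1, e2, e3⟩ := hcr i hi
      rw [show d - 1 - (i + 1) = k by omega, show d - (i + 1) = k + 1 by omega]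
      rw [hk, Nat.add_sub_cancel] at e1 e2 e3
      rw [hk, show d - i = k + 2 by omega] at ih
      rw [hA i k (by omega) (by omega) (by omega)] at e1 e2 e3
      rw [hA i (k + 1) (by omega) (by omega) (by omega)] at e1
      rw [hB (i + 1) (k + 1) (by omega) (by omega) (by omega)] at e2
      rw [hB i (k + 2) (by omega) (by omega) (by omega), ← e1] at e3
      have hne := (hE 0 (by omega)).ne_zero (k + 1) (by omega)
      obtain ⟨w, hw⟩ := (hE 0 (by omega)).succ k (by omega)
      have h0 : contract φ (E 0 (k + 1)) = 0 := by
        rw [← meet_eq_zero_iff d, ih, meet_meet]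
      have h1 : contract φ (E 0 k) = 0 := by
        rw [hw] at hne h0
        exact ((hE 0 (by omega)).isBlade k (by omega)).contract_eq_zero_of_mul hne h0
      rw [← e3, meet_mul_ι, (meet_eq_zero_iff d _ _).2 h0, zero_mul, sub_zero] at ih
      have hc : (-1 : ℂ) ^ (d + 1) * φ y = 1 :=
        smul_left_injective ℂ hne (ih.symm.trans (one_smul ℂ _).symm)
      rw [e2, meet_mul_ι, (meet_eq_zero_iff d _ _).2 h1, zero_mul, sub_zero, hc, one_smul]
  refine ⟨fun k h1 hk => ?_, fun h0 => ?_⟩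
  · have := heq (d - 1 - k) (by omega)
    rwa [show d - 1 - (d - 1 - k) = k by omega, show d - (d - 1 - k) = k + 1 by omega] at this
  · have h2 := (hrel (d - 2) (by omega)).2
    rw [show d - 1 - (d - 2) = 1 by omega, hA _ _ (by omega) le_rfl (by omega),
      show d - 2 + 1 = d - 1 by omega] at h2
    obtain ⟨w, hw⟩ := (hE _ le_rfl).succ 1 (by omega)
    have h3 := heq (d - 2) (by omega)
    rw [show d - 1 - (d - 2) = 1 by omega, show d - (d - 2) = 1 + 1 by omega, hw, meet_mul_ι, h0,
      zero_mul, sub_zero] at h3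
    exact h2 _ h3

end Blocks

/-! ### The intermediate flags of a block -/

section Mixing

variable {V : Type*} [AddCommGroup V] [Module ℂ V] {d : ℕ}
  {vol : VolumeForm V d} {A B : ℕ → ExteriorAlgebra ℂ V}

/-- The flag reached from `A` after `i` letters of the word `1 2 ⋯ (d-1)` leading to `B`. -/
def blackMix (d : ℕ) (A B : ℕ → ExteriorAlgebra ℂ V) (i k : ℕ) : ExteriorAlgebra ℂ V :=
  if k - 1 < i ∧ k < d then B k else A k

/-- The flag reached from `A` after `i` letters of the word `(d-1) ⋯ 2 1` leading to `B`. -/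
def whiteMix (d : ℕ) (A B : ℕ → ExteriorAlgebra ℂ V) (i k : ℕ) : ExteriorAlgebra ℂ V :=
  if d - 1 - k < i ∧ 1 ≤ k then B k else A k

/-- The mixed flag consists of parts of B in low degrees and of A in high degrees. The seam is Aᵏ⁺¹
= v ∧ Bᵏ = ±Bᵏ ∧ v. -/
theorem IsBlackBlock.isFlag (hA : IsFlag vol A) (hB : IsFlag vol B) {v : V}
    (h : IsBlackBlock d A B v) {i : ℕ} (hi : i ≤ d - 1) :
    IsFlag vol (blackMix d A B i) := by
  unfold blackMix
  refine ⟨?_, ?_, fun k hk => ?_, fun k hk => ?_, fun k hk => ?_⟩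
  · split_ifs
    exacts [hB.zero, hA.zero]
  · rw [if_neg (by omega), hA.top]
  · split_ifs
    exacts [hB.isBlade k hk, hA.isBlade k hk]
  · split_ifs
    exacts [hB.ne_zero k hk, hA.ne_zero k hk]
  · split_ifs with h1 h2 h2
    · exact hB.succ k hk
    · omega
    · by_cases hkd : k + 1 = d
      · obtain ⟨w, hw⟩ := hB.succ k hk
        exact ⟨w, by rw [← hw, hkd, hA.top, hB.top]⟩
      · refine ⟨(-1 : ℂ) ^ k • v, ?_⟩
        rw [h.eq_mul (k + 1) (by omega) (by omega), Nat.add_sub_cancel,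
          (hB.isBlade k hk.le).ι_mul_eq, map_smul, mul_smul_comm]
    · exact hA.succ k hk

/-- Left multiplication by v kills the parts of A in degrees 1, …, d - 1 but not the corresponding
parts of B. -/
theorem IsBlackBlock.rel (hA : IsFlag vol A) {v : V} (h : IsBlackBlock d A B v) {i : ℕ}
    (hi : i < d - 1) : Rel d (blackMix d A B i) (blackMix d A B (i + 1)) (i + 1) := by
  refine ⟨fun k h1 hk hki => ?_, fun c hc => ?_⟩
  · unfold blackMix
    split_ifs <;> first | rfl | omega
  · rw [blackMix, if_neg (by omega), blackMix, if_pos (by omega)] at hc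
    have h1 : ExteriorAlgebra.ι ℂ v * A (i + 1) = 0 := by
      rw [h.eq_mul _ (by omega) (by omega), ← mul_assoc, ExteriorAlgebra.ι_sq_zero, zero_mul]
    rw [hc, mul_smul_comm, smul_eq_zero] at h1
    have h2 : ExteriorAlgebra.ι ℂ v * B (i + 1) ≠ 0 := by
      by_cases hid : i + 1 = d - 1
      · rw [hid]
        exact h.ne_zero
      · have := hA.ne_zero (i + 2) (by omega)
        rwa [h.eq_mul _ (by omega) (by omega)] at this
    refine hA.ne_zero (i + 1) (by omega) ?_
    rw [hc, h1.resolve_right h2, zero_smul]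

theorem IsBlackBlock.crossing (hA : IsFlag vol A) (hB : IsFlag vol B) {v : V}
    (h : IsBlackBlock d A B v) {i : ℕ} (hi : i + 1 < d - 1) :
    Crossing (blackMix d A B i) (blackMix d A B (i + 1)) (i + 1) := by
  have h0 : blackMix d A B i i = B i := by
    unfold blackMix
    split_ifs with hi'
    · rfl
    · obtain rfl : i = 0 := by omega
      rw [hA.zero, hB.zero]
  have e1 := h.eq_mul (i + 1) (by omega) (by omega)
  have e2 := h.eq_mul (i + 2) (by omega) (by omega)
  obtain ⟨w, hw⟩ := hB.succ i (by omega)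
  refine ⟨v, w, ?_, ?_, ?_⟩
  · rw [Nat.add_sub_cancel, h0, blackMix, if_neg (by omega), e1, Nat.add_sub_cancel]
  · rw [Nat.add_sub_cancel, h0, blackMix, if_pos (by omega), hw]
  · rw [Nat.add_sub_cancel, h0, blackMix, if_neg (by omega), e2, mul_assoc, ← hw]
    rfl

/-- The mixed flag consists of parts of A in low degrees and of B in high degrees. At the seam, Aᵏ =
φ ∩ Bᵏ⁺¹ divides Bᵏ⁺¹, since a nonzero contraction of a blade divides it. -/
theorem IsWhiteBlock.isFlag (hA : IsFlag vol A) (hB : IsFlag vol B) {φ : Dual ℂ V}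
    (h : IsWhiteBlock d A B φ) (i : ℕ) : IsFlag vol (whiteMix d A B i) := by
  unfold whiteMix
  refine ⟨?_, ?_, fun k hk => ?_, fun k hk => ?_, fun k hk => ?_⟩
  · rw [if_neg (by omega), hA.zero]
  · split_ifs
    exacts [hB.top, hA.top]
  · split_ifs
    exacts [hB.isBlade k hk, hA.isBlade k hk]
  · split_ifs
    exacts [hB.ne_zero k hk, hA.ne_zero k hk]
  · split_ifs with h1 h2 h2
    · exact hB.succ k hk
    · rcases Nat.eq_zero_or_pos k with rfl | h0
      · obtain ⟨w, hw⟩ := hB.succ 0 hk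
        exact ⟨w, by rw [hw, hA.zero, hB.zero]⟩
      · have e := h.eq_meet k h0 hk
        have hne := hA.ne_zero k hk.le
        rw [e, meet_apply] at hne
        obtain ⟨w, hw⟩ := (hB.isBlade (k + 1) hk).exists_eq_contract_mul (right_ne_zero_of_smul hne)
        refine ⟨(-1 : ℂ) ^ (d + 1) • w, ?_⟩
        rw [e, meet_apply, map_smul, mul_smul_comm, smul_mul_assoc, smul_smul, ← mul_pow, ← hw]
        simp
    · obtain ⟨w, hw⟩ := hA.succ k hk
      omega
    · exact hA.succ k hk

theorem IsWhiteBlock.rel (hA : IsFlag vol A) {φ : Dual ℂ V} (h : IsWhiteBlock d A B φ) {i : ℕ}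
    (hi : i < d - 1) :
    Rel d (whiteMix d A B i) (whiteMix d A B (i + 1)) (d - 1 - i) := by
  refine ⟨fun k h1 hk hki => ?_, fun c hc => ?_⟩
  · unfold whiteMix
    split_ifs <;> first | rfl | omega
  · obtain ⟨k, hk⟩ : ∃ k, d - 1 - i = k + 1 := ⟨d - 2 - i, by omega⟩
    rw [hk, whiteMix, if_neg (by omega), whiteMix, if_pos (by omega)] at hc
    have h1 : meet d φ (A (k + 1)) = 0 := by
      rw [h.eq_meet _ (by omega) (by omega), meet_meet]
    rw [hc, map_smul, smul_eq_zero] at h1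
    have h2 : meet d φ (B (k + 1)) ≠ 0 := by
      rcases k with _ | k
      · exact h.ne_zero
      · rw [← h.eq_meet _ (by omega) (by omega)]
        exact hA.ne_zero _ (by omega)
    refine hA.ne_zero (k + 1) (by omega) ?_
    rw [hc, h1.resolve_right h2, zero_smul]

theorem IsWhiteBlock.crossing (hA : IsFlag vol A) (hB : IsFlag vol B) {φ : Dual ℂ V}
    (h : IsWhiteBlock d A B φ) {i : ℕ} (hi : i + 1 < d - 1) :
    Crossing (whiteMix d A B i) (whiteMix d A B (i + 1)) (d - 1 - i) := by
  obtain ⟨k, hk⟩ : ∃ k, d - 1 - i = k + 1 := ⟨d - 2 - i, by omega⟩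
  rw [hk]
  have h0 : whiteMix d A B i (k + 1 + 1) = B (k + 2) := by
    unfold whiteMix
    split_ifs with hi'
    · rfl
    · rw [show k + 1 + 1 = d by omega, hA.top, hB.top]
  have e1 := h.eq_meet k (by omega) (by omega)
  have e2 := h.eq_meet (k + 1) (by omega) (by omega)
  obtain ⟨x, hx⟩ := hA.succ k (by omega)
  obtain ⟨w, hw⟩ := hB.succ (k + 1) (by omega)
  obtain ⟨x', hx'⟩ : ∃ x', A (k + 1) = ExteriorAlgebra.ι ℂ x' * A k := by
    refine ⟨(-1 : ℂ) ^ k • x, ?_⟩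
    rw [map_smul, smul_mul_assoc, (hA.isBlade k (by omega)).ι_mul_eq, smul_smul, ← mul_pow, hx]
    simp
  have hne := hA.ne_zero k (by omega)
  rw [e1, meet_apply] at hne
  obtain ⟨y, hy⟩ := (hB.isBlade (k + 1) (by omega)).exists_eq_contract_mul
    (right_ne_zero_of_smul hne)
  obtain ⟨z, hy'⟩ : ∃ z, B (k + 1) = A k * ExteriorAlgebra.ι ℂ z := by
    refine ⟨(-1 : ℂ) ^ (d + 1) • y, ?_⟩
    rw [e1, meet_apply, map_smul, mul_smul_comm, smul_mul_assoc, smul_smul, ← mul_pow, ← hy]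
    simp
  refine ⟨x', z, ?_, ?_, ?_⟩
  · rw [Nat.add_sub_cancel, whiteMix, if_neg (by omega), whiteMix, if_neg (by omega)]
    exact hx'
  · rw [Nat.add_sub_cancel, whiteMix, if_pos (by omega), whiteMix, if_neg (by omega)]
    exact hy'
  -- By the Leibniz rule, Aᵏ⁺¹ = φ ∩ (Bᵏ⁺¹ ∧ w) = ±φ(w) Bᵏ⁺¹ - Aᵏ ∧ w. Multiplication by z kills the
  -- first term, because Bᵏ⁺¹ = Aᵏ ∧ z, and turns the second into Aᵏ ∧ z ∧ w = Bᵏ⁺².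
  · rw [Nat.add_sub_cancel, whiteMix, if_neg (by omega), h0, ← hx', e2, hw, meet_mul_ι, sub_mul,
      smul_mul_assoc, ← e1, hy', mul_assoc, mul_assoc, ExteriorAlgebra.ι_sq_zero, mul_zero,
      smul_zero, zero_sub, mul_assoc, ι_mul_ι_swap w z, mul_neg, neg_neg, ← mul_assoc, ← hy']

end Mixing

/-! ### Indexing the flags of a decoration by block and position -/

section Indexing

variable {V : Type*} [AddCommGroup V] [Module ℂ V] {d n s : ℕ}
  (vol : VolumeForm V d) (σ : Signature n)

/-- The parts of the flag with number `t` of a sequence of flags. -/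
def flagAt (D : Fin (s + 1) → FlagTuple V d) (t : ℕ) : ℕ → ExteriorAlgebra ℂ V :=
  part vol (D (Fin.ofNat (s + 1) t))

theorem flagAt_val (D : Fin (s + 1) → FlagTuple V d) (t : Fin (s + 1)) :
    flagAt vol D t = part vol (D t) := by
  rw [flagAt, Fin.ofNat_val_eq_self]

theorem flagAt_of_le (D : Fin (s + 1) → FlagTuple V d) {t : ℕ} (ht : t ≤ s) :
    flagAt vol D t = part vol (D ⟨t, Nat.lt_succ_of_le ht⟩) :=
  flagAt_val vol D ⟨t, Nat.lt_succ_of_le ht⟩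

/-- The letter number `i` of the block of the vertex `j`. -/
def Signature.letter (d : ℕ) (j : ℤ) (i : ℕ) : ℕ := if σ.toFun j = 1 then i + 1 else d - 1 - i

theorem Signature.one_le_letter {j : ℤ} {i : ℕ} (hi : i < d - 1) : 1 ≤ σ.letter d j i := by
  unfold Signature.letter
  split_ifs <;> omega

variable {σ} in
theorem Signature.word_of_val_eq {p i : ℕ} (hp : p < n) (hi : i < d - 1) {t : Fin (n * (d - 1))}
    (ht : (t : ℕ) = p * (d - 1) + i) :
    (σ.word d).letter t = σ.letter d (p + 1) i ∧ ((σ.word d).marked t ↔ i + 1 = d - 1) := by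
  obtain rfl : t = finProdFinEquiv (⟨p, hp⟩, ⟨i, hi⟩) := Fin.ext (by
    rw [ht, finProdFinEquiv_apply_val]
    simp only
    ring)
  simp only [Signature.word, MarkedWord.concat, Equiv.symm_apply_apply, Signature.letter,
    Signature.colour]
  split_ifs <;> exact ⟨rfl, Iff.rfl⟩

variable {σ} in
-- The index t is written as p (d-1) + i, with p the block of the vertex p + 1; the marked letters
-- are those with i + 1 = d - 1.
theorem mem_signatureModuli_iff [FiniteDimensional ℂ V] (hV : finrank ℂ V = d) (hd : 2 ≤ d)
    {D : Fin (n * (d - 1) + 1) → FlagTuple V d} :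
    D ∈ signatureModuli vol hV σ ↔ (∀ t ≤ n * (d - 1), IsFlag vol (flagAt vol D t)) ∧
      D 0 = D (Fin.last _) ∧ ∀ p < n, ∀ i < d - 1,
        Rel d (flagAt vol D (p * (d - 1) + i)) (flagAt vol D (p * (d - 1) + (i + 1)))
          (σ.letter d (p + 1) i) ∧
        (i + 1 < d - 1 → Crossing (flagAt vol D (p * (d - 1) + i))
          (flagAt vol D (p * (d - 1) + (i + 1))) (σ.letter d (p + 1) i)) := by
  have hflag : (∀ t, IsDecoratedFlag vol (D t)) ↔
      ∀ t ≤ n * (d - 1), IsFlag vol (flagAt vol D t) := by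
    simp only [isDecoratedFlag_iff vol hV hd]
    exact ⟨fun h t ht => by rw [flagAt_of_le vol D ht]; exact h _,
      fun h t => by rw [← flagAt_val]; exact h _ (Nat.le_of_lt_succ t.2)⟩
  have hcast : ∀ t : Fin (n * (d - 1)), part vol (D t.castSucc) = flagAt vol D t :=
    fun t => (flagAt_val vol D t.castSucc).symm
  have hsucc : ∀ t : Fin (n * (d - 1)), part vol (D t.succ) = flagAt vol D (t + 1) :=
    fun t => (flagAt_val vol D t.succ).symm
  have hrel : ∀ (t : Fin (n * (d - 1))) k, RelPosition vol (D t.castSucc) (D t.succ) k ↔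
      Rel d (flagAt vol D t) (flagAt vol D (t + 1)) k := fun t k => by
    rw [← hcast, ← hsucc]
    exact Iff.rfl
  have hcr : ∀ (t : Fin (n * (d - 1))) k, 1 ≤ k →
      (HasCrossingValue vol (D t.castSucc) (D t.succ) k 1 ↔
        Crossing (flagAt vol D t) (flagAt vol D (t + 1)) k) := fun t k hk => by
    rw [← hcast, ← hsucc]
    exact hasCrossingValue_one_iff vol _ _ hk
  change IsNormalizedCyclicDecoration vol (σ.word d) D ↔ _
  rw [IsNormalizedCyclicDecoration, hflag]
  refine and_congr_right fun _ => and_congr_right fun _ => ⟨?_, fun h => ?_⟩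
  · rintro ⟨h1, h2⟩ p hp i hi
    have hlt : p * (d - 1) + i < n * (d - 1) := by nlinarith
    obtain ⟨e1, e2⟩ := Signature.word_of_val_eq (σ := σ) hp hi (t := ⟨_, hlt⟩) rfl
    have h1 := h1 ⟨_, hlt⟩
    have h2 := h2 ⟨_, hlt⟩
    rw [hrel, e1] at h1
    rw [hcr _ _ (by rw [e1]; exact σ.one_le_letter hi), e2, e1] at h2
    exact ⟨h1, fun hi' => h2 hi'.ne⟩
  · have key : ∀ t : Fin (n * (d - 1)), ∃ p < n, ∃ i < d - 1, (t : ℕ) = p * (d - 1) + i :=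
      fun t => ⟨t / (d - 1), Nat.div_lt_of_lt_mul (t.2.trans_eq (mul_comm _ _)), t % (d - 1),
        Nat.mod_lt _ (by omega), (Nat.div_add_mod' _ _).symm⟩
    refine ⟨fun t => ?_, fun t => ?_⟩
    · obtain ⟨p, hp, i, hi, e⟩ := key t
      rw [hrel, (Signature.word_of_val_eq hp hi e).1, e]
      exact (h p hp i hi).1
    · obtain ⟨p, hp, i, hi, e⟩ := key t
      have e' := Signature.word_of_val_eq (σ := σ) hp hi e
      rw [e'.2, e'.1, hcr _ _ (σ.one_le_letter hi), e]
      exact fun hne => (h p hp i hi).2 (by omega)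

/-- The flag number `i` on the way from `A` to `B` along the block of the vertex `j`. -/
def blockMix (d : ℕ) (j : ℤ) (A B : ℕ → ExteriorAlgebra ℂ V) (i : ℕ) :
    ℕ → ExteriorAlgebra ℂ V :=
  if σ.toFun j = 1 then blackMix d A B i else whiteMix d A B i

variable {σ}

/-- A flag `A` is obtained from a flag `B` by the operator `u_j ⋏ ·`. -/
structure IsBlock (u : Conf σ V) (j : ℤ) (A B : ℕ → ExteriorAlgebra ℂ V) : Prop where
  black (h : σ.colour (σ.position j) = 1) : IsBlackBlock d A B (u.1 ⟨_, h⟩)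
  white (h : σ.colour (σ.position j) = -1) : IsWhiteBlock d A B (u.2 ⟨_, h⟩)

variable {vol} {u : Conf σ V} {j : ℤ} {A B : ℕ → ExteriorAlgebra ℂ V}

theorem IsBlock.isFlag (h : IsBlock (d := d) u j A B) (hA : IsFlag vol A) (hB : IsFlag vol B)
    {i : ℕ} (hi : i ≤ d - 1) : IsFlag vol (blockMix σ d j A B i) := by
  rcases σ.toFun_cases j with ⟨hs, -⟩ | ⟨hs, -⟩
  · simpa [blockMix, hs] using (h.black ((σ.colour_position j).trans hs)).isFlag hA hB hi
  · simpa [blockMix, hs] using (h.white ((σ.colour_position j).trans hs)).isFlag hA hB i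

theorem IsBlock.rel (h : IsBlock (d := d) u j A B) (hA : IsFlag vol A) {i : ℕ} (hi : i < d - 1) :
    Rel d (blockMix σ d j A B i) (blockMix σ d j A B (i + 1)) (σ.letter d j i) := by
  rcases σ.toFun_cases j with ⟨hs, -⟩ | ⟨hs, -⟩
  · simpa [blockMix, Signature.letter, hs] using
      (h.black ((σ.colour_position j).trans hs)).rel hA hi
  · simpa [blockMix, Signature.letter, hs] using
      (h.white ((σ.colour_position j).trans hs)).rel hA hi

theorem IsBlock.crossing (h : IsBlock (d := d) u j A B) (hA : IsFlag vol A) (hB : IsFlag vol B)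
    {i : ℕ} (hi : i + 1 < d - 1) :
    Crossing (blockMix σ d j A B i) (blockMix σ d j A B (i + 1)) (σ.letter d j i) := by
  rcases σ.toFun_cases j with ⟨hs, -⟩ | ⟨hs, -⟩
  · simpa [blockMix, Signature.letter, hs] using
      (h.black ((σ.colour_position j).trans hs)).crossing hA hB hi
  · simpa [blockMix, Signature.letter, hs] using
      (h.white ((σ.colour_position j).trans hs)).crossing hA hB hi

variable (σ)

theorem blockMix_zero (d : ℕ) (j : ℤ) (A B : ℕ → ExteriorAlgebra ℂ V) :
    blockMix σ d j A B 0 = A := by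
  ext k
  unfold blockMix
  split_ifs <;> simp [blackMix, whiteMix]

variable (vol)

theorem part_congr (F H : FlagTuple V d) {k : ℕ} (hk : ¬ (1 ≤ k ∧ k ≤ d - 1)) :
    part vol F k = part vol H k := by
  rw [part, part, dif_neg hk, dif_neg hk]

theorem blockMix_part (j : ℤ) (F H : FlagTuple V d) (i : ℕ) {k : ℕ}
    (hk : ¬ (1 ≤ k ∧ k ≤ d - 1)) :
    blockMix σ d j (part vol F) (part vol H) i k = part vol F k := by
  have h := part_congr vol F H hk
  unfold blockMix
  split_ifs
  · rw [blackMix, h, ite_self]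
  · rw [whiteMix, h, ite_self]

theorem blockMix_last (j : ℤ) (F H : FlagTuple V d) :
    blockMix σ d j (part vol F) (part vol H) (d - 1) = part vol H := by
  ext k
  by_cases hk : 1 ≤ k ∧ k ≤ d - 1
  · unfold blockMix
    split_ifs
    · rw [blackMix, if_pos (by omega)]
    · rw [whiteMix, if_pos (by omega)]
  · rw [blockMix_part vol σ j F H _ hk, part_congr vol F H hk]

theorem part_blockMix (j : ℤ) (F H : FlagTuple V d) (i : ℕ) :
    part vol (fun k : Fin (d - 1) => blockMix σ d j (part vol F) (part vol H) i (k + 1)) =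
      blockMix σ d j (part vol F) (part vol H) i := by
  ext k
  by_cases hk : 1 ≤ k ∧ k ≤ d - 1
  · rw [part_of_le vol hk.1 hk.2, Nat.sub_add_cancel hk.1]
  · rw [blockMix_part vol σ j F H _ hk, part_congr vol _ F hk]

end Indexing

theorem Signature.position_add_one {n : ℕ} (σ : Signature n) (j : ℤ) :
    (σ.position (j + 1) : ℕ) = if (σ.position j : ℕ) + 1 = n then 0 else (σ.position j : ℕ) + 1 := by
  have := σ.three_le
  have hp : ∀ j, ((σ.position j : ℕ) : ℤ) = (j - 1) % n :=
    fun j => Int.toNat_of_nonneg (Int.emod_nonneg _ (by omega))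
  have h := Int.emod_add_emod (j - 1) n 1
  rw [show j - 1 + 1 = j + 1 - 1 by ring, ← hp, ← hp] at h
  have hlt := (σ.position j).2
  split_ifs with h'
  · rw [show ((σ.position j : ℕ) : ℤ) + 1 = n by omega, Int.emod_self] at h
    omega
  · rw [Int.emod_eq_of_lt (by omega) (by omega)] at h
    omega

/-! ### From configurations to decorations -/

section Decoration

variable {V : Type*} [AddCommGroup V] [Module ℂ V] [FiniteDimensional ℂ V] {d n : ℕ}
  (vol : VolumeForm V d) {σ : Signature n} (u : Conf σ V)

/-- The decorated flag of the elements `u_j ⋏ u_{j+1} ⋏ ⋯` of degrees `1, …, d - 1`. -/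
def levelFlag (j : ℤ) : FlagTuple V d := fun k => level vol u j ((k : ℕ) + 1)

theorem part_levelFlag (hd : 0 < d) (j : ℤ) {k : ℕ} (hk : k ≤ d) :
    part vol (levelFlag vol u j) k = level vol u j k := by
  rcases Nat.eq_zero_or_pos k with rfl | h0
  · rw [part_zero, Nat.cast_zero, level_zero]
  rcases hk.eq_or_lt with rfl | hk
  · rw [part_top vol hd, level_top _ _ hd]
  · rw [part_of_le vol h0 (by omega), levelFlag]
    congr 1
    simp only
    omega

/-- The cyclic decoration that is determined by a configuration of vectors and covectors. -/
def decoration : Fin (n * (d - 1) + 1) → FlagTuple V d := fun t k =>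
  blockMix σ d ((t / (d - 1) : ℕ) + 1) (part vol (levelFlag vol u ((t / (d - 1) : ℕ) + 1)))
    (part vol (levelFlag vol u ((t / (d - 1) : ℕ) + 1 + 1))) (t % (d - 1)) (k + 1)

/-- The case i = d - 1 is included: the end of a block is the start of the next one, and the two
descriptions agree. -/
theorem flagAt_decoration (hd : 2 ≤ d) {p i : ℕ} (hi : i ≤ d - 1)
    (ht : p * (d - 1) + i ≤ n * (d - 1)) :
    flagAt vol (decoration vol u) (p * (d - 1) + i) =
      blockMix σ d (p + 1) (part vol (levelFlag vol u (p + 1)))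
        (part vol (levelFlag vol u (p + 1 + 1))) i := by
  have key : ∀ p i : ℕ, i < d - 1 → p * (d - 1) + i ≤ n * (d - 1) →
      flagAt vol (decoration vol u) (p * (d - 1) + i) =
        blockMix σ d (p + 1) (part vol (levelFlag vol u (p + 1)))
          (part vol (levelFlag vol u (p + 1 + 1))) i := fun p i hi ht => by
    rw [flagAt_of_le vol _ ht]
    have h1 : (p * (d - 1) + i) / (d - 1) = p := by
      rw [mul_comm, Nat.mul_add_div (by omega), Nat.div_eq_of_lt hi, add_zero]
    have h2 : (p * (d - 1) + i) % (d - 1) = i := by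
      rw [mul_comm, Nat.mul_add_mod, Nat.mod_eq_of_lt hi]
    unfold decoration
    simp only [h1, h2]
    exact part_blockMix vol σ _ _ _ _
  rcases hi.eq_or_lt with rfl | hi
  · rw [← Nat.succ_mul, ← Nat.add_zero (p.succ * (d - 1)), key _ _ (by omega)
      (by rw [Nat.succ_mul]; exact ht), blockMix_zero, blockMix_last, Nat.cast_succ]
  · exact key p i hi ht

omit [FiniteDimensional ℂ V] in
theorem eq_of_flagAt_eq {s : ℕ} {D D' : Fin (s + 1) → FlagTuple V d}
    (h : ∀ t ≤ s, flagAt vol D t = flagAt vol D' t) : D = D' := by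
  ext t k
  have := congrFun (h t (Nat.le_of_lt_succ t.2)) (k + 1)
  rw [flagAt_val, flagAt_val, part_of_le vol (by omega) (by omega),
    part_of_le vol (by omega) (by omega)] at this
  exact this

/-- The vectors and covectors at the beginnings of the blocks. -/
def blockCoord (hd : 3 ≤ d) (hV : finrank ℂ V = d) (σ : Signature n) :
    (Fin (n * (d - 1) + 1) → FlagTuple V d) →ₗ[ℂ] Conf σ V :=
  LinearMap.prod
    (LinearMap.pi fun p => ExteriorAlgebra.ιInv ∘ₗ LinearMap.proj (⟨0, by omega⟩ : Fin (d - 1)) ∘ₗ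
      LinearMap.proj (Fin.ofNat (n * (d - 1) + 1) (p.1 * (d - 1))))
    (LinearMap.pi fun p => ExteriorAlgebra.ιInv ∘ₗ
      (LinearEquiv.ofBijective (psi vol) (psi_bijective vol hV)).symm.toLinearMap ∘ₗ
      LinearMap.proj (⟨d - 2, by omega⟩ : Fin (d - 1)) ∘ₗ
      LinearMap.proj (Fin.ofNat (n * (d - 1) + 1) (p.1 * (d - 1))))

variable (hd : 3 ≤ d) (hV : finrank ℂ V = d) (hσ : σ.IsAdmissible d)

/-- `ιInv` is linear on the whole exterior algebra, so `blockCoord` makes sense for arbitrary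
tuples; it has its intended meaning once the entry is known to be a vector. -/
theorem blockCoord_fst {D : Fin (n * (d - 1) + 1) → FlagTuple V d}
    {p : {p : Fin n // σ.colour p = 1}} {v : V}
    (h : flagAt vol D (p.1 * (d - 1)) 1 = ExteriorAlgebra.ι ℂ v) :
    (blockCoord vol hd hV σ D).1 p = v := by
  rw [flagAt, part_of_le vol le_rfl (by omega)] at h
  exact (congrArg ExteriorAlgebra.ιInv h).trans (ExteriorAlgebra.ι_leftInverse v)

theorem blockCoord_snd {D : Fin (n * (d - 1) + 1) → FlagTuple V d}
    {p : {p : Fin n // σ.colour p = -1}} {φ : Dual ℂ V}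
    (h : flagAt vol D (p.1 * (d - 1)) (d - 1) = psi vol (ExteriorAlgebra.ι ℂ φ)) :
    (blockCoord vol hd hV σ D).2 p = φ := by
  rw [flagAt, part_of_le vol (by omega) le_rfl] at h
  have h' := (LinearEquiv.ofBijective (psi vol) (psi_bijective vol hV)).symm_apply_apply
    (ExteriorAlgebra.ι ℂ φ)
  rw [LinearEquiv.ofBijective_apply, ← h] at h'
  exact (congrArg ExteriorAlgebra.ιInv h').trans (ExteriorAlgebra.ι_leftInverse φ)

include hd hV hσ

theorem decoration_smul (g : SpecialLinearGroup ℂ V) :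
    decoration vol (g • u) = g • decoration vol u := by
  have h : ∀ (j : ℤ) (k : Fin (d - 1)), part vol (levelFlag vol (g • u) j) (k + 1) =
      g • part vol (levelFlag vol u j) (k + 1) := fun j k => by
    rw [part_levelFlag vol _ (by omega) j (by omega), part_levelFlag vol _ (by omega) j (by omega),
      level_smul vol u hd hV hσ g (by omega) (by omega)]
  ext t k
  change decoration vol (g • u) t k = g • decoration vol u t k
  unfold decoration blockMix
  split_ifs
  · unfold blackMix
    split_ifs <;> exact h _ _
  · unfold whiteMix
    split_ifs <;> exact h _ _

theorem isPolyMap_decoration : IsPolyMap (decoration vol : Conf σ V → _) := by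
  have h : ∀ (j : ℤ) (k : Fin (d - 1)),
      IsPolyMap fun u : Conf σ V => part vol (levelFlag vol u j) (k + 1) := fun j k => by
    simp only [part_levelFlag vol _ (show 0 < d by omega) j (show (k : ℕ) + 1 ≤ d by omega)]
    exact isPolyMap_level vol hd hV hσ (by omega) (by omega)
  refine isPolyMap_pi fun t => isPolyMap_pi fun k => ?_
  unfold decoration blockMix
  split_ifs
  · unfold blackMix
    split_ifs <;> exact h _ _
  · unfold whiteMix
    split_ifs <;> exact h _ _

section Generic

variable {u} (hu : frozenProduct vol σ u ≠ 0)

include hu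

theorem isFlag_levelFlag (j : ℤ) : IsFlag vol (part vol (levelFlag vol u j)) := by
  have h := fun {k : ℕ} (hk : k ≤ d) => part_levelFlag vol u (by omega) j hk
  refine ⟨part_zero _ _, part_top vol (by omega) _, fun k hk => ?_, fun k hk => ?_, fun k hk => ?_⟩
  · rw [h hk]
    simpa using isBlade_level vol u hd hV hσ (j := j) (k := k) (by omega) (by omega)
  · rw [h hk]
    exact level_ne_zero vol hd hV hσ hu (by omega) (by omega)
  · rw [h hk.le, h hk, Nat.cast_succ]
    exact exists_level_succ_eq vol hd hV hσ hu (by omega) (by omega)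

/-- The recursion for the levels is the block relation, and f_j ≠ 0 is its condition of
nonvanishing. -/
theorem isBlock_levelFlag (j : ℤ) : IsBlock (d := d) u j (part vol (levelFlag vol u j))
    (part vol (levelFlag vol u (j + 1))) := by
  have h := fun (j : ℤ) {k : ℕ} (hk : k ≤ d) => part_levelFlag vol u (by omega) j hk
  have hf := (frozenProduct_ne_zero_iff vol u hd hV hσ).1 hu j
  have hf' := smul_ne_zero hf (volume_ne_zero vol)
  refine ⟨fun hc => ⟨fun k h1 hk => ?_, ?_⟩, fun hc => ⟨fun k h1 hk => ?_, ?_⟩⟩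
  · have hs := (σ.colour_position j).symm.trans hc
    rw [h j hk.le, h (j + 1) (by omega), level_eq_step vol u hd hV hσ (by omega) (by omega),
      step_black u hc, LinearMap.mulLeft_apply, hs, Nat.cast_pred h1]
    rfl
  · rw [h (j + 1) (by omega), Nat.cast_pred (by omega), ← frozen_black vol u hd hV hσ hc]
    exact hf'
  · have hs := (σ.colour_position j).symm.trans hc
    rw [h j hk.le, h (j + 1) (by omega), level_eq_step vol u hd hV hσ (by omega) (by omega),
      step_white u hc, hs]
    congr 2
  -- For a level b of degree 1, both φ ∩ b and ψ(φ) ∧ b are governed by the same scalar ±φ(b).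
  · rw [h (j + 1) (by omega)]
    intro h0
    rw [frozen_white vol u hd hV hσ hc] at hf'
    obtain ⟨b, hb⟩ := exists_eq_ι_of_mem
      (isBlade_level vol u hd hV hσ (j := j + 1) (k := 1) (by omega) (by omega)).mem
    rw [Nat.cast_one, hb, meet_ι] at h0
    rw [hb, psi_ι_mul_ι hV] at hf'
    rw [(smul_eq_zero.1 h0).resolve_right one_ne_zero, zero_smul] at hf'
    exact hf' rfl

theorem decoration_mem : decoration vol u ∈ signatureModuli vol hV σ := by
  have hF := isFlag_levelFlag vol hd hV hσ hu
  have hB := isBlock_levelFlag vol hd hV hσ hu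
  refine (mem_signatureModuli_iff vol hV (by omega)).2 ⟨fun t ht => ?_, ?_, fun p hp i hi => ?_⟩
  · have hmod := Nat.mod_lt t (y := d - 1) (by omega)
    rw [← Nat.div_add_mod' t (d - 1), flagAt_decoration vol u (by omega) hmod.le
      (by rw [Nat.div_add_mod']; exact ht)]
    exact (hB _).isFlag (hF _) (hF _) hmod.le
  · have h0 := flagAt_decoration vol u (p := 0) (i := 0) (by omega) (by omega) (by omega)
    have h1 := flagAt_decoration vol u (p := n) (i := 0) (by omega) (by omega) (by omega)
    rw [blockMix_zero, Nat.zero_mul, Nat.add_zero, Nat.cast_zero, zero_add] at h0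
    rw [blockMix_zero, Nat.add_zero] at h1
    -- The last index n (d-1) is the start of a block for the vertex n + 1; periodicity of the
    -- levels closes the cycle.
    have h2 : levelFlag vol u (n + 1) = levelFlag vol u 1 := by
      ext k
      rw [levelFlag, levelFlag, add_comm, level_add_period vol u hd hV hσ (by omega) (by omega)]
    rw [h2, ← h0] at h1
    ext k
    have := congrFun h1 (k + 1)
    rw [flagAt_of_le vol _ le_rfl, flagAt_of_le vol _ (Nat.zero_le _),
      part_of_le vol (by omega) (by omega), part_of_le vol (by omega) (by omega)] at this
    exact this.symm
  · have hlt : p * (d - 1) + (i + 1) ≤ n * (d - 1) := by nlinarith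
    rw [flagAt_decoration vol u (by omega) hi.le (by omega),
      flagAt_decoration vol u (by omega) (by omega) hlt]
    exact ⟨(hB _).rel (hF _) hi, (hB _).crossing (hF _) (hF _)⟩

theorem blockCoord_decoration : blockCoord vol hd hV σ (decoration vol u) = u := by
  have hB := isBlock_levelFlag vol hd hV hσ hu
  have hF := isFlag_levelFlag vol hd hV hσ hu
  have key : ∀ p : Fin n, flagAt vol (decoration vol u) (p * (d - 1)) =
      part vol (levelFlag vol u ((p : ℕ) + 1)) := fun p => by
    have := flagAt_decoration vol u (p := p) (i := 0) (by omega) (by omega)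
      (by nlinarith [p.2])
    rwa [blockMix_zero, Nat.add_zero] at this
  refine Prod.ext (funext fun p => ?_) (funext fun p => ?_)
  · refine blockCoord_fst vol hd hV ?_
    have hp := σ.position_val_add_one p.1
    rw [key, ((hB ((p.1 : ℕ) + 1)).black (by rw [hp]; exact p.2)).eq_mul 1 le_rfl (by omega),
      Nat.sub_self, (hF _).zero, mul_one]
    exact congrArg (fun q => ExteriorAlgebra.ι ℂ (u.1 q)) (Subtype.ext hp)
  · refine blockCoord_snd vol hd hV ?_
    have hp := σ.position_val_add_one p.1
    rw [key, ((hB ((p.1 : ℕ) + 1)).white (by rw [hp]; exact p.2)).eq_meet (d - 1) (by omega)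
      (by omega), Nat.sub_add_cancel (by omega), (hF _).top, psi_ι]
    exact congrArg (fun q => meet d (u.2 q) vol.e) (Subtype.ext hp)

end Generic

end Decoration

/-! ### From decorations to configurations -/

section Reconstruction

variable {V : Type*} [AddCommGroup V] [Module ℂ V] [FiniteDimensional ℂ V] {d n : ℕ}
  (vol : VolumeForm V d) {σ : Signature n}
  (hd : 3 ≤ d) (hV : finrank ℂ V = d) (hσ : σ.IsAdmissible d)
  {D : Fin (n * (d - 1) + 1) → FlagTuple V d} (hD : D ∈ signatureModuli vol hV σ)

include hD

theorem isBlock_flagAt {p : ℕ} (hp : p < n) :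
    IsBlock (d := d) (blockCoord vol hd hV σ D) (p + 1) (flagAt vol D (p * (d - 1)))
      (flagAt vol D (p * (d - 1) + (d - 1))) := by
  obtain ⟨h1, -, h2⟩ := (mem_signatureModuli_iff vol hV (by omega)).1 hD
  specialize h2 p hp
  have hle : p * (d - 1) + (d - 1) ≤ n * (d - 1) := by nlinarith
  have hE : ∀ i ≤ d - 1, IsFlag vol (flagAt vol D (p * (d - 1) + i)) :=
    fun i hi => h1 _ (by omega)
  have hpos : σ.position (p + 1) = ⟨p, hp⟩ := σ.position_val_add_one ⟨p, hp⟩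
  refine ⟨fun hc => ?_, fun hc => ?_⟩
  · have hs : σ.toFun (p + 1) = 1 := (σ.colour_position _).symm.trans hc
    simp only [Signature.letter, if_pos hs] at h2
    obtain ⟨v, hv⟩ := exists_eq_ι_of_mem ((hE 0 (by omega)).isBlade 1 (by omega)).mem
    have := isBlackBlock_of_rel (E := fun i => flagAt vol D (p * (d - 1) + i)) hd hE
      (fun i hi => (h2 i hi).1) (fun i hi => (h2 i (by omega)).2 hi) hv
    rw [blockCoord_fst vol hd hV (p := ⟨_, hc⟩) (v := v)
      ((congrArg (fun q : Fin n => flagAt vol D (q * (d - 1)) 1) hpos).trans hv)]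
    exact this
  · have hs : σ.toFun (p + 1) = -1 := (σ.colour_position _).symm.trans hc
    simp only [Signature.letter, if_neg (show ¬ σ.toFun (p + 1) = 1 by rw [hs]; decide)] at h2
    obtain ⟨φ, hφ⟩ := ((hE 0 (by omega)).isBlade (d - 1) (by omega)).exists_eq_psi_ι hV vol
      (by omega) ((hE 0 (by omega)).ne_zero _ (by omega))
    have := isWhiteBlock_of_rel (E := fun i => flagAt vol D (p * (d - 1) + i)) hd hE
      (fun i hi => (h2 i hi).1) (fun i hi => (h2 i (by omega)).2 hi)
      (hφ.trans (psi_ι vol φ))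
    rw [blockCoord_snd vol hd hV (p := ⟨_, hc⟩) (φ := φ)
      ((congrArg (fun q : Fin n => flagAt vol D (q * (d - 1)) (d - 1)) hpos).trans hφ)]
    exact this

omit [FiniteDimensional ℂ V] hD in
theorem flagAt_position_add_one (hD : D 0 = D (Fin.last _)) (j : ℤ) :
    flagAt vol D (σ.position (j + 1) * (d - 1)) =
      flagAt vol D (σ.position j * (d - 1) + (d - 1)) := by
  rw [σ.position_add_one, ← Nat.succ_mul]
  split_ifs with h
  · rw [Nat.succ_eq_add_one, h, Nat.zero_mul, flagAt_of_le vol D (Nat.zero_le _),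
      flagAt_of_le vol D le_rfl]
    exact congrArg _ hD
  · rfl

theorem isBlock_flagAt_position (j : ℤ) :
    IsBlock (d := d) (blockCoord vol hd hV σ D) j (flagAt vol D (σ.position j * (d - 1)))
      (flagAt vol D (σ.position (j + 1) * (d - 1))) := by
  have h := isBlock_flagAt vol hd hV hD (σ.position j).2
  rw [flagAt_position_add_one vol ((mem_signatureModuli_iff vol hV (by omega)).1 hD).2.1]
  have hp := σ.position_val_add_one (σ.position j)
  constructor
  · intro hc
    have := h.black (by rw [hp]; exact hc)
    simpa only [hp] using this
  · intro hc
    have := h.white (by rw [hp]; exact hc)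
    simpa only [hp] using this

include hσ

/-- The flags at the starts of the blocks, extended periodically to all of ℤ, satisfy the recursion
of the levels, which has a unique solution. -/
theorem flagAt_position (j : ℤ) : flagAt vol D (σ.position j * (d - 1)) =
    part vol (levelFlag vol (blockCoord vol hd hV σ D) j) := by
  ext k
  by_cases hk : 1 ≤ k ∧ k ≤ d - 1
  swap
  · exact part_congr vol _ _ hk
  have hfl : ∀ p : Fin n, IsFlag vol (flagAt vol D (p * (d - 1))) := fun p =>
    ((mem_signatureModuli_iff vol hV (by omega)).1 hD).1 _ (by nlinarith [p.2])
  have h := eq_level vol (blockCoord vol hd hV σ D) hd hV hσ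
    (F := fun j k => flagAt vol D (σ.position j * (d - 1)) k.toNat) (fun j => (hfl _).zero)
    (fun j => by simpa using (hfl _).top) (fun j k h0 hk => ?_) (j := j) (k := k)
    (by omega) (by omega)
  · rw [part_levelFlag _ _ (by omega) _ (by omega), ← h, Int.toNat_natCast]
  · have hB := isBlock_flagAt_position vol hd hV hD j
    rcases σ.toFun_cases j with ⟨hs, hs'⟩ | ⟨hs, hs'⟩
    · have hc := (σ.colour_position j).trans hs
      rw [step_black _ hc, LinearMap.mulLeft_apply, hs',
        (hB.black hc).eq_mul k.toNat (by omega) (by omega),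
        show (k - 1).toNat = k.toNat - 1 by omega]
    · have hc := (σ.colour_position j).trans hs
      rw [step_white _ hc, hs', (hB.white hc).eq_meet k.toNat (by omega) (by omega),
        show (k - -1).toNat = k.toNat + 1 by omega]

theorem frozenProduct_blockCoord_ne_zero :
    frozenProduct vol σ (blockCoord vol hd hV σ D) ≠ 0 := by
  refine (frozenProduct_ne_zero_iff vol _ hd hV hσ).2 fun j h0 => ?_
  have hB := isBlock_flagAt_position vol hd hV hD j
  have h := fun k (hk : k ≤ d) => (congrFun (flagAt_position vol hd hV hσ hD (j + 1)) k).trans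
    (part_levelFlag vol _ (by omega) (j + 1) hk)
  rcases Int.units_eq_one_or (σ.colour (σ.position j)) with hc | hc
  · refine (hB.black hc).ne_zero ?_
    rw [h _ (by omega), Nat.cast_pred (by omega), ← frozen_black vol _ hd hV hσ hc, h0, zero_smul]
  · refine (hB.white hc).ne_zero ?_
    have hf := frozen_white vol (blockCoord vol hd hV σ D) hd hV hσ hc
    obtain ⟨b, hb⟩ := exists_eq_ι_of_mem
      (isBlade_level vol (blockCoord vol hd hV σ D) hd hV hσ (j := j + 1) (k := 1)
        (by omega) (by omega)).mem
    rw [h0, zero_smul, hb, psi_ι_mul_ι hV] at hf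
    rw [h 1 (by omega), Nat.cast_one, hb, meet_ι,
      (smul_eq_zero.1 hf.symm).resolve_right (volume_ne_zero vol), zero_smul]

omit hσ in
theorem flagAt_eq_blockMix {p i : ℕ} (hp : p < n) (hi : i ≤ d - 1) :
    flagAt vol D (p * (d - 1) + i) = blockMix σ d (p + 1) (flagAt vol D (p * (d - 1)))
      (flagAt vol D (p * (d - 1) + (d - 1))) i := by
  ext k
  by_cases hk : 1 ≤ k ∧ k ≤ d - 1
  swap
  · exact (part_congr vol _ _ hk).trans (blockMix_part vol σ _ _ _ i hk).symm
  have h2 := ((mem_signatureModuli_iff vol hV (by omega)).1 hD).2.2 p hp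
  rcases σ.toFun_cases (p + 1) with ⟨hs, -⟩ | ⟨hs, -⟩
  · simp only [Signature.letter, if_pos hs] at h2
    rw [blockMix, if_pos hs, blackMix]
    simpa [show k < d by omega] using
      black_mix (E := fun i => flagAt vol D (p * (d - 1) + i)) (fun i hi => (h2 i hi).1) hi
        hk.1 (by omega)
  · have hs' : ¬ σ.toFun (p + 1) = 1 := by
      rw [hs]
      decide
    simp only [Signature.letter, if_neg hs'] at h2
    rw [blockMix, if_neg hs', whiteMix]
    simpa [hk.1] using
      white_mix (E := fun i => flagAt vol D (p * (d - 1) + i)) (fun i hi => (h2 i hi).1) hi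
        hk.1 (by omega)

theorem decoration_blockCoord : decoration vol (blockCoord vol hd hV σ D) = D := by
  refine eq_of_flagAt_eq vol fun t ht => ?_
  have hcyc := ((mem_signatureModuli_iff vol hV (by omega)).1 hD).2.1
  have hstart : ∀ p < n, flagAt vol D (p * (d - 1)) =
      part vol (levelFlag vol (blockCoord vol hd hV σ D) (p + 1)) := fun p hp => by
    have := flagAt_position vol hd hV hσ hD (p + 1)
    rwa [σ.position_val_add_one ⟨p, hp⟩] at this
  have hnext : ∀ p < n, flagAt vol D (p * (d - 1) + (d - 1)) =
      part vol (levelFlag vol (blockCoord vol hd hV σ D) (p + 1 + 1)) := fun p hp => by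
    have := flagAt_position_add_one vol (σ := σ) hcyc (p + 1)
    rw [flagAt_position vol hd hV hσ hD, σ.position_val_add_one ⟨p, hp⟩] at this
    exact this.symm
  have key : ∀ p < n, ∀ i ≤ d - 1, flagAt vol (decoration vol (blockCoord vol hd hV σ D))
      (p * (d - 1) + i) = flagAt vol D (p * (d - 1) + i) := fun p hp i hi => by
    rw [flagAt_decoration vol _ (by omega) hi (by nlinarith),
      flagAt_eq_blockMix vol hV hD hp hi, hstart p hp, hnext p hp]
  -- The last index lies in no block p < n as a start; it is reached as the end of block n - 1.
  rcases ht.lt_or_eq with ht | rfl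
  · have := key (t / (d - 1)) (Nat.div_lt_of_lt_mul (ht.trans_eq (mul_comm _ _)))
      (t % (d - 1)) (Nat.mod_lt _ (by omega)).le
    rwa [Nat.div_add_mod'] at this
  · have h3 := σ.three_le
    have := key (n - 1) (by omega) (d - 1) le_rfl
    rwa [← Nat.succ_mul, Nat.succ_eq_add_one, Nat.sub_add_cancel (by omega)] at this

end Reconstruction

/-! ### The isomorphism and the invariant functions -/

section Model

variable {V : Type*} [AddCommGroup V] [Module ℂ V] [FiniteDimensional ℂ V] {d n : ℕ}
  (hd : 3 ≤ d) (hV : finrank ℂ V = d) (vol : VolumeForm V d)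
  {σ : Signature n} (hσ : σ.IsAdmissible d)

/-- The identification of the cyclic decorated flag moduli space with the generic
configurations. -/
def moduliModel : PrincipalOpenModel (signatureModuli vol hV σ) (frozenProduct vol σ) where
  param := decoration vol
  coord := blockCoord vol hd hV σ
  isPolyMap_param := isPolyMap_decoration vol hd hV hσ
  isPolyMap_coord := isPolyMap_linear _
  f_mem := frozenProduct_mem_polyFun vol hd hV hσ
  f_smul g u := frozenProduct_smul vol u hd hV hσ g
  f_coord _ hD := frozenProduct_blockCoord_ne_zero vol hd hV hσ hD
  param_coord _ hD := decoration_blockCoord vol hd hV hσ hD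
  param_mem _ hu := decoration_mem vol hd hV hσ hu
  coord_param _ hu := blockCoord_decoration vol hd hV hσ hu
  param_smul g u := decoration_smul vol u hd hV hσ g

omit [FiniteDimensional ℂ V] in
theorem isPolyMap_conf_smul (g : SpecialLinearGroup ℂ V) :
    IsPolyMap (fun u : Conf σ V => g • u) :=
  isPolyMap_linear
    ({ toFun := fun u => g • u
       map_add' := fun _ _ => Prod.ext (funext fun _ => map_add (g : V ≃ₗ[ℂ] V) _ _)
        (funext fun _ => LinearMap.add_comp _ _ _)
       map_smul' := fun _ _ => Prod.ext (funext fun _ => map_smul (g : V ≃ₗ[ℂ] V) _ _)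
        (funext fun _ => LinearMap.smul_comp _ _ _) } : Conf σ V →ₗ[ℂ] Conf σ V)

end Model

end FlagModuli

end

open FlagModuli

theorem mainTheorem7 {V : Type*} [AddCommGroup V] [Module ℂ V] [FiniteDimensional ℂ V] {d n : ℕ}
    (hd : 3 ≤ d) (hV : Module.finrank ℂ V = d) (vol : VolumeForm V d)
    (σ : Signature n) (hσ : σ.IsAdmissible d) :
    @IsLocallyClosed _ (zariski (Fin (n * (d - 1) + 1) → FlagTuple V d))
      (signatureModuli vol hV σ).carrier ∧
    ∃ (hf : frozenProduct vol σ ∈ mixedPluckerRing σ V)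
      (Φ : ↥(signatureModuli vol hV σ : Set (Fin (n * (d - 1) + 1) → FlagTuple V d)) ≃
        ↥(genericConf vol σ)),
      IsRegularMap Φ ∧ IsRegularMap Φ.symm ∧
      (∀ (g : SpecialLinearGroup ℂ V) (D : signatureModuli vol hV σ),
        (Φ (g • D) : Conf σ V) = g • (Φ D : Conf σ V)) ∧
      (∃ E : Localization.Away (⟨frozenProduct vol σ, hf⟩ : mixedPluckerRing σ V) ≃ₐ[ℂ]
          regularInvariants (signatureModuli vol hV σ),
        ∀ (r : mixedPluckerRing σ V) (D : signatureModuli vol hV σ),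
          (E (algebraMap _ _ r)).1 D = r.1 (Φ D)) ∧
      ((genericConf vol σ).Nonempty →
        ∃ E : FractionRing (mixedPluckerRing σ V) ≃ₐ[ℂ]
            rationalInvariants (signatureModuli vol hV σ),
          ∀ r : mixedPluckerRing σ V,
            (E (algebraMap _ _ r)).1 = Filter.Germ.ofFun fun D => r.1 (Φ D)) := by
  let P := moduliModel hd hV vol hσ
  have hR : ∀ p : Conf σ V → ℂ, p ∈ mixedPluckerRing σ V ↔ p ∈ polyFun (Conf σ V) ∧
      ∀ (g : SpecialLinearGroup ℂ V) (u : Conf σ V), p (g • u) = p u := fun _ => Iff.rfl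
  have hf : frozenProduct vol σ ∈ mixedPluckerRing σ V := ⟨P.f_mem, P.f_smul⟩
  refine ⟨P.isLocallyClosed, hf, P.equiv, P.isRegularMap_equiv, P.isRegularMap_equiv_symm,
    fun g D => P.coord_smul g D.2, P.exists_localizationEquiv hR hf, fun hne => ?_⟩
  obtain ⟨u, hu⟩ := hne
  -- A generic configuration serves only to show that f is not the zero polynomial.
  exact P.exists_fractionRingEquiv (fun h => hu (congrFun h u)) hR isPolyMap_conf_smul
    (character_eq_one (by omega))
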